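/- Let $k$ be a field of characteristic $0$, $\otimes=\otimes_k$, and fix $c\in k\setminus\{0,1,-1\}$. A double bracket on a $k$-algebra $A$ is a $k$-bilinear map $\{\!\{-,-\}\!\}:A\times A\to A\otimes A$ with $\{\!\{a,b\}\!\}=-\{\!\{b,a\}\!\}^\circ$ (where $(d'\otimes d'')^\circ=d''\otimes d'$) and $\{\!\{a,be\}\!\}=\{\!\{a,b\}\!\}e+b\{\!\{a,e\}\!\}$ for the outer bimodule structure. With $\tau(a_1\otimes a_2\otimes a_3)=a_3\otimes a_1\otimes a_2$, it is quasi-Poisson if $\{\!\{a,b,d\}\!\}:=\{\!\{a,\{\!\{b,d\}\!\}'\}\!\}\otimes\{\!\{b,d\}\!\}''+\tau\big(\{\!\{b,\{\!\{d,a\}\!\}'\}\!\}\otimes\{\!\{d,a\}\!\}''\big)+\tau^2\big(\{\!\{d,\{\!\{a,b\}\!\}'\}\!\}\otimes\{\!\{a,b\}\!\}''\big)$ equals $\tfrac14\big(da\otimes b\otimes 1-da\otimes1\otimes b-d\otimes ab\otimes 1+d\otimes a\otimes b-a\otimes b\otimes d+a\otimes1\otimes bd+1\otimes ab\otimes d-1\otimes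 a\otimes bd\big)$ for all $a,b,d\in A$. A multiplicative moment map is an invertible $\Phi\in A$ with $\{\!\{\Phi,a\}\!\}=\tfrac12(a\otimes\Phi-1\otimes\Phi a+a\Phi\otimes1-\Phi\otimes a)$ for all $a$. A quasi-Hamiltonian structure on $A$ is a double quasi-Poisson bracket together with a multiplicative moment map; an isomorphism of quasi-Hamiltonian algebras is an algebra isomorphism intertwining the double brackets and matching the moment maps. Let $F=k\langle x,y\rangle_S$ be the universal localisation at $S=\{1+xy,1+yx\}$, and let $B_1^c=(A_1^c)_{1+xy}$ be the localisation at $1+xy$ of $A_1^c=k\langle x,y\rangle/(1+xy-c(1+yx))$. Then the following hold. 1. $F$ has quasi-Hamiltonian structures $H_1$ and $H_2$, given for $H_1$ (upper signs) and $H_2$ (lower signs) by $\{\!\{x,x\}\!\}=\mp\tfrac12(x^2\otimes1-1\otimes x^2)$, $\{\!\{y,y\}\!\}=\pm\tfrac12(y^2\otimes1-1\otimes y^2)$, $\{\!\{y,x\}\!\}=1\otimes1+\tfrac12\big(xy\otimes1+1\otimes yx\pm(x\otimes y-y\otimes x)\big)$, with moment maps $\Phi_1=(1+yx)(1+xy)^{-1}$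 and $\Phi_2=(1+xy)^{-1}(1+yx)$ respectively. 2. The algebra map $\pi:F\to B_1^c$, $x\mapsto x$, $y\mapsto y$, is surjective, and for $i=1,2$ its kernel is the two-sided ideal generated by $\Phi_i-c^{-1}$. 3. There are algebra automorphisms of $F$ with $\psi:x\mapsto x(1+xy),\ y\mapsto(1+xy)^{-1}y$; $\ \xi:x\mapsto-(1+yx)^{-1}y,\ y\mapsto x$; $\ \varphi_\beta:x\mapsto\beta^{-1}x,\ y\mapsto\beta y$ ($\beta\in k^\times$). Both $\psi$ and $\xi$ are isomorphisms of quasi-Hamiltonian algebras $(F,H_1)\to(F,H_2)$, and each $\varphi_\beta$ is an automorphism of both $(F,H_1)$ and $(F,H_2)$. They induce automorphisms of $B_1^c$ along $\pi$, and these induced automorphisms generate the group $\operatorname{Aut}_k(B_1^c)$. 4. Every $k$-algebra automorphism $\sigma$ of $B_1^c$ is induced by an isomorphism of quasi-Hamiltonian algebras on $F$, possibly between different structures: there are $i,j\in\{1,2\}$ and an isomorphism of quasi-Hamiltonian algebras $f:(F,H_i)\to(F,H_j)$ with $\sigma\circ\pi=\pi\circ f$. -/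

import Mathlib

open scoped TensorProduct

noncomputable section

namespace QuasiHam

/-! ### Double brackets and quasi-Hamiltonian algebras

Algebras are taken over the base `B = k`, i.e. the unit is decomposed with the single idempotent
`1`. Then `B`-linearity of a double bracket (`{1, a} = {a, 1} = 0`) follows from the derivation
rules. -/

section Brackets

variable (k A : Type*) [Field k] [Ring A] [Algebra k A]

/-- A double bracket on `A`: a `k`-bilinear map `A × A → A ⊗ A` which satisfies cyclic antisymmetry
and is a derivation in its second argument for the outer bimodule structure. Multiplying by
`b ⊗ 1` on the left or by `1 ⊗ c` on the right, in the algebra `A ⊗ A`, is the outer action. -/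
structure DoubleBracket where
  /-- the underlying bilinear map -/
  br : A →ₗ[k] A →ₗ[k] A ⊗[k] A
  cyclic_antisymm : ∀ a b : A, br a b = -(TensorProduct.comm k A A (br b a))
  deriv_right : ∀ a b c : A, br a (b * c) = br a b * (1 ⊗ₜ c) + (b ⊗ₜ 1) * br a c

variable {k A}

/-- `cyc (a₁ ⊗ a₂ ⊗ a₃) = a₃ ⊗ a₁ ⊗ a₂`. -/
def cyc : (A ⊗[k] A) ⊗[k] A →ₗ[k] (A ⊗[k] A) ⊗[k] A :=
  (TensorProduct.assoc k A A A).symm.toLinearMap ∘ₗ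
    (TensorProduct.comm k (A ⊗[k] A) A).toLinearMap

theorem cyc_tmul (a b c : A) : cyc (k := k) ((a ⊗ₜ b) ⊗ₜ c) = (c ⊗ₜ a) ⊗ₜ b := by
  simp [cyc]

namespace DoubleBracket

/-- `{a, {b, c}'} ⊗ {b, c}''`. -/
def nested (P : DoubleBracket k A) (a b c : A) : (A ⊗[k] A) ⊗[k] A :=
  LinearMap.rTensor A (P.br a) (P.br b c)

/-- The triple bracket associated with a double bracket. -/
def triple (P : DoubleBracket k A) (a b c : A) : (A ⊗[k] A) ⊗[k] A :=
  P.nested a b c + cyc (P.nested b c a) + cyc (cyc (P.nested c a b))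

/-- A double bracket is quasi-Poisson if its triple bracket is the distinguished one. -/
def IsQuasiPoisson (P : DoubleBracket k A) : Prop :=
  ∀ a b c : A, P.triple a b c = (4 : k)⁻¹ •
    ((((c * a) ⊗ₜ[k] b) ⊗ₜ[k] (1 : A)) - (((c * a) ⊗ₜ[k] (1 : A)) ⊗ₜ[k] b)
      - ((c ⊗ₜ[k] (a * b)) ⊗ₜ[k] (1 : A)) + ((c ⊗ₜ[k] a) ⊗ₜ[k] b)
      - ((a ⊗ₜ[k] b) ⊗ₜ[k] c) + ((a ⊗ₜ[k] (1 : A)) ⊗ₜ[k] (b * c))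
      + (((1 : A) ⊗ₜ[k] (a * b)) ⊗ₜ[k] c) - (((1 : A) ⊗ₜ[k] a) ⊗ₜ[k] (b * c)))

/-- A multiplicative moment map: an invertible element with the multiplicative property. -/
def IsMomentMap (P : DoubleBracket k A) (Φ : A) : Prop :=
  IsUnit Φ ∧ ∀ a : A, P.br Φ a = (2 : k)⁻¹ •
    (a ⊗ₜ[k] Φ - (1 : A) ⊗ₜ[k] (Φ * a) + (a * Φ) ⊗ₜ[k] (1 : A) - Φ ⊗ₜ[k] a)

end DoubleBracket

variable (k A) in
/-- A quasi-Hamiltonian algebra structure on `A`: a double quasi-Poisson bracket together with a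
multiplicative moment map. -/
structure QuasiHamiltonian extends DoubleBracket k A where
  quasiPoisson : toDoubleBracket.IsQuasiPoisson
  /-- the multiplicative moment map -/
  moment : A
  isMomentMap : toDoubleBracket.IsMomentMap moment

/-- An isomorphism of quasi-Hamiltonian algebras: an isomorphism of algebras which intertwines the
double brackets and maps one moment map to the other. -/
def IsQuasiHamiltonianIso {A₁ A₂ : Type*} [Ring A₁] [Algebra k A₁] [Ring A₂] [Algebra k A₂]
    (H₁ : QuasiHamiltonian k A₁) (H₂ : QuasiHamiltonian k A₂) (f : A₁ ≃ₐ[k] A₂) : Prop :=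
  (∀ a b : A₁, H₂.br (f a) (f b) =
    TensorProduct.map f.toLinearMap f.toLinearMap (H₁.br a b)) ∧
  f H₁.moment = H₂.moment

end Brackets

/-! ### Universal localisation of an algebra at a set of elements -/

section Localisation

variable {k A : Type*} [Field k] [Ring A] [Algebra k A]

variable (k) in
/-- Relations of the universal localisation: `Sum.inl a` stands for `a : A`, and `Sum.inr s` for the
formal inverse of `s ∈ S`. -/
inductive UnivLocRel (S : Set A) : FreeAlgebra k (A ⊕ S) → FreeAlgebra k (A ⊕ S) → Prop
  | add (a b : A) : UnivLocRel S (FreeAlgebra.ι k (Sum.inl (a + b)))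
      (FreeAlgebra.ι k (Sum.inl a) + FreeAlgebra.ι k (Sum.inl b))
  | mul (a b : A) : UnivLocRel S (FreeAlgebra.ι k (Sum.inl (a * b)))
      (FreeAlgebra.ι k (Sum.inl a) * FreeAlgebra.ι k (Sum.inl b))
  | scalar (r : k) : UnivLocRel S (FreeAlgebra.ι k (Sum.inl (algebraMap k A r)))
      (algebraMap k (FreeAlgebra k (A ⊕ S)) r)
  | mul_inv (s : S) :
      UnivLocRel S (FreeAlgebra.ι k (Sum.inl (s : A)) * FreeAlgebra.ι k (Sum.inr s)) 1
  | inv_mul (s : S) :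
      UnivLocRel S (FreeAlgebra.ι k (Sum.inr s) * FreeAlgebra.ι k (Sum.inl (s : A))) 1

variable (k) in
/-- The universal localisation `A_S`: the universal `k`-algebra under `A` in which all elements of
`S` become invertible. -/
def UnivLoc (S : Set A) : Type _ := RingQuot (UnivLocRel k S)

namespace UnivLoc

variable (S : Set A)

instance : Ring (UnivLoc k S) := inferInstanceAs (Ring (RingQuot (UnivLocRel k S)))

instance : Algebra k (UnivLoc k S) := inferInstanceAs (Algebra k (RingQuot (UnivLocRel k S)))

/-- The quotient map from the free algebra. -/
def mk : FreeAlgebra k (A ⊕ S) →ₐ[k] UnivLoc k S := RingQuot.mkAlgHom k (UnivLocRel k S)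

theorem mk_rel {p q : FreeAlgebra k (A ⊕ S)} (h : UnivLocRel k S p q) : mk S p = mk S q :=
  RingQuot.mkAlgHom_rel k h

/-- The canonical map `A → A_S`. -/
def of : A →ₐ[k] UnivLoc k S where
  toFun a := mk S (FreeAlgebra.ι k (Sum.inl a))
  map_one' := by
    have h := mk_rel S (UnivLocRel.scalar (S := S) (1 : k))
    simpa using h
  map_mul' a b := by
    have h := mk_rel S (UnivLocRel.mul (k := k) (S := S) a b)
    simpa using h
  map_zero' := by
    have h := mk_rel S (UnivLocRel.scalar (S := S) (0 : k))
    simpa using h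
  map_add' a b := by
    have h := mk_rel S (UnivLocRel.add (k := k) (S := S) a b)
    simpa using h
  commutes' r := by
    have h := mk_rel S (UnivLocRel.scalar (S := S) r)
    simpa using h

/-- An element of `S`, as a unit of `A_S`. -/
def unit (s : S) : (UnivLoc k S)ˣ where
  val := of S (s : A)
  inv := mk S (FreeAlgebra.ι k (Sum.inr s))
  val_inv := by
    have h := mk_rel S (UnivLocRel.mul_inv (k := k) (S := S) s)
    rwa [map_mul, map_one] at h
  inv_val := by
    have h := mk_rel S (UnivLocRel.inv_mul (k := k) (S := S) s)
    rwa [map_mul, map_one] at h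

variable {S}

/-- The universal property of `A_S`. -/
def lift {C : Type*} [Ring C] [Algebra k C] (f : A →ₐ[k] C) (hf : ∀ s : S, IsUnit (f (s : A))) :
    UnivLoc k S →ₐ[k] C :=
  RingQuot.liftAlgHom k
    ⟨FreeAlgebra.lift k (Sum.elim f fun s => (((hf s).unit⁻¹ : Cˣ) : C)), by
      intro p q h
      cases h <;> simp⟩

@[simp]
theorem lift_of {C : Type*} [Ring C] [Algebra k C] (f : A →ₐ[k] C)
    (hf : ∀ s : S, IsUnit (f (s : A))) (a : A) : lift f hf (of S a) = f a := by
  have h := RingQuot.liftAlgHom_mkAlgHom_apply (S := k)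
    (FreeAlgebra.lift k (Sum.elim f fun s : S => (((hf s).unit⁻¹ : Cˣ) : C)))
    (s := UnivLocRel k S) (by intro p q h; cases h <;> simp) (FreeAlgebra.ι k (Sum.inl a))
  exact h.trans (by simp)

end UnivLoc

end Localisation

/-! ### The algebra `k⟨x, y⟩_S` for `S = {1 + xy, 1 + yx}` -/

section Free

variable (k : Type*) [Field k]

/-- The first free generator. -/
def fx : FreeAlgebra k (Fin 2) := FreeAlgebra.ι k 0

/-- The second free generator. -/
def fy : FreeAlgebra k (Fin 2) := FreeAlgebra.ι k 1

/-- The set `{1 + xy, 1 + yx}`. -/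
def locSet : Set (FreeAlgebra k (Fin 2)) := {1 + fx k * fy k, 1 + fy k * fx k}

/-- The localised free algebra `k⟨x, y⟩_S`, `S = {1 + xy, 1 + yx}`. -/
abbrev F2S : Type _ := UnivLoc k (locSet k)

namespace F2S

/-- The generator `x`. -/
def x : F2S k := UnivLoc.of (locSet k) (fx k)

/-- The generator `y`. -/
def y : F2S k := UnivLoc.of (locSet k) (fy k)

/-- The unit `1 + xy`. -/
def u : (F2S k)ˣ := UnivLoc.unit (locSet k) ⟨1 + fx k * fy k, Or.inl rfl⟩

/-- The unit `1 + yx`. -/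
def v : (F2S k)ˣ := UnivLoc.unit (locSet k) ⟨1 + fy k * fx k, Or.inr rfl⟩

theorem u_val : (u k : F2S k) = 1 + x k * y k := by
  change UnivLoc.of (locSet k) (1 + fx k * fy k) = _
  simp [x, y]

theorem v_val : (v k : F2S k) = 1 + y k * x k := by
  change UnivLoc.of (locSet k) (1 + fy k * fx k) = _
  simp [x, y]

variable {k}

/-- The first quasi-Hamiltonian structure on `k⟨x, y⟩_S` (ordering `y < x` at the vertex of the
one-loop quiver with loop `y` and `x = y*`), given on generators, with moment map
`(1 + yx)(1 + xy)⁻¹`. -/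
def IsFirstStructure (H : QuasiHamiltonian k (F2S k)) : Prop :=
  H.br (x k) (x k) = -((2 : k)⁻¹ • ((x k ^ 2) ⊗ₜ[k] (1 : F2S k) - (1 : F2S k) ⊗ₜ[k] (x k ^ 2))) ∧
  H.br (y k) (y k) = (2 : k)⁻¹ • ((y k ^ 2) ⊗ₜ[k] (1 : F2S k) - (1 : F2S k) ⊗ₜ[k] (y k ^ 2)) ∧
  H.br (y k) (x k) = (1 : F2S k) ⊗ₜ[k] (1 : F2S k) + (2 : k)⁻¹ •
    ((x k * y k) ⊗ₜ[k] (1 : F2S k) + (1 : F2S k) ⊗ₜ[k] (y k * x k)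
      + x k ⊗ₜ[k] y k - y k ⊗ₜ[k] x k) ∧
  H.moment = (v k : F2S k) * ((u k)⁻¹ : (F2S k)ˣ)

/-- The second quasi-Hamiltonian structure on `k⟨x, y⟩_S` (opposite ordering `x < y`), given on
generators, with moment map `(1 + xy)⁻¹(1 + yx)`. -/
def IsSecondStructure (H : QuasiHamiltonian k (F2S k)) : Prop :=
  H.br (x k) (x k) = (2 : k)⁻¹ • ((x k ^ 2) ⊗ₜ[k] (1 : F2S k) - (1 : F2S k) ⊗ₜ[k] (x k ^ 2)) ∧
  H.br (y k) (y k) = -((2 : k)⁻¹ • ((y k ^ 2) ⊗ₜ[k] (1 : F2S k) - (1 : F2S k) ⊗ₜ[k] (y k ^ 2))) ∧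
  H.br (y k) (x k) = (1 : F2S k) ⊗ₜ[k] (1 : F2S k) + (2 : k)⁻¹ •
    ((x k * y k) ⊗ₜ[k] (1 : F2S k) + (1 : F2S k) ⊗ₜ[k] (y k * x k)
      - x k ⊗ₜ[k] y k + y k ⊗ₜ[k] x k) ∧
  H.moment = ((u k)⁻¹ : (F2S k)ˣ) * (v k : F2S k)

end F2S

end Free

/-! ### The localised first quantised Weyl algebra -/

section Weyl

variable {k : Type*} [Field k] (c : k)

/-- The relation `1 + xy = c (1 + yx)`. -/
inductive QWeylRel : FreeAlgebra k (Fin 2) → FreeAlgebra k (Fin 2) → Prop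
  | rel : QWeylRel (1 + fx k * fy k) (c • (1 + fy k * fx k))

/-- The first quantised Weyl algebra `A₁ᶜ = k⟨x, y⟩ / (1 + xy - c (1 + yx))`. -/
def QWeyl : Type _ := RingQuot (QWeylRel c)

namespace QWeyl

instance : Ring (QWeyl c) := inferInstanceAs (Ring (RingQuot (QWeylRel c)))

instance : Algebra k (QWeyl c) := inferInstanceAs (Algebra k (RingQuot (QWeylRel c)))

/-- The quotient map `k⟨x, y⟩ → A₁ᶜ`. -/
def mk : FreeAlgebra k (Fin 2) →ₐ[k] QWeyl c := RingQuot.mkAlgHom k (QWeylRel c)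

theorem mk_rel : mk c (1 + fx k * fy k) = c • mk c (1 + fy k * fx k) := by
  have h : mk c (1 + fx k * fy k) = mk c (c • (1 + fy k * fx k)) :=
    RingQuot.mkAlgHom_rel k QWeylRel.rel
  rw [h, map_smul]

end QWeyl

/-- The set `{1 + xy}` in `A₁ᶜ`. -/
def weylSet : Set (QWeyl c) := {QWeyl.mk c (1 + fx k * fy k)}

/-- The localised first quantised Weyl algebra `B₁ᶜ = (A₁ᶜ)_{1 + xy}`. -/
abbrev B1 : Type _ := UnivLoc k (weylSet c)

variable {c}

theorem B1.isUnit_of_locSet (hc : c ≠ 0) (s : locSet k) :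
    IsUnit (((UnivLoc.of (weylSet c)).comp (QWeyl.mk c)) (s : FreeAlgebra k (Fin 2))) := by
  have h1 : IsUnit (UnivLoc.of (weylSet c) (QWeyl.mk c (1 + fx k * fy k))) :=
    (UnivLoc.unit (k := k) (weylSet c) ⟨QWeyl.mk c (1 + fx k * fy k), rfl⟩).isUnit
  obtain ⟨s, rfl | rfl⟩ := s
  · exact h1
  · rw [QWeyl.mk_rel, map_smul] at h1
    have h2 := h1.smul (Units.mk0 c hc)⁻¹
    simpa [Units.smul_def, smul_smul, inv_mul_cancel₀ hc] using h2

/-- The canonical map `k⟨x, y⟩_S → B₁ᶜ`, `x ↦ x`, `y ↦ y`. -/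
def toB1 (hc : c ≠ 0) : F2S k →ₐ[k] B1 c :=
  UnivLoc.lift ((UnivLoc.of (weylSet c)).comp (QWeyl.mk c)) (B1.isUnit_of_locSet hc)

/-- The automorphism `σ` of `B₁ᶜ` is induced by the automorphism `f` of the algebra
`k⟨x, y⟩_S`. -/
def Induces (hc : c ≠ 0) (f : F2S k ≃ₐ[k] F2S k) (σ : B1 c ≃ₐ[k] B1 c) : Prop :=
  ∀ p : F2S k, σ (toB1 hc p) = toB1 hc (f p)

end Weyl

end QuasiHam

end

/-! ### Derivations and double brackets on the localised free algebra. -/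

noncomputable section

namespace QuasiHam

/-! ### Morphisms from universal localisations -/

section Uniqueness

variable {k : Type*} [Field k]

/-! Write `u = 1 + xy`, `v = 1 + yx`. A derivation `δ` along a pair `(i, j)` of algebra maps on `F`
is the same as an algebra map `a ↦ (i a, δ a; 0, j a)` to upper triangular matrices. Since `F` is
universal for pairs with both `1 + ab` and `1 + ba` invertible, such a `δ` exists and is unique for
arbitrary values on `x` and `y`. So a double bracket exists for prescribed values on generators
(`exists_doubleBracket`), subject only to antisymmetry of `{x,x}` and `{y,y}`. Compatibility with
algebra maps and the moment map condition are identities between derivations, hence can be checked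
on generators. The same holds for the quasi-Poisson condition, because the triple bracket is
cyclically invariant and a derivation in its last argument (`DoubleBracket.triple_mul`). What
remains are finite computations with words in `x, y, u, v` and the inverses of `u, v`.

Either equation `v u⁻¹ = c⁻¹`, `u⁻¹ v = c⁻¹` says `u = c v`, the defining relation of `B₁ᶜ`. This
gives the two kernels, and lets every isomorphism that carries one moment map to another descend to
`B₁ᶜ`.

For the automorphism group put `z = 1 + xy` in `B₁ᶜ`. Sending `x` to `t` and `y` to `t⁻¹(z - 1)`
represents `B₁ᶜ` faithfully in a skew Laurent ring over `k[z, z⁻¹]`, so every element is uniquely a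
sum of terms `fᵢ(z) mono i`. Comparing extreme degrees, a factor of a nonzero element of degree `0`
is homogeneous (`B1.homogeneous_of_mul_eq`). Moreover `mono i * mono (-i)` is a Laurent polynomial
in `z` with a root in `kˣ` when `i ≠ 0`, and with two distinct roots when `|i| ≥ 2`. Hence units are
`r zⁿ`, and an automorphism sends `z` to `r z` or `r z⁻¹`. If `z ↦ l z`, then the images of `x` and
`y` multiply to `l z - 1`, which has one root. With `c ≠ 1, -1` this forces `l = 1` and `x ↦ r zⁿ
x`. The case `z ↦ r z⁻¹` is reduced to this one by `ξ`.

Lifting a power of `ψ` is not immediate, since `ψ` goes from `H₁` to `H₂`. It is replaced by `θ : x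
↦ ux, y ↦ y u⁻¹`, which preserves `H₁` and induces on `B₁ᶜ` the same map as `φ_c ψ`. Every
automorphism is then induced by `φ_β θⁿ : H₁ → H₁` or `φ_β θⁿ ξ⁻¹ : H₂ → H₁`. -/

theorem UnivLoc.algHom_ext {A C : Type*} [Ring A] [Algebra k A] [Ring C] [Algebra k C] {S : Set A}
    {f g : UnivLoc k S →ₐ[k] C} (h : ∀ a, f (UnivLoc.of S a) = g (UnivLoc.of S a)) : f = g := by
  refine RingQuot.ringQuot_ext' k f g ?_
  refine FreeAlgebra.hom_ext (funext ?_)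
  rintro (a | s)
  · exact h a
  · have h1 : Units.map (f : UnivLoc k S →* C) (UnivLoc.unit S s) =
        Units.map (g : UnivLoc k S →* C) (UnivLoc.unit S s) := Units.ext (h s)
    exact congrArg (fun w : Cˣ => ((w⁻¹ : Cˣ) : C)) h1

theorem F2S.algHom_ext {C : Type*} [Ring C] [Algebra k C] {f g : F2S k →ₐ[k] C}
    (hx : f (F2S.x k) = g (F2S.x k)) (hy : f (F2S.y k) = g (F2S.y k)) : f = g := by
  refine UnivLoc.algHom_ext fun a => ?_
  have : f.comp (UnivLoc.of (locSet k)) = g.comp (UnivLoc.of (locSet k)) := by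
    refine FreeAlgebra.hom_ext (funext fun i => ?_)
    fin_cases i
    · exact hx
    · exact hy
  exact DFunLike.congr_fun this a

/-- The universal property of `k⟨x, y⟩_S`. -/
theorem F2S.exists_algHom {C : Type*} [Ring C] [Algebra k C] (a b : C)
    (hu : IsUnit (1 + a * b)) (hv : IsUnit (1 + b * a)) :
    ∃ f : F2S k →ₐ[k] C, f (F2S.x k) = a ∧ f (F2S.y k) = b := by
  let g : FreeAlgebra k (Fin 2) →ₐ[k] C := FreeAlgebra.lift k ![a, b]
  have ga : g (fx k) = a := by simp [g, fx]
  have gb : g (fy k) = b := by simp [g, fy]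
  refine ⟨UnivLoc.lift g ?_, ?_, ?_⟩
  · rintro ⟨s, rfl | rfl⟩
    · simpa [ga, gb] using hu
    · simpa [ga, gb] using hv
  · rw [F2S.x, UnivLoc.lift_of, ga]
  · rw [F2S.y, UnivLoc.lift_of, gb]

end Uniqueness

/-! ### Upper triangular matrices -/

section Triangular

variable {k R : Type*} [Field k] [Ring R] [Algebra k R]

variable (k R) in
/-- The algebra of upper triangular `2 × 2` matrices. -/
def upperTriangular : Subalgebra k (Matrix (Fin 2) (Fin 2) R) where
  carrier := {m | m 1 0 = 0}
  mul_mem' {a b} ha hb := by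
    simp only [Set.mem_ofPred_eq] at *
    simp [Matrix.mul_apply, ha, hb]
  add_mem' {a b} ha hb := by
    simp only [Set.mem_ofPred_eq] at *
    simp [ha, hb]
  algebraMap_mem' r := by simp [Matrix.algebraMap_matrix_apply]

/-- The upper triangular matrix with the given entries. -/
def upper (a p b : R) : upperTriangular k R := ⟨!![a, p; 0, b], by simp [upperTriangular]⟩

theorem upper_mul (a p b a' p' b' : R) :
    upper (k := k) a p b * upper a' p' b' = upper (a * a') (a * p' + p * b') (b * b') := by
  apply Subtype.ext
  ext i j
  fin_cases i <;> fin_cases j <;> simp [upper, Matrix.mul_apply]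

theorem upper_one : upper (k := k) (1 : R) 0 1 = 1 := by
  apply Subtype.ext
  ext i j
  fin_cases i <;> fin_cases j <;> simp [upper]

theorem upper_add (a p b a' p' b' : R) :
    upper (k := k) a p b + upper a' p' b' = upper (a + a') (p + p') (b + b') := by
  apply Subtype.ext
  ext i j
  fin_cases i <;> fin_cases j <;> simp [upper]

theorem upper_smul (r : k) (a p b : R) :
    r • upper (k := k) a p b = upper (r • a) (r • p) (r • b) := by
  apply Subtype.ext
  ext i j
  fin_cases i <;> fin_cases j <;> simp [upper]

theorem isUnit_upper {a p b : R} (ha : IsUnit a) (hb : IsUnit b) :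
    IsUnit (upper (k := k) a p b) := by
  obtain ⟨a, rfl⟩ := ha
  obtain ⟨b, rfl⟩ := hb
  refine isUnit_iff_exists.mpr
    ⟨upper ((a⁻¹ : Rˣ) : R) (-((a⁻¹ : Rˣ) * p * (b⁻¹ : Rˣ))) ((b⁻¹ : Rˣ) : R), ?_, ?_⟩
  · rw [upper_mul, ← upper_one]; congr 1 <;> simp [mul_assoc]
  · rw [upper_mul, ← upper_one]; congr 1 <;> simp [mul_assoc]

/-- A diagonal entry of upper triangular matrices, as a homomorphism. -/
def upperDiag (t : Fin 2) : upperTriangular k R →ₐ[k] R where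
  toFun m := m.1 t t
  map_one' := by simp
  map_mul' := by
    rintro ⟨a, ha : a 1 0 = 0⟩ ⟨b, hb : b 1 0 = 0⟩
    fin_cases t <;> simp [Matrix.mul_apply, ha, hb]
  map_zero' := rfl
  map_add' _ _ := rfl
  commutes' r := by
    change (algebraMap k (Matrix (Fin 2) (Fin 2) R) r) t t = _
    simp [Matrix.algebraMap_matrix_apply]

theorem upperDiag_upper_zero (a p b : R) : upperDiag 0 (upper (k := k) a p b) = a := rfl

theorem upperDiag_upper_one (a p b : R) : upperDiag 1 (upper (k := k) a p b) = b := rfl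

end Triangular

/-! ### Derivations along a pair of algebra maps -/

section Derivations

variable {k R : Type*} [Field k] [Ring R] [Algebra k R]

/-- `δ` is a derivation along the pair of homomorphisms `(i, j)`. -/
def IsDerivAlong {A : Type*} [Ring A] [Algebra k A] (i j : A →ₐ[k] R) (δ : A →ₗ[k] R) : Prop :=
  ∀ a b, δ (a * b) = δ a * j b + i a * δ b

/-- The Leibniz rule is multiplicativity of the upper right matrix entry, so uniqueness of
derivations is uniqueness of algebra maps out of `F2S k`. -/
theorem IsDerivAlong.ext {i j : F2S k →ₐ[k] R} {δ δ' : F2S k →ₗ[k] R} (h : IsDerivAlong i j δ)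
    (h' : IsDerivAlong i j δ') (hx : δ (F2S.x k) = δ' (F2S.x k))
    (hy : δ (F2S.y k) = δ' (F2S.y k)) : δ = δ' := by
  have key : ∀ e : F2S k →ₗ[k] R, IsDerivAlong i j e → ∃ f : F2S k →ₐ[k] upperTriangular k R,
      ∀ a, f a = upper (i a) (e a) (j a) := by
    intro e he
    have e1 : e 1 = 0 := by simpa using he 1 1
    refine ⟨AlgHom.ofLinearMap
      { toFun := fun a => upper (i a) (e a) (j a)
        map_add' := fun a b => by rw [upper_add]; simp
        map_smul' := fun r a => by simp [upper_smul] } ?_ ?_, fun a => rfl⟩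
    · simp [e1, upper_one]
    · intro a b
      simp [upper_mul, he a b, add_comm]
  obtain ⟨f, hf⟩ := key δ h
  obtain ⟨g, hg⟩ := key δ' h'
  have hfg : f = g := F2S.algHom_ext (by rw [hf, hg, hx]) (by rw [hf, hg, hy])
  ext a
  have := congrArg (fun m : upperTriangular k R => m.1 0 1) (DFunLike.congr_fun hfg a)
  simpa [hf, hg, upper] using this

/-- No condition on `p` and `q` arises: an upper triangular matrix is invertible once its diagonal
is, and the diagonals of `1 + xy` and `1 + yx` are images of units under `i` and `j`. -/
theorem exists_derivAlong (i j : F2S k →ₐ[k] R) (p q : R) :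
    ∃ δ : F2S k →ₗ[k] R, IsDerivAlong i j δ ∧ δ (F2S.x k) = p ∧ δ (F2S.y k) = q := by
  have hu : ∀ f : F2S k →ₐ[k] R, IsUnit (1 + f (F2S.x k) * f (F2S.y k)) := fun f => by
    simpa [F2S.u_val] using (F2S.u k).isUnit.map f
  have hv : ∀ f : F2S k →ₐ[k] R, IsUnit (1 + f (F2S.y k) * f (F2S.x k)) := fun f => by
    simpa [F2S.v_val] using (F2S.v k).isUnit.map f
  obtain ⟨f, fx, fy⟩ := F2S.exists_algHom (k := k)
    (upper (k := k) (i (F2S.x k)) p (j (F2S.x k))) (upper (i (F2S.y k)) q (j (F2S.y k)))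
    (by rw [upper_mul, ← upper_one, upper_add]; exact isUnit_upper (hu i) (hu j))
    (by rw [upper_mul, ← upper_one, upper_add]; exact isUnit_upper (hv i) (hv j))
  have hi : (upperDiag 0).comp f = i := F2S.algHom_ext
    (by rw [AlgHom.comp_apply, fx, upperDiag_upper_zero])
    (by rw [AlgHom.comp_apply, fy, upperDiag_upper_zero])
  have hj : (upperDiag 1).comp f = j := F2S.algHom_ext
    (by rw [AlgHom.comp_apply, fx, upperDiag_upper_one])
    (by rw [AlgHom.comp_apply, fy, upperDiag_upper_one])
  refine ⟨{ toFun := fun a => (f a).1 0 1, map_add' := ?_, map_smul' := ?_ }, ?_, ?_, ?_⟩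
  · intro a b; simp
  · intro r a; simp
  · intro a b
    have h0 : (f a).1 0 0 = i a := DFunLike.congr_fun hi a
    have h1 : (f b).1 1 1 = j b := DFunLike.congr_fun hj b
    simp [Matrix.mul_apply, h0, h1, add_comm]
  · simp [fx, upper]
  · simp [fy, upper]

variable {A : Type*} [Ring A] [Algebra k A] {i j : A →ₐ[k] R}

theorem IsDerivAlong.add {δ δ' : A →ₗ[k] R} (h : IsDerivAlong i j δ) (h' : IsDerivAlong i j δ') :
    IsDerivAlong i j (δ + δ') := fun a b => by
  simp only [LinearMap.add_apply, h a b, h' a b]; noncomm_ring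

theorem IsDerivAlong.smul {δ : A →ₗ[k] R} (h : IsDerivAlong i j δ) (r : k) :
    IsDerivAlong i j (r • δ) := fun a b => by
  simp [h a b]

/-- Used for the inner bimodule structure on `A ⊗ A`, which commutes with the outer one. -/
theorem IsDerivAlong.mulLeft {δ : A →ₗ[k] R} (h : IsDerivAlong i j δ) {s : R}
    (hs : ∀ a, Commute s (i a)) : IsDerivAlong i j (LinearMap.mulLeft k s ∘ₗ δ) := fun a b => by
  simp only [LinearMap.comp_apply, LinearMap.mulLeft_apply, h a b, mul_add, ← mul_assoc, (hs a).eq]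

theorem IsDerivAlong.mulRight {δ : A →ₗ[k] R} (h : IsDerivAlong i j δ) {s : R}
    (hs : ∀ a, Commute s (j a)) : IsDerivAlong i j (LinearMap.mulRight k s ∘ₗ δ) := fun a b => by
  simp only [LinearMap.comp_apply, LinearMap.mulRight_apply, h a b, add_mul, mul_assoc, (hs b).eq]

end Derivations

/-! ### Double brackets with given values on the generators -/

section Brackets

variable {k A : Type*} [Field k] [Ring A] [Algebra k A]

/-- The inclusion of the first factor. -/
abbrev inl : A →ₐ[k] A ⊗[k] A := Algebra.TensorProduct.includeLeft

/-- The inclusion of the second factor. -/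
abbrev inr : A →ₐ[k] A ⊗[k] A := Algebra.TensorProduct.includeRight

theorem commute_inl_inr (a b : A) : Commute (a ⊗ₜ[k] (1 : A)) ((1 : A) ⊗ₜ[k] b) := by
  simp [Commute, SemiconjBy]

theorem comm_mul (s t : A ⊗[k] A) : TensorProduct.comm k A A (s * t) =
    TensorProduct.comm k A A s * TensorProduct.comm k A A t :=
  map_mul (Algebra.TensorProduct.comm k A A) s t

theorem comm_comm (s : A ⊗[k] A) : TensorProduct.comm k A A (TensorProduct.comm k A A s) = s := by
  induction s with
  | zero => simp
  | tmul a b => simp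
  | add a b ha hb => simp only [map_add, ha, hb]

theorem DoubleBracket.isDerivAlong (P : DoubleBracket k A) (a : A) :
    IsDerivAlong inl inr (P.br a) := fun b c => P.deriv_right a b c

theorem DoubleBracket.deriv_left (P : DoubleBracket k A) (a b c : A) :
    P.br (a * b) c = (1 ⊗ₜ a) * P.br b c + P.br a c * (b ⊗ₜ 1) := by
  rw [P.cyclic_antisymm (a * b), P.deriv_right, P.cyclic_antisymm b, P.cyclic_antisymm a]
  simp [comm_mul, add_comm]

/-- The derivations `{x, -}` and `{y, -}` are fixed by their values on generators. Antisymmetry then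
dictates `{a, x}` and `{a, y}` for every `a`, and these two values extend to the derivation `{a,
-}`. -/
theorem exists_doubleBracket {p q : F2S k ⊗[k] F2S k} (r : F2S k ⊗[k] F2S k)
    (hp : p = -TensorProduct.comm k _ _ p) (hq : q = -TensorProduct.comm k _ _ q) :
    ∃ P : DoubleBracket k (F2S k), P.br (F2S.x k) (F2S.x k) = p ∧ P.br (F2S.y k) (F2S.y k) = q ∧
      P.br (F2S.y k) (F2S.x k) = r := by
  have hder : ∀ p q : F2S k ⊗[k] F2S k, ∃ δ : F2S k →ₗ[k] F2S k ⊗[k] F2S k,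
      IsDerivAlong inl inr δ ∧ δ (F2S.x k) = p ∧ δ (F2S.y k) = q :=
    fun p q => exists_derivAlong inl inr p q
  choose der hd hx hy using hder
  let τ := TensorProduct.comm k (F2S k) (F2S k)
  let Dx := der p (-τ r)
  let Dy := der r q
  let br : F2S k →ₗ[k] F2S k →ₗ[k] F2S k ⊗[k] F2S k :=
    { toFun := fun a => der (-τ (Dx a)) (-τ (Dy a))
      map_add' := fun a b => (hd _ _).ext ((hd _ _).add (hd _ _))
        (by simp [hx]; abel) (by simp [hy]; abel)
      map_smul' := fun r a => (hd _ _).ext ((hd _ _).smul r) (by simp [hx]) (by simp [hy]) }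
  have hbr : ∀ a, IsDerivAlong inl inr (br a) := fun a => hd _ _
  have brx : ∀ a, br a (F2S.x k) = -τ (Dx a) := fun a => hx _ _
  have bry : ∀ a, br a (F2S.y k) = -τ (Dy a) := fun a => hy _ _
  have hττ : ∀ s, τ (τ s) = s := comm_comm
  -- Consistency of the construction: `br x` and `br y` are the derivations started from. Only here
  -- is antisymmetry of `p` and `q` needed.
  have hDx : br (F2S.x k) = Dx := (hbr _).ext (hd _ _)
    (by rw [brx]; simp only [Dx, hx]; exact hp.symm) (by rw [bry]; simp only [Dx, Dy, hx, hy])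
  have hDy : br (F2S.y k) = Dy := (hbr _).ext (hd _ _)
    (by rw [brx]; simp only [Dx, Dy, hx, hy, map_neg, neg_neg, hττ])
    (by rw [bry]; simp only [Dy, hy]; exact hq.symm)
  -- Both sides are outer derivations in `a`, so `a = x` and `a = y` suffice; there the rule is the
  -- flip of the Leibniz rule for `Dx` and `Dy`.
  have hleft : ∀ b c a, br (b * c) a = (1 ⊗ₜ b) * br c a + br b a * (c ⊗ₜ 1) := by
    intro b c a
    have h1 : IsDerivAlong inl inr (LinearMap.mulLeft k ((1 : F2S k) ⊗ₜ[k] b) ∘ₗ br c +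
        LinearMap.mulRight k (c ⊗ₜ[k] (1 : F2S k)) ∘ₗ br b) :=
      ((hbr c).mulLeft fun a => (commute_inl_inr a b).symm).add
        ((hbr b).mulRight fun a => commute_inl_inr c a)
    have h2 : ∀ D : F2S k →ₗ[k] F2S k ⊗[k] F2S k, IsDerivAlong inl inr D → -τ (D (b * c)) =
        (1 ⊗ₜ b) * -τ (D c) + -τ (D b) * (c ⊗ₜ 1) := by
      intro D hD
      rw [hD b c, map_add, comm_mul, comm_mul]
      change -(τ (D b) * TensorProduct.comm k _ _ ((1 : F2S k) ⊗ₜ[k] c) +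
        TensorProduct.comm k _ _ (b ⊗ₜ[k] (1 : F2S k)) * τ (D c)) = _
      rw [TensorProduct.comm_tmul, TensorProduct.comm_tmul, mul_neg, neg_mul, neg_add, add_comm]
    refine DFunLike.congr_fun ((hbr _).ext h1 ?_ ?_) a
    · simp only [LinearMap.add_apply, LinearMap.comp_apply, LinearMap.mulLeft_apply,
        LinearMap.mulRight_apply, brx]
      exact h2 Dx (hd _ _)
    · simp only [LinearMap.add_apply, LinearMap.comp_apply, LinearMap.mulLeft_apply,
        LinearMap.mulRight_apply, bry]
      exact h2 Dy (hd _ _)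
  refine ⟨⟨br, ?_, fun a b c => hbr a b c⟩, ?_, ?_, ?_⟩
  · intro a b
    -- By the left Leibniz rule, `b ↦ -{b, a}°` is an outer derivation too, so it is compared with
    -- `{a, -}` on generators.
    have h1 : IsDerivAlong inl inr (-(τ.toLinearMap ∘ₗ br.flip a)) := by
      intro b c
      change -τ (br (b * c) a) = -τ (br b a) * ((1 : F2S k) ⊗ₜ[k] c) +
        (b ⊗ₜ[k] (1 : F2S k)) * -τ (br c a)
      rw [hleft, map_add, comm_mul, comm_mul, TensorProduct.comm_tmul, TensorProduct.comm_tmul,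
        neg_add, mul_neg, neg_mul, add_comm]
    refine DFunLike.congr_fun ((hbr a).ext h1 ?_ ?_) b
    · change _ = -τ (br (F2S.x k) a)
      rw [brx, hDx]
    · change _ = -τ (br (F2S.y k) a)
      rw [bry, hDy]
  · simp only [hDx, Dx, hx]
  · simp only [hDy, Dy, hy]
  · simp only [hDy, Dy, hx]

end Brackets

end QuasiHam

end

/-! ### Functoriality of brackets, and reduction of the axioms to generators. -/

noncomputable section

namespace QuasiHam

/-! ### Brackets and algebra maps -/

section Naturality

variable {k A B : Type*} [Field k] [Ring A] [Algebra k A] [Ring B] [Algebra k B]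

theorem comm_map (f : A →ₐ[k] B) (s : A ⊗[k] A) :
    TensorProduct.comm k B B (TensorProduct.map f.toLinearMap f.toLinearMap s) =
      TensorProduct.map f.toLinearMap f.toLinearMap (TensorProduct.comm k A A s) := by
  induction s with
  | zero => simp only [map_zero]
  | tmul a b => simp
  | add a b ha hb => simp only [map_add, ha, hb]

theorem map_mul_tensor (f : A →ₐ[k] B) (s t : A ⊗[k] A) :
    TensorProduct.map f.toLinearMap f.toLinearMap (s * t) =
      TensorProduct.map f.toLinearMap f.toLinearMap s *
        TensorProduct.map f.toLinearMap f.toLinearMap t :=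
  map_mul (Algebra.TensorProduct.map f f) s t

/-- A homomorphism between algebras with double brackets is compatible with the brackets as soon
as it is so on the generators. -/
theorem br_map_of_generators (P : DoubleBracket k (F2S k)) (Q : DoubleBracket k A)
    (f : F2S k →ₐ[k] A)
    (hxx : Q.br (f (F2S.x k)) (f (F2S.x k)) =
      TensorProduct.map f.toLinearMap f.toLinearMap (P.br (F2S.x k) (F2S.x k)))
    (hyy : Q.br (f (F2S.y k)) (f (F2S.y k)) =
      TensorProduct.map f.toLinearMap f.toLinearMap (P.br (F2S.y k) (F2S.y k)))
    (hyx : Q.br (f (F2S.y k)) (f (F2S.x k)) =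
      TensorProduct.map f.toLinearMap f.toLinearMap (P.br (F2S.y k) (F2S.x k))) (a b : F2S k) :
    Q.br (f a) (f b) = TensorProduct.map f.toLinearMap f.toLinearMap (P.br a b) := by
  have hsymm : ∀ a b, Q.br (f a) (f b) =
      TensorProduct.map f.toLinearMap f.toLinearMap (P.br a b) → Q.br (f b) (f a) =
      TensorProduct.map f.toLinearMap f.toLinearMap (P.br b a) := by
    intro a b h
    rw [Q.cyclic_antisymm, h, comm_map, P.cyclic_antisymm b a, map_neg]
  have hL : ∀ a, IsDerivAlong (inl.comp f) (inr.comp f) (Q.br (f a) ∘ₗ f.toLinearMap) :=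
    fun a b c => by
      change Q.br (f a) (f (b * c)) = Q.br (f a) (f b) * (1 ⊗ₜ f c) + (f b ⊗ₜ 1) * Q.br (f a) (f c)
      rw [map_mul, Q.deriv_right]
  have hR : ∀ a, IsDerivAlong (inl.comp f) (inr.comp f)
      (TensorProduct.map f.toLinearMap f.toLinearMap ∘ₗ P.br a) := fun a b c => by
    change TensorProduct.map f.toLinearMap f.toLinearMap (P.br a (b * c)) =
      TensorProduct.map f.toLinearMap f.toLinearMap (P.br a b) * (1 ⊗ₜ f c) +
        (f b ⊗ₜ 1) * TensorProduct.map f.toLinearMap f.toLinearMap (P.br a c)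
    rw [P.deriv_right, map_add, map_mul_tensor, map_mul_tensor]
    simp
  have hall : ∀ a, Q.br (f a) (f (F2S.x k)) =
      TensorProduct.map f.toLinearMap f.toLinearMap (P.br a (F2S.x k)) →
      Q.br (f a) (f (F2S.y k)) =
      TensorProduct.map f.toLinearMap f.toLinearMap (P.br a (F2S.y k)) → ∀ b, Q.br (f a) (f b) =
      TensorProduct.map f.toLinearMap f.toLinearMap (P.br a b) :=
    fun a h1 h2 b => DFunLike.congr_fun ((hL a).ext (hR a) h1 h2) b
  exact hall a (hsymm _ _ (hall _ hxx (hsymm _ _ hyx) a)) (hsymm _ _ (hall _ hyx hyy a)) b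

/-- Transport of a double bracket along an isomorphism. -/
def DoubleBracket.transport (P : DoubleBracket k A) (e : A ≃ₐ[k] B) : DoubleBracket k B where
  br := (P.br.compl₁₂ e.symm.toLinearMap e.symm.toLinearMap).compr₂
    (TensorProduct.map (e : A →ₐ[k] B).toLinearMap (e : A →ₐ[k] B).toLinearMap)
  cyclic_antisymm a b := by
    change TensorProduct.map (e : A →ₐ[k] B).toLinearMap _ (P.br (e.symm a) (e.symm b)) =
      -TensorProduct.comm k B B (TensorProduct.map (e : A →ₐ[k] B).toLinearMap
        (e : A →ₐ[k] B).toLinearMap (P.br (e.symm b) (e.symm a)))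
    rw [comm_map, P.cyclic_antisymm, map_neg]
  deriv_right a b c := by
    change TensorProduct.map (e : A →ₐ[k] B).toLinearMap (e : A →ₐ[k] B).toLinearMap
      (P.br (e.symm a) (e.symm (b * c))) = TensorProduct.map (e : A →ₐ[k] B).toLinearMap
        (e : A →ₐ[k] B).toLinearMap (P.br (e.symm a) (e.symm b)) * (1 ⊗ₜ c) +
      (b ⊗ₜ 1) * TensorProduct.map (e : A →ₐ[k] B).toLinearMap
        (e : A →ₐ[k] B).toLinearMap (P.br (e.symm a) (e.symm c))
    rw [map_mul, P.deriv_right, map_add, map_mul_tensor, map_mul_tensor]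
    simp

theorem DoubleBracket.transport_br (P : DoubleBracket k A) (e : A ≃ₐ[k] B) (a b : B) :
    (P.transport e).br a b = TensorProduct.map (e : A →ₐ[k] B).toLinearMap
      (e : A →ₐ[k] B).toLinearMap (P.br (e.symm a) (e.symm b)) := rfl

/-- The threefold tensor power of a linear map. -/
abbrev map3 (f : A →ₗ[k] B) : (A ⊗[k] A) ⊗[k] A →ₗ[k] (B ⊗[k] B) ⊗[k] B :=
  TensorProduct.map (TensorProduct.map f f) f

theorem cyc_map3 (f : A →ₗ[k] B) (s : (A ⊗[k] A) ⊗[k] A) : cyc (map3 f s) = map3 f (cyc s) := by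
  have : cyc ∘ₗ map3 f = map3 f ∘ₗ cyc := by
    refine TensorProduct.ext_threefold fun a b c => ?_
    simp [cyc_tmul]
  exact DFunLike.congr_fun this s

theorem DoubleBracket.transport_nested (P : DoubleBracket k A) (e : A ≃ₐ[k] B) (a b c : B) :
    (P.transport e).nested a b c =
      map3 (e : A →ₐ[k] B).toLinearMap (P.nested (e.symm a) (e.symm b) (e.symm c)) := by
  simp only [DoubleBracket.nested, DoubleBracket.transport_br]
  generalize P.br (e.symm b) (e.symm c) = s
  induction s with
  | zero => simp only [map_zero]
  | tmul p q => simp [DoubleBracket.transport_br]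
  | add s t hs ht => simp only [map_add, hs, ht]

theorem DoubleBracket.IsQuasiPoisson.transport {P : DoubleBracket k A} (h : P.IsQuasiPoisson)
    (e : A ≃ₐ[k] B) : (P.transport e).IsQuasiPoisson := by
  intro a b c
  have key : (P.transport e).triple a b c =
      map3 (e : A →ₐ[k] B).toLinearMap (P.triple (e.symm a) (e.symm b) (e.symm c)) := by
    simp only [DoubleBracket.triple, DoubleBracket.transport_nested, cyc_map3, map_add]
  rw [key, h]
  simp

theorem DoubleBracket.IsMomentMap.transport {P : DoubleBracket k A} {Φ : A} (h : P.IsMomentMap Φ)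
    (e : A ≃ₐ[k] B) : (P.transport e).IsMomentMap (e Φ) := by
  refine ⟨h.1.map e, fun a => ?_⟩
  rw [DoubleBracket.transport_br, e.symm_apply_apply, h.2]
  simp

/-- Transport of a quasi-Hamiltonian structure along an isomorphism. -/
def QuasiHamiltonian.transport (H : QuasiHamiltonian k A) (e : A ≃ₐ[k] B) :
    QuasiHamiltonian k B where
  toDoubleBracket := H.toDoubleBracket.transport e
  quasiPoisson := H.quasiPoisson.transport e
  moment := e H.moment
  isMomentMap := H.isMomentMap.transport e

theorem QuasiHamiltonian.isIso_transport (H : QuasiHamiltonian k A) (e : A ≃ₐ[k] B) :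
    IsQuasiHamiltonianIso H (H.transport e) e := by
  refine ⟨fun a b => ?_, rfl⟩
  change (H.toDoubleBracket.transport e).br (e a) (e b) = _
  rw [DoubleBracket.transport_br, e.symm_apply_apply, e.symm_apply_apply]
  rfl

end Naturality

/-! ### Isomorphisms of quasi-Hamiltonian algebras -/

section Isomorphisms

variable {k A B C : Type*} [Field k] [Ring A] [Algebra k A] [Ring B] [Algebra k B] [Ring C]
  [Algebra k C] {H₁ : QuasiHamiltonian k A} {H₂ : QuasiHamiltonian k B} {H₃ : QuasiHamiltonian k C}

theorem isQuasiHamiltonianIso_refl (H : QuasiHamiltonian k A) :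
    IsQuasiHamiltonianIso H H AlgEquiv.refl := by
  refine ⟨fun a b => ?_, rfl⟩
  change H.br a b = TensorProduct.map LinearMap.id LinearMap.id (H.br a b)
  simp

theorem IsQuasiHamiltonianIso.trans {f : A ≃ₐ[k] B} {g : B ≃ₐ[k] C}
    (hf : IsQuasiHamiltonianIso H₁ H₂ f) (hg : IsQuasiHamiltonianIso H₂ H₃ g) :
    IsQuasiHamiltonianIso H₁ H₃ (f.trans g) := by
  refine ⟨fun a b => ?_, ?_⟩
  · have h : (f.trans g).toLinearMap = g.toLinearMap ∘ₗ f.toLinearMap := rfl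
    rw [h, TensorProduct.map_comp, LinearMap.comp_apply, ← hf.1, ← hg.1]
    rfl
  · rw [AlgEquiv.trans_apply, hf.2, hg.2]

theorem IsQuasiHamiltonianIso.symm {f : A ≃ₐ[k] B} (hf : IsQuasiHamiltonianIso H₁ H₂ f) :
    IsQuasiHamiltonianIso H₂ H₁ f.symm := by
  refine ⟨fun a b => ?_, ?_⟩
  · have h := hf.1 (f.symm a) (f.symm b)
    rw [f.apply_symm_apply, f.apply_symm_apply] at h
    have h' : f.symm.toLinearMap ∘ₗ f.toLinearMap = LinearMap.id := by ext; simp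
    rw [h, ← LinearMap.comp_apply, ← TensorProduct.map_comp, h']
    simp
  · rw [← hf.2, f.symm_apply_apply]

end Isomorphisms

/-! ### Reduction of the axioms to generators -/

section QuasiPoisson

variable {k A : Type*} [Field k] [Ring A] [Algebra k A]

/-- The distinguished triple bracket, without the factor `1 / 4`. -/
def dist3 (a b c : A) : (A ⊗[k] A) ⊗[k] A :=
  (((c * a) ⊗ₜ[k] b) ⊗ₜ[k] (1 : A)) - (((c * a) ⊗ₜ[k] (1 : A)) ⊗ₜ[k] b)
      - ((c ⊗ₜ[k] (a * b)) ⊗ₜ[k] (1 : A)) + ((c ⊗ₜ[k] a) ⊗ₜ[k] b)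
      - ((a ⊗ₜ[k] b) ⊗ₜ[k] c) + ((a ⊗ₜ[k] (1 : A)) ⊗ₜ[k] (b * c))
      + (((1 : A) ⊗ₜ[k] (a * b)) ⊗ₜ[k] c) - (((1 : A) ⊗ₜ[k] a) ⊗ₜ[k] (b * c))

/-- The algebra map `a ↦ a ⊗ 1 ⊗ 1`. -/
abbrev in1 : A →ₐ[k] (A ⊗[k] A) ⊗[k] A :=
  (Algebra.TensorProduct.includeLeft : A ⊗[k] A →ₐ[k] (A ⊗[k] A) ⊗[k] A).comp inl

/-- The algebra map `a ↦ 1 ⊗ 1 ⊗ a`. -/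
abbrev in3 : A →ₐ[k] (A ⊗[k] A) ⊗[k] A := Algebra.TensorProduct.includeRight

theorem in1_apply (a : A) : in1 (k := k) a = (a ⊗ₜ 1) ⊗ₜ 1 := rfl

theorem in3_apply (a : A) : in3 (k := k) a = 1 ⊗ₜ a := rfl

theorem dist3_mul (a b c d : A) : dist3 (k := k) a b (c * d) =
    dist3 a b c * in3 d + in1 c * dist3 a b d := by
  simp only [dist3, in1_apply, in3_apply, Algebra.TensorProduct.one_def, mul_add, add_mul, mul_sub,
    sub_mul, Algebra.TensorProduct.tmul_mul_tmul, mul_one, one_mul, mul_assoc]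
  abel

theorem cyc_dist3 (a b c : A) : cyc (dist3 (k := k) b c a) = dist3 a b c := by
  simp only [dist3, map_add, map_sub, cyc_tmul]
  abel

theorem cyc_cyc_cyc (s : (A ⊗[k] A) ⊗[k] A) : cyc (cyc (cyc s)) = s := by
  have : cyc ∘ₗ cyc ∘ₗ cyc = (LinearMap.id : (A ⊗[k] A) ⊗[k] A →ₗ[k] _) := by
    refine TensorProduct.ext_threefold fun a b c => ?_
    simp [cyc_tmul]
  exact DFunLike.congr_fun this s

/-- The product of `s ⊗ 1` and `1 ⊗ t`. -/
def join : A ⊗[k] A →ₗ[k] A ⊗[k] A →ₗ[k] (A ⊗[k] A) ⊗[k] A :=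
  (LinearMap.mul k ((A ⊗[k] A) ⊗[k] A)).compl₁₂
    (Algebra.TensorProduct.includeLeft : A ⊗[k] A →ₐ[k] (A ⊗[k] A) ⊗[k] A).toLinearMap
    (LinearMap.rTensor A (inr : A →ₐ[k] A ⊗[k] A).toLinearMap)

theorem join_tmul (s : A ⊗[k] A) (c d : A) :
    join s (c ⊗ₜ[k] d) = (s * (1 ⊗ₜ c)) ⊗ₜ d := by
  simp [join]

namespace DoubleBracket

variable (P : DoubleBracket k A)

/-- The map `s ↦ {a, s'} ⊗ s''`. -/
abbrev nest (a : A) : A ⊗[k] A →ₗ[k] (A ⊗[k] A) ⊗[k] A := LinearMap.rTensor A (P.br a)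

theorem nest_mul_right (a d : A) (s : A ⊗[k] A) : P.nest a (s * (1 ⊗ₜ d)) =
    P.nest a s * in3 d := by
  induction s with
  | zero => simp only [map_zero, zero_mul]
  | tmul p q => simp
  | add s t hs ht => simp only [map_add, add_mul, hs, ht]

theorem nest_mul_left (a c : A) (s : A ⊗[k] A) : P.nest a ((c ⊗ₜ 1) * s) =
    in1 c * P.nest a s + join (P.br a c) s := by
  induction s with
  | zero => simp only [map_zero, mul_zero, add_zero]
  | tmul p q =>
    simp only [Algebra.TensorProduct.tmul_mul_tmul, LinearMap.rTensor_tmul, P.deriv_right,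
      join_tmul, in1_apply, TensorProduct.add_tmul, one_mul]
    rw [add_comm]
  | add s t hs ht => simp only [map_add, mul_add, hs, ht]; abel

/-- The factor `c` sits in the third slot, which one rotation moves to the first: inner
multiplication turns into outer multiplication. -/
theorem cyc_nest_inner_left (b c : A) (s : A ⊗[k] A) : cyc (P.nest b ((1 ⊗ₜ c) * s)) =
    in1 c * cyc (P.nest b s) := by
  induction s with
  | zero => simp only [map_zero, mul_zero]
  | tmul p q =>
    simp only [Algebra.TensorProduct.tmul_mul_tmul, LinearMap.rTensor_tmul, one_mul]
    generalize P.br b p = t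
    induction t with
    | zero => simp only [map_zero, mul_zero, TensorProduct.zero_tmul]
    | tmul e f => simp [cyc_tmul]
    | add s t hs ht => simp only [map_add, mul_add, TensorProduct.add_tmul, hs, ht]
  | add s t hs ht => simp only [map_add, mul_add, hs, ht]

/-- Applying `{b, -}` to a product ending in `d` leaves a cross term in `{b, d}`. Its sign comes
from rewriting `{c, a}` as minus the flip of `{a, c}`. -/
theorem cyc_nest_inner_right (a b c d : A) : cyc (P.nest b (P.br c a * (d ⊗ₜ 1))) =
    cyc (P.nest b (P.br c a)) * in3 d - join (P.br a c) (P.br b d) := by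
  rw [P.cyclic_antisymm a c]
  generalize P.br c a = s
  induction s with
  | zero => simp
  | tmul p q =>
    simp only [Algebra.TensorProduct.tmul_mul_tmul, LinearMap.rTensor_tmul, P.deriv_right,
      TensorProduct.comm_tmul, TensorProduct.add_tmul, map_add, map_neg, LinearMap.neg_apply,
      sub_neg_eq_add, mul_one]
    congr 1
    · generalize P.br b p = t
      induction t with
      | zero => simp
      | tmul e f => simp [cyc_tmul]
      | add s t hs ht => simp only [map_add, add_mul, TensorProduct.add_tmul, hs, ht]
    · generalize P.br b d = t
      induction t with
      | zero => simp
      | tmul e f => simp [cyc_tmul, join_tmul]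
      | add s t hs ht => simp only [map_add, mul_add, TensorProduct.add_tmul, hs, ht]
  | add s t hs ht =>
    simp only [map_add, add_mul, hs, ht, neg_add, LinearMap.add_apply]
    abel

theorem cyc_cyc_nest_mul (c d : A) (s : A ⊗[k] A) : cyc (cyc (P.nest (c * d) s)) =
    cyc (cyc (P.nest c s)) * in3 d + in1 c * cyc (cyc (P.nest d s)) := by
  induction s with
  | zero => simp
  | tmul p q =>
    simp only [LinearMap.rTensor_tmul, P.deriv_left, TensorProduct.add_tmul, map_add]
    rw [add_comm]
    congr 1
    · generalize P.br c p = t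
      induction t with
      | zero => simp
      | tmul e f => simp [cyc_tmul]
      | add s t hs ht => simp only [map_add, add_mul, TensorProduct.add_tmul, hs, ht]
    · generalize P.br d p = t
      induction t with
      | zero => simp
      | tmul e f => simp [cyc_tmul]
      | add s t hs ht => simp only [map_add, mul_add, TensorProduct.add_tmul, hs, ht]
  | add s t hs ht =>
    simp only [map_add, add_mul, mul_add, hs, ht]
    abel

/-- Each of the three summands is a derivation in the last argument up to a cross term `join {a, c}
{b, d}`. This term occurs in the first with sign `+`, in the second with sign `-`, and not in the
third. -/
theorem triple_mul (a b c d : A) : P.triple a b (c * d) =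
    P.triple a b c * in3 d + in1 c * P.triple a b d := by
  have h1 : P.nested a b (c * d) =
      P.nested a b c * in3 d + (in1 c * P.nested a b d + join (P.br a c) (P.br b d)) := by
    simp only [nested, P.deriv_right b, map_add, nest_mul_right, nest_mul_left]
  have h2 : cyc (P.nested b (c * d) a) = in1 c * cyc (P.nested b d a) +
      (cyc (P.nested b c a) * in3 d - join (P.br a c) (P.br b d)) := by
    simp only [nested, P.deriv_left c d a, map_add, cyc_nest_inner_left, cyc_nest_inner_right]
  have h3 : cyc (cyc (P.nested (c * d) a b)) =
      cyc (cyc (P.nested c a b)) * in3 d + in1 c * cyc (cyc (P.nested d a b)) :=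
    P.cyc_cyc_nest_mul c d _
  simp only [triple, h1, h2, h3, add_mul, mul_add]
  abel

theorem cyc_triple (a b c : A) : cyc (P.triple b c a) = P.triple a b c := by
  simp only [triple, map_add, cyc_cyc_cyc]
  abel

theorem triple_add (a b c d : A) : P.triple a b (c + d) = P.triple a b c + P.triple a b d := by
  simp only [triple, nested, map_add, LinearMap.add_apply, LinearMap.rTensor_add]
  abel

theorem triple_smul (a b c : A) (r : k) : P.triple a b (r • c) = r • P.triple a b c := by
  simp only [triple, nested, map_smul, LinearMap.smul_apply, LinearMap.rTensor_smul, smul_add]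

end DoubleBracket

theorem dist3_add (a b c d : A) :
    dist3 (k := k) a b (c + d) = dist3 a b c + dist3 a b d := by
  simp only [dist3, add_mul, mul_add, TensorProduct.add_tmul, TensorProduct.tmul_add]
  abel

theorem dist3_smul (a b c : A) (r : k) : dist3 (k := k) a b (r • c) = r • dist3 a b c := by
  simp only [dist3, smul_mul_assoc, mul_smul_comm, TensorProduct.smul_tmul',
    TensorProduct.tmul_smul, smul_sub, smul_add]

/-- A double bracket on `k⟨x, y⟩_S` is quasi-Poisson if the condition holds on generators. -/
theorem isQuasiPoisson_of_generators (P : DoubleBracket k (F2S k))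
    (hxxx : P.triple (F2S.x k) (F2S.x k) (F2S.x k) =
      (4 : k)⁻¹ • dist3 (F2S.x k) (F2S.x k) (F2S.x k))
    (hyxx : P.triple (F2S.y k) (F2S.x k) (F2S.x k) =
      (4 : k)⁻¹ • dist3 (F2S.y k) (F2S.x k) (F2S.x k))
    (hyyx : P.triple (F2S.y k) (F2S.y k) (F2S.x k) =
      (4 : k)⁻¹ • dist3 (F2S.y k) (F2S.y k) (F2S.x k))
    (hyyy : P.triple (F2S.y k) (F2S.y k) (F2S.y k) =
      (4 : k)⁻¹ • dist3 (F2S.y k) (F2S.y k) (F2S.y k)) : P.IsQuasiPoisson := by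
  let S : F2S k → F2S k → F2S k → Prop := fun a b c =>
    P.triple a b c = (4 : k)⁻¹ • dist3 a b c
  -- Both sides are cyclically invariant, so the four given words represent all words of length
  -- three in `x` and `y`.
  have hcyc : ∀ a b c, S b c a → S a b c := by
    intro a b c h
    change P.triple a b c = _
    rw [← P.cyc_triple, h, map_smul, cyc_dist3]
  have hder : ∀ a b, S a b (F2S.x k) → S a b (F2S.y k) → ∀ c, S a b c := by
    intro a b hx hy c
    let δ : F2S k →ₗ[k] (F2S k ⊗[k] F2S k) ⊗[k] F2S k :=
      { toFun := P.triple a b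
        map_add' := P.triple_add a b
        map_smul' := fun r c => P.triple_smul a b c r }
    let δ' : F2S k →ₗ[k] (F2S k ⊗[k] F2S k) ⊗[k] F2S k :=
      { toFun := dist3 a b
        map_add' := dist3_add a b
        map_smul' := fun r c => dist3_smul a b c r }
    have h : IsDerivAlong in1 in3 δ := P.triple_mul a b
    have h' : IsDerivAlong in1 in3 δ' := dist3_mul a b
    exact DFunLike.congr_fun (h.ext (h'.smul (4 : k)⁻¹) hx hy) c
  -- The slots are freed one at a time: the last by the derivation property, then the next is
  -- rotated into last position.
  have xx : ∀ c, S (F2S.x k) (F2S.x k) c := hder _ _ hxxx (hcyc _ _ _ (hcyc _ _ _ hyxx))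
  have yx : ∀ c, S (F2S.y k) (F2S.x k) c := hder _ _ hyxx (hcyc _ _ _ (hcyc _ _ _ hyyx))
  have xy : ∀ c, S (F2S.x k) (F2S.y k) c := hder _ _ (hcyc _ _ _ hyxx) (hcyc _ _ _ hyyx)
  have yy : ∀ c, S (F2S.y k) (F2S.y k) c := hder _ _ hyyx hyyy
  have hx : ∀ c d, S (F2S.x k) c d := fun c =>
    hder _ _ (hcyc _ _ _ (hcyc _ _ _ (xx c))) (hcyc _ _ _ (hcyc _ _ _ (yx c)))
  have hy : ∀ c d, S (F2S.y k) c d := fun c =>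
    hder _ _ (hcyc _ _ _ (hcyc _ _ _ (xy c))) (hcyc _ _ _ (hcyc _ _ _ (yy c)))
  exact fun a b c => hder a b (hcyc _ _ _ (hcyc _ _ _ (hx a b)))
    (hcyc _ _ _ (hcyc _ _ _ (hy a b))) c

/-- The right hand side of the moment map condition. -/
def momentRhs (Φ a : A) : A ⊗[k] A := (2 : k)⁻¹ •
  (a ⊗ₜ[k] Φ - (1 : A) ⊗ₜ[k] (Φ * a) + (a * Φ) ⊗ₜ[k] (1 : A) - Φ ⊗ₜ[k] a)

/-- The right hand side of the moment map condition is itself an outer derivation in `a`: the mixed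
terms cancel in the Leibniz rule. -/
theorem isMomentMap_of_generators (P : DoubleBracket k (F2S k)) {Φ : F2S k} (hΦ : IsUnit Φ)
    (hx : P.br Φ (F2S.x k) = momentRhs Φ (F2S.x k))
    (hy : P.br Φ (F2S.y k) = momentRhs Φ (F2S.y k)) : P.IsMomentMap Φ := by
  refine ⟨hΦ, fun a => ?_⟩
  let δ : F2S k →ₗ[k] F2S k ⊗[k] F2S k :=
    { toFun := momentRhs Φ
      map_add' := fun a b => by
        simp only [momentRhs, add_mul, mul_add, TensorProduct.add_tmul, TensorProduct.tmul_add]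
        module
      map_smul' := fun r a => by
        simp only [momentRhs, smul_mul_assoc, mul_smul_comm, ← TensorProduct.smul_tmul',
          TensorProduct.tmul_smul, RingHom.id_apply]
        module }
  have h : IsDerivAlong inl inr δ := by
    intro a b
    change momentRhs Φ (a * b) = momentRhs Φ a * (1 ⊗ₜ b) + (a ⊗ₜ 1) * momentRhs Φ b
    simp only [momentRhs, mul_add, add_mul, mul_sub, sub_mul, smul_mul_assoc, mul_smul_comm,
      Algebra.TensorProduct.tmul_mul_tmul, mul_one, one_mul, mul_assoc]
    module
  exact DFunLike.congr_fun ((P.isDerivAlong Φ).ext h hx hy) a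

end QuasiPoisson

end QuasiHam

end

/-! ### Bracket computations for a pair with invertible `1 + xy` and `1 + yx`. -/

noncomputable section

set_option linter.unusedSimpArgs false

namespace QuasiHam

/-! ### Pairs of elements with invertible `1 + xy` and `1 + yx` -/

section Pairs

variable {k A : Type*} [Field k] [Ring A] [Algebra k A]

/-- Elements `x, y` with `u = 1 + xy` and `v = 1 + yx` invertible, with inverses `U` and `V`. -/
structure IsLocPair (x y u U v V : A) : Prop where
  u_eq : u = 1 + x * y
  v_eq : v = 1 + y * x
  uU : u * U = 1
  Uu : U * u = 1
  vV : v * V = 1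
  Vv : V * v = 1

namespace IsLocPair

variable {x y u U v V : A}

theorem map {B : Type*} [Ring B] [Algebra k B] (h : IsLocPair x y u U v V) (f : A →ₐ[k] B) :
    IsLocPair (f x) (f y) (f u) (f U) (f v) (f V) where
  u_eq := by rw [h.u_eq]; simp
  v_eq := by rw [h.v_eq]; simp
  uU := by rw [← map_mul, h.uU, map_one]
  Uu := by rw [← map_mul, h.Uu, map_one]
  vV := by rw [← map_mul, h.vV, map_one]
  Vv := by rw [← map_mul, h.Vv, map_one]

theorem inv_unique (h : IsLocPair x y u U v V) {U' V' : A} (h' : IsLocPair x y u U' v V') :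
    U = U' ∧ V = V' :=
  ⟨left_inv_eq_right_inv h.Uu h'.uU, left_inv_eq_right_inv h.Vv h'.vV⟩

variable (h : IsLocPair x y u U v V)
include h

/-- This and the following relations form a rewriting system on words in `x, y, u, U, v, V`: `xy`
and `yx` are eliminated, `u, U` are moved right past `x`, and `v, V` right past `y`. The `_assoc`
forms apply the same rules inside right-nested products. After rewriting, the bracket identities
below become linear and `module` closes them. -/
theorem xy : x * y = u - 1 := by rw [h.u_eq]; abel

theorem yx : y * x = v - 1 := by rw [h.v_eq]; abel

theorem ux : u * x = x * v := by rw [h.u_eq, h.v_eq]; noncomm_ring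

theorem vy : v * y = y * u := by rw [h.u_eq, h.v_eq]; noncomm_ring

theorem Ux : U * x = x * V := by
  calc U * x = U * (x * v) * V := by rw [mul_assoc, mul_assoc, h.vV, mul_one]
    _ = x * V := by rw [← h.ux, ← mul_assoc, h.Uu, one_mul]

theorem Vy : V * y = y * U := by
  calc V * y = V * (y * u) * U := by rw [mul_assoc, mul_assoc, h.uU, mul_one]
    _ = y * U := by rw [← h.vy, ← mul_assoc, h.Vv, one_mul]

theorem uU_assoc (t : A) : u * (U * t) = t := by rw [← mul_assoc, h.uU, one_mul]

theorem Uu_assoc (t : A) : U * (u * t) = t := by rw [← mul_assoc, h.Uu, one_mul]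

theorem vV_assoc (t : A) : v * (V * t) = t := by rw [← mul_assoc, h.vV, one_mul]

theorem Vv_assoc (t : A) : V * (v * t) = t := by rw [← mul_assoc, h.Vv, one_mul]

theorem xy_assoc (t : A) : x * (y * t) = u * t - t := by rw [← mul_assoc, h.xy, sub_mul, one_mul]

theorem yx_assoc (t : A) : y * (x * t) = v * t - t := by rw [← mul_assoc, h.yx, sub_mul, one_mul]

theorem ux_assoc (t : A) : u * (x * t) = x * (v * t) := by rw [← mul_assoc, h.ux, mul_assoc]

theorem vy_assoc (t : A) : v * (y * t) = y * (u * t) := by rw [← mul_assoc, h.vy, mul_assoc]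

theorem Ux_assoc (t : A) : U * (x * t) = x * (V * t) := by rw [← mul_assoc, h.Ux, mul_assoc]

theorem Vy_assoc (t : A) : V * (y * t) = y * (U * t) := by rw [← mul_assoc, h.Vy, mul_assoc]

end IsLocPair

theorem DoubleBracket.br_one (P : DoubleBracket k A) (a : A) : P.br a 1 = 0 := by
  have h := P.deriv_right a 1 1
  rw [← Algebra.TensorProduct.one_def, mul_one, mul_one, one_mul] at h
  simpa using h

theorem DoubleBracket.br_inv_right (P : DoubleBracket k A) (a : A) {s t : A} (hst : s * t = 1)
    (hts : t * s = 1) : P.br a t = -((t ⊗ₜ 1) * P.br a s * (1 ⊗ₜ t)) := by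
  have h := P.deriv_right a t s
  rw [hts, P.br_one] at h
  have h' : P.br a t = (P.br a t * (1 ⊗ₜ s)) * (1 ⊗ₜ t) := by
    rw [mul_assoc, Algebra.TensorProduct.tmul_mul_tmul, hst, mul_one,
      ← Algebra.TensorProduct.one_def, mul_one]
  rw [h', eq_neg_of_add_eq_zero_left h.symm, neg_mul]

/-- The double bracket with values on the pair `x, y` as in the first (`ε = 1`) or the second
(`ε = -1`) structure. -/
structure IsSignedBracket (P : DoubleBracket k A) (ε : k) (x y : A) : Prop where
  xx : P.br x x = -((ε * 2⁻¹) • ((x * x) ⊗ₜ[k] (1 : A) - (1 : A) ⊗ₜ[k] (x * x)))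
  yy : P.br y y = (ε * 2⁻¹) • ((y * y) ⊗ₜ[k] (1 : A) - (1 : A) ⊗ₜ[k] (y * y))
  yx : P.br y x = (1 : A) ⊗ₜ[k] (1 : A) + (2 : k)⁻¹ •
    ((x * y) ⊗ₜ[k] (1 : A) + (1 : A) ⊗ₜ[k] (y * x)) + (ε * 2⁻¹) • (x ⊗ₜ[k] y - y ⊗ₜ[k] x)

namespace IsSignedBracket

variable [CharZero k] {P : DoubleBracket k A} {ε : k} {x y u U v V : A}

theorem xy (hP : IsSignedBracket P ε x y) : P.br x y = -((1 : A) ⊗ₜ[k] (1 : A)) - (2 : k)⁻¹ •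
    ((1 : A) ⊗ₜ[k] (x * y) + (y * x) ⊗ₜ[k] (1 : A)) - (ε * 2⁻¹) • (y ⊗ₜ[k] x - x ⊗ₜ[k] y) := by
  rw [P.cyclic_antisymm, hP.yx]
  simp only [map_add, map_sub, map_smul, TensorProduct.comm_tmul]
  module

variable (hP : IsSignedBracket P ε x y) (h : IsLocPair x y u U v V)
include hP h

/-- Start of a table of brackets. Entries come from the Leibniz rule for `u = 1 + xy` and `v = 1 +
yx`, from `br_inv_right` for the inverses, and from antisymmetry. All of this is linear in the
bracket, so `ε` may stay arbitrary. -/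
theorem ux : P.br u x = (2 : k)⁻¹ • (u ⊗ₜ[k] x + (1 : A) ⊗ₜ[k] (x * v)) +
    (ε * 2⁻¹) • (x ⊗ₜ[k] u - (x * u) ⊗ₜ[k] (1 : A)) := by
  have h1 : P.br 1 x = 0 := by rw [P.cyclic_antisymm, P.br_one]; simp
  rw [h.u_eq, map_add, LinearMap.add_apply, h1, P.deriv_left, hP.yx, hP.xx, ← h.u_eq]
  simp only [mul_add, add_mul, mul_sub, sub_mul, smul_add, smul_sub, neg_mul, mul_neg,
    smul_mul_assoc, mul_smul_comm, Algebra.TensorProduct.tmul_mul_tmul, mul_one, one_mul, mul_assoc,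
    TensorProduct.add_tmul, TensorProduct.tmul_add, TensorProduct.sub_tmul, TensorProduct.tmul_sub,
    h.xy, h.yx, h.ux, h.vy, h.xy_assoc, h.yx_assoc, h.ux_assoc, h.vy_assoc]
  module

theorem uy : P.br u y = -((2 : k)⁻¹ • (y ⊗ₜ[k] u + (y * u) ⊗ₜ[k] (1 : A))) +
    (ε * 2⁻¹) • (u ⊗ₜ[k] y - (1 : A) ⊗ₜ[k] (u * y)) := by
  have h1 : P.br 1 y = 0 := by rw [P.cyclic_antisymm, P.br_one]; simp
  rw [h.u_eq, map_add, LinearMap.add_apply, h1, P.deriv_left, hP.yy, hP.xy, ← h.u_eq]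
  simp only [mul_add, add_mul, mul_sub, sub_mul, smul_add, smul_sub, neg_mul, mul_neg,
    smul_mul_assoc, mul_smul_comm, Algebra.TensorProduct.tmul_mul_tmul, mul_one, one_mul, mul_assoc,
    TensorProduct.add_tmul, TensorProduct.tmul_add, TensorProduct.sub_tmul, TensorProduct.tmul_sub,
    h.xy, h.yx, h.ux, h.vy, h.xy_assoc, h.yx_assoc, h.ux_assoc, h.vy_assoc]
  module

theorem vx : P.br v x = (2 : k)⁻¹ • ((x * v) ⊗ₜ[k] (1 : A) + x ⊗ₜ[k] v) +
    (ε * 2⁻¹) • ((1 : A) ⊗ₜ[k] (v * x) - v ⊗ₜ[k] x) := by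
  have h1 : P.br 1 x = 0 := by rw [P.cyclic_antisymm, P.br_one]; simp
  rw [h.v_eq, map_add, LinearMap.add_apply, h1, P.deriv_left, hP.yx, hP.xx, ← h.v_eq]
  simp only [mul_add, add_mul, mul_sub, sub_mul, smul_add, smul_sub, neg_mul, mul_neg,
    smul_mul_assoc, mul_smul_comm, Algebra.TensorProduct.tmul_mul_tmul, mul_one, one_mul, mul_assoc,
    TensorProduct.add_tmul, TensorProduct.tmul_add, TensorProduct.sub_tmul, TensorProduct.tmul_sub,
    h.xy, h.yx, h.ux, h.vy, h.xy_assoc, h.yx_assoc, h.ux_assoc, h.vy_assoc]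
  module

theorem vy : P.br v y = -((2 : k)⁻¹ • ((1 : A) ⊗ₜ[k] (y * u) + v ⊗ₜ[k] y)) +
    (ε * 2⁻¹) • ((y * v) ⊗ₜ[k] (1 : A) - y ⊗ₜ[k] v) := by
  have h1 : P.br 1 y = 0 := by rw [P.cyclic_antisymm, P.br_one]; simp
  rw [h.v_eq, map_add, LinearMap.add_apply, h1, P.deriv_left, hP.yy, hP.xy, ← h.v_eq]
  simp only [mul_add, add_mul, mul_sub, sub_mul, smul_add, smul_sub, neg_mul, mul_neg,
    smul_mul_assoc, mul_smul_comm, Algebra.TensorProduct.tmul_mul_tmul, mul_one, one_mul, mul_assoc,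
    TensorProduct.add_tmul, TensorProduct.tmul_add, TensorProduct.sub_tmul, TensorProduct.tmul_sub,
    h.xy, h.yx, h.ux, h.vy, h.xy_assoc, h.yx_assoc, h.ux_assoc, h.vy_assoc]
  module

theorem xu : P.br x u = (2 : k)⁻¹ • (-(x ⊗ₜ[k] u) - (x * v) ⊗ₜ[k] (1 : A)) +
    (ε * 2⁻¹) • ((1 : A) ⊗ₜ[k] (x * u) - u ⊗ₜ[k] x) := by
  rw [P.cyclic_antisymm, hP.ux h]
  simp only [map_add, map_sub, map_neg, map_smul, TensorProduct.comm_tmul]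
  module

theorem yu : P.br y u = (2 : k)⁻¹ • ((1 : A) ⊗ₜ[k] (y * u) + u ⊗ₜ[k] y) +
    (ε * 2⁻¹) • ((u * y) ⊗ₜ[k] (1 : A) - y ⊗ₜ[k] u) := by
  rw [P.cyclic_antisymm, hP.uy h]
  simp only [map_add, map_sub, map_neg, map_smul, TensorProduct.comm_tmul]
  module

theorem uu : P.br u u = (2 : k)⁻¹ • ((1 : A) ⊗ₜ[k] (u * u) - (u * u) ⊗ₜ[k] (1 : A)) := by
  nth_rewrite 2 [h.u_eq]
  rw [map_add, P.br_one, P.deriv_right, hP.ux h, hP.uy h]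
  simp only [mul_add, add_mul, mul_sub, sub_mul, smul_add, smul_sub, smul_neg, neg_mul, mul_neg,
    zero_add, smul_mul_assoc, mul_smul_comm, Algebra.TensorProduct.tmul_mul_tmul, mul_one, one_mul,
    mul_assoc, TensorProduct.add_tmul, TensorProduct.tmul_add, TensorProduct.sub_tmul,
    TensorProduct.tmul_sub, h.xy, h.yx, h.ux, h.vy, h.xy_assoc, h.yx_assoc, h.ux_assoc, h.vy_assoc,
    h.uU, h.Uu, h.vV, h.Vv, h.uU_assoc, h.Uu_assoc, h.vV_assoc, h.Vv_assoc, h.Ux, h.Vy, h.Ux_assoc,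
    h.Vy_assoc]
  module

theorem xU : P.br x U = (2 : k)⁻¹ • (x ⊗ₜ[k] U + (x * V) ⊗ₜ[k] (1 : A)) +
    (ε * 2⁻¹) • ((1 : A) ⊗ₜ[k] (x * U) - U ⊗ₜ[k] x) := by
  rw [P.br_inv_right x h.uU h.Uu, hP.xu h]
  simp only [mul_add, add_mul, mul_sub, sub_mul, smul_add, smul_sub, smul_neg, neg_mul, mul_neg,
    zero_add, smul_mul_assoc, mul_smul_comm, Algebra.TensorProduct.tmul_mul_tmul, mul_one, one_mul,
    mul_assoc, TensorProduct.add_tmul, TensorProduct.tmul_add, TensorProduct.sub_tmul,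
    TensorProduct.tmul_sub, h.xy, h.yx, h.ux, h.vy, h.xy_assoc, h.yx_assoc, h.ux_assoc, h.vy_assoc,
    h.uU, h.Uu, h.vV, h.Vv, h.uU_assoc, h.Uu_assoc, h.vV_assoc, h.Vv_assoc, h.Ux, h.Vy, h.Ux_assoc,
    h.Vy_assoc]
  module

theorem yU : P.br y U = (2 : k)⁻¹ • (-((1 : A) ⊗ₜ[k] (y * U)) - U ⊗ₜ[k] y) +
    (ε * 2⁻¹) • ((U * y) ⊗ₜ[k] (1 : A) - y ⊗ₜ[k] U) := by
  rw [P.br_inv_right y h.uU h.Uu, hP.yu h]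
  simp only [mul_add, add_mul, mul_sub, sub_mul, smul_add, smul_sub, smul_neg, neg_mul, mul_neg,
    zero_add, smul_mul_assoc, mul_smul_comm, Algebra.TensorProduct.tmul_mul_tmul, mul_one, one_mul,
    mul_assoc, TensorProduct.add_tmul, TensorProduct.tmul_add, TensorProduct.sub_tmul,
    TensorProduct.tmul_sub, h.xy, h.yx, h.ux, h.vy, h.xy_assoc, h.yx_assoc, h.ux_assoc, h.vy_assoc,
    h.uU, h.Uu, h.vV, h.Vv, h.uU_assoc, h.Uu_assoc, h.vV_assoc, h.Vv_assoc, h.Ux, h.Vy, h.Ux_assoc,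
    h.Vy_assoc]
  module

theorem uU : P.br u U = (2 : k)⁻¹ • (u ⊗ₜ[k] U - U ⊗ₜ[k] u) := by
  rw [P.br_inv_right u h.uU h.Uu, hP.uu h]
  simp only [mul_add, add_mul, mul_sub, sub_mul, smul_add, smul_sub, smul_neg, neg_mul, mul_neg,
    zero_add, smul_mul_assoc, mul_smul_comm, Algebra.TensorProduct.tmul_mul_tmul, mul_one, one_mul,
    mul_assoc, TensorProduct.add_tmul, TensorProduct.tmul_add, TensorProduct.sub_tmul,
    TensorProduct.tmul_sub, h.xy, h.yx, h.ux, h.vy, h.xy_assoc, h.yx_assoc, h.ux_assoc, h.vy_assoc,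
    h.uU, h.Uu, h.vV, h.Vv, h.uU_assoc, h.Uu_assoc, h.vV_assoc, h.Vv_assoc, h.Ux, h.Vy, h.Ux_assoc,
    h.Vy_assoc]
  module

theorem Ux : P.br U x = (2 : k)⁻¹ • (-((1 : A) ⊗ₜ[k] (x * V)) - U ⊗ₜ[k] x) +
    (ε * 2⁻¹) • (x ⊗ₜ[k] U - (x * U) ⊗ₜ[k] (1 : A)) := by
  rw [P.cyclic_antisymm, hP.xU h]
  simp only [map_add, map_sub, map_neg, map_smul, TensorProduct.comm_tmul]
  module

theorem Uy : P.br U y = (2 : k)⁻¹ • (y ⊗ₜ[k] U + (y * U) ⊗ₜ[k] (1 : A)) +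
    (ε * 2⁻¹) • (U ⊗ₜ[k] y - (1 : A) ⊗ₜ[k] (U * y)) := by
  rw [P.cyclic_antisymm, hP.yU h]
  simp only [map_add, map_sub, map_neg, map_smul, TensorProduct.comm_tmul]
  module

theorem Uu : P.br U u = (2 : k)⁻¹ • (u ⊗ₜ[k] U - U ⊗ₜ[k] u) := by
  rw [P.cyclic_antisymm, hP.uU h]
  simp only [map_add, map_sub, map_neg, map_smul, TensorProduct.comm_tmul]
  module

theorem UU : P.br U U = (2 : k)⁻¹ • ((U * U) ⊗ₜ[k] (1 : A) - (1 : A) ⊗ₜ[k] (U * U)) := by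
  rw [P.br_inv_right U h.uU h.Uu, hP.Uu h]
  simp only [mul_add, add_mul, mul_sub, sub_mul, smul_add, smul_sub, smul_neg, neg_mul, mul_neg,
    zero_add, smul_mul_assoc, mul_smul_comm, Algebra.TensorProduct.tmul_mul_tmul, mul_one, one_mul,
    mul_assoc, TensorProduct.add_tmul, TensorProduct.tmul_add, TensorProduct.sub_tmul,
    TensorProduct.tmul_sub, h.xy, h.yx, h.ux, h.vy, h.xy_assoc, h.yx_assoc, h.ux_assoc, h.vy_assoc,
    h.uU, h.Uu, h.vV, h.Vv, h.uU_assoc, h.Uu_assoc, h.vV_assoc, h.Vv_assoc, h.Ux, h.Vy, h.Ux_assoc,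
    h.Vy_assoc]
  module

theorem xv : P.br x v = (2 : k)⁻¹ • (-((1 : A) ⊗ₜ[k] (x * v)) - v ⊗ₜ[k] x) +
    (ε * 2⁻¹) • (x ⊗ₜ[k] v - (v * x) ⊗ₜ[k] (1 : A)) := by
  rw [P.cyclic_antisymm, hP.vx h]
  simp only [map_add, map_sub, map_neg, map_smul, TensorProduct.comm_tmul]
  module

theorem yv : P.br y v = (2 : k)⁻¹ • (y ⊗ₜ[k] v + (y * u) ⊗ₜ[k] (1 : A)) +
    (ε * 2⁻¹) • (v ⊗ₜ[k] y - (1 : A) ⊗ₜ[k] (y * v)) := by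
  rw [P.cyclic_antisymm, hP.vy h]
  simp only [map_add, map_sub, map_neg, map_smul, TensorProduct.comm_tmul]
  module

theorem vv : P.br v v = (2 : k)⁻¹ • ((v * v) ⊗ₜ[k] (1 : A) - (1 : A) ⊗ₜ[k] (v * v)) := by
  nth_rewrite 2 [h.v_eq]
  rw [map_add, P.br_one, P.deriv_right, hP.vx h, hP.vy h]
  simp only [mul_add, add_mul, mul_sub, sub_mul, smul_add, smul_sub, smul_neg, neg_mul, mul_neg,
    zero_add, smul_mul_assoc, mul_smul_comm, Algebra.TensorProduct.tmul_mul_tmul, mul_one, one_mul,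
    mul_assoc, TensorProduct.add_tmul, TensorProduct.tmul_add, TensorProduct.sub_tmul,
    TensorProduct.tmul_sub, h.xy, h.yx, h.ux, h.vy, h.xy_assoc, h.yx_assoc, h.ux_assoc, h.vy_assoc,
    h.uU, h.Uu, h.vV, h.Vv, h.uU_assoc, h.Uu_assoc, h.vV_assoc, h.Vv_assoc, h.Ux, h.Vy, h.Ux_assoc,
    h.Vy_assoc]
  module

theorem xV : P.br x V = (2 : k)⁻¹ • ((1 : A) ⊗ₜ[k] (x * V) + V ⊗ₜ[k] x) +
    (ε * 2⁻¹) • (x ⊗ₜ[k] V - (V * x) ⊗ₜ[k] (1 : A)) := by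
  rw [P.br_inv_right x h.vV h.Vv, hP.xv h]
  simp only [mul_add, add_mul, mul_sub, sub_mul, smul_add, smul_sub, smul_neg, neg_mul, mul_neg,
    zero_add, smul_mul_assoc, mul_smul_comm, Algebra.TensorProduct.tmul_mul_tmul, mul_one, one_mul,
    mul_assoc, TensorProduct.add_tmul, TensorProduct.tmul_add, TensorProduct.sub_tmul,
    TensorProduct.tmul_sub, h.xy, h.yx, h.ux, h.vy, h.xy_assoc, h.yx_assoc, h.ux_assoc, h.vy_assoc,
    h.uU, h.Uu, h.vV, h.Vv, h.uU_assoc, h.Uu_assoc, h.vV_assoc, h.Vv_assoc, h.Ux, h.Vy, h.Ux_assoc,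
    h.Vy_assoc]
  module

theorem yV : P.br y V = (2 : k)⁻¹ • (-(y ⊗ₜ[k] V) - (y * U) ⊗ₜ[k] (1 : A)) +
    (ε * 2⁻¹) • (V ⊗ₜ[k] y - (1 : A) ⊗ₜ[k] (y * V)) := by
  rw [P.br_inv_right y h.vV h.Vv, hP.yv h]
  simp only [mul_add, add_mul, mul_sub, sub_mul, smul_add, smul_sub, smul_neg, neg_mul, mul_neg,
    zero_add, smul_mul_assoc, mul_smul_comm, Algebra.TensorProduct.tmul_mul_tmul, mul_one, one_mul,
    mul_assoc, TensorProduct.add_tmul, TensorProduct.tmul_add, TensorProduct.sub_tmul,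
    TensorProduct.tmul_sub, h.xy, h.yx, h.ux, h.vy, h.xy_assoc, h.yx_assoc, h.ux_assoc, h.vy_assoc,
    h.uU, h.Uu, h.vV, h.Vv, h.uU_assoc, h.Uu_assoc, h.vV_assoc, h.Vv_assoc, h.Ux, h.Vy, h.Ux_assoc,
    h.Vy_assoc]
  module

theorem vV : P.br v V = (2 : k)⁻¹ • (V ⊗ₜ[k] v - v ⊗ₜ[k] V) := by
  rw [P.br_inv_right v h.vV h.Vv, hP.vv h]
  simp only [mul_add, add_mul, mul_sub, sub_mul, smul_add, smul_sub, smul_neg, neg_mul, mul_neg,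
    zero_add, smul_mul_assoc, mul_smul_comm, Algebra.TensorProduct.tmul_mul_tmul, mul_one, one_mul,
    mul_assoc, TensorProduct.add_tmul, TensorProduct.tmul_add, TensorProduct.sub_tmul,
    TensorProduct.tmul_sub, h.xy, h.yx, h.ux, h.vy, h.xy_assoc, h.yx_assoc, h.ux_assoc, h.vy_assoc,
    h.uU, h.Uu, h.vV, h.Vv, h.uU_assoc, h.Uu_assoc, h.vV_assoc, h.Vv_assoc, h.Ux, h.Vy, h.Ux_assoc,
    h.Vy_assoc]
  module

theorem Vy : P.br V y = (2 : k)⁻¹ • ((1 : A) ⊗ₜ[k] (y * U) + V ⊗ₜ[k] y) +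
    (ε * 2⁻¹) • ((y * V) ⊗ₜ[k] (1 : A) - y ⊗ₜ[k] V) := by
  rw [P.cyclic_antisymm, hP.yV h]
  simp only [map_add, map_sub, map_neg, map_smul, TensorProduct.comm_tmul]
  module

theorem Vv : P.br V v = (2 : k)⁻¹ • (V ⊗ₜ[k] v - v ⊗ₜ[k] V) := by
  rw [P.cyclic_antisymm, hP.vV h]
  simp only [map_add, map_sub, map_neg, map_smul, TensorProduct.comm_tmul]
  module

theorem VV : P.br V V = (2 : k)⁻¹ • ((1 : A) ⊗ₜ[k] (V * V) - (V * V) ⊗ₜ[k] (1 : A)) := by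
  rw [P.br_inv_right V h.vV h.Vv, hP.Vv h]
  simp only [mul_add, add_mul, mul_sub, sub_mul, smul_add, smul_sub, smul_neg, neg_mul, mul_neg,
    zero_add, smul_mul_assoc, mul_smul_comm, Algebra.TensorProduct.tmul_mul_tmul, mul_one, one_mul,
    mul_assoc, TensorProduct.add_tmul, TensorProduct.tmul_add, TensorProduct.sub_tmul,
    TensorProduct.tmul_sub, h.xy, h.yx, h.ux, h.vy, h.xy_assoc, h.yx_assoc, h.ux_assoc, h.vy_assoc,
    h.uU, h.Uu, h.vV, h.Vv, h.uU_assoc, h.Uu_assoc, h.vV_assoc, h.Vv_assoc, h.Ux, h.Vy, h.Ux_assoc,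
    h.Vy_assoc]
  module

/-- The substitution behind `θ`; it keeps the sign, so it can be iterated within one structure. -/
theorem mul_left : IsSignedBracket P ε (u * x) (y * U) := by
  constructor
  all_goals
    try simp only [P.deriv_left, P.deriv_right, map_neg, LinearMap.neg_apply]
    simp only [mul_add, add_mul, mul_sub, sub_mul, smul_add, smul_sub, smul_neg, neg_mul, mul_neg,
      zero_add, smul_mul_assoc, mul_smul_comm, Algebra.TensorProduct.tmul_mul_tmul, mul_one,
      one_mul, mul_assoc, TensorProduct.add_tmul, TensorProduct.tmul_add, TensorProduct.sub_tmul,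
      TensorProduct.tmul_sub, TensorProduct.neg_tmul, TensorProduct.tmul_neg, h.xy, h.yx, h.ux,
      h.vy, h.xy_assoc, h.yx_assoc, h.ux_assoc, h.vy_assoc, h.uU, h.Uu, h.vV, h.Vv, h.uU_assoc,
      h.Uu_assoc, h.vV_assoc, h.Vv_assoc, h.Ux, h.Vy, h.Ux_assoc, h.Vy_assoc, hP.xx, hP.yy, hP.yx,
      hP.xy, hP.ux h, hP.uy h, hP.xu h, hP.yu h, hP.uu h, hP.xU h, hP.yU h, hP.uU h, hP.Ux h,
      hP.Uy h, hP.Uu h, hP.UU h, hP.xV h, hP.yV h, hP.Vy h, hP.VV h]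
    module

/-- The substitution behind `ξ`. Reversal of the sign is what lets `ξ` exchange the two structures,
and what produces the second structure from the first. -/
theorem swap : IsSignedBracket P (-ε) (-(V * y)) x := by
  constructor
  all_goals
    try simp only [P.deriv_left, P.deriv_right, map_neg, LinearMap.neg_apply]
    simp only [mul_add, add_mul, mul_sub, sub_mul, smul_add, smul_sub, smul_neg, neg_mul, mul_neg,
      zero_add, smul_mul_assoc, mul_smul_comm, Algebra.TensorProduct.tmul_mul_tmul, mul_one,
      one_mul, mul_assoc, TensorProduct.add_tmul, TensorProduct.tmul_add, TensorProduct.sub_tmul,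
      TensorProduct.tmul_sub, TensorProduct.neg_tmul, TensorProduct.tmul_neg, h.xy, h.yx, h.ux,
      h.vy, h.xy_assoc, h.yx_assoc, h.ux_assoc, h.vy_assoc, h.uU, h.Uu, h.vV, h.Vv, h.uU_assoc,
      h.Uu_assoc, h.vV_assoc, h.Vv_assoc, h.Ux, h.Vy, h.Ux_assoc, h.Vy_assoc, hP.xx, hP.yy, hP.yx,
      hP.xy, hP.ux h, hP.uy h, hP.xu h, hP.yu h, hP.uu h, hP.xU h, hP.yU h, hP.uU h, hP.Ux h,
      hP.Uy h, hP.Uu h, hP.UU h, hP.xV h, hP.yV h, hP.Vy h, hP.VV h]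
    module

end IsSignedBracket

namespace IsSignedBracket

variable [CharZero k] {P : DoubleBracket k A} {x y u U v V : A}

/-- The substitution behind `ψ`, in the one direction needed. It fits the moment maps: the new pair
has `u' = u` and `v' = U * v * u`, so the first moment map of the new pair is `v' * U = U * v`, the
second one of the old pair. -/
theorem mul_right (hP : IsSignedBracket P (-1) x y) (h : IsLocPair x y u U v V) :
    IsSignedBracket P 1 (x * u) (U * y) := by
  constructor
  all_goals
    try simp only [P.deriv_left, P.deriv_right, map_neg, LinearMap.neg_apply]
    simp only [mul_add, add_mul, mul_sub, sub_mul, smul_add, smul_sub, smul_neg, neg_mul, mul_neg,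
      zero_add, smul_mul_assoc, mul_smul_comm, Algebra.TensorProduct.tmul_mul_tmul, mul_one,
      one_mul, mul_assoc, TensorProduct.add_tmul, TensorProduct.tmul_add, TensorProduct.sub_tmul,
      TensorProduct.tmul_sub, TensorProduct.neg_tmul, TensorProduct.tmul_neg, h.xy, h.yx, h.ux,
      h.vy, h.xy_assoc, h.yx_assoc, h.ux_assoc, h.vy_assoc, h.uU, h.Uu, h.vV, h.Vv, h.uU_assoc,
      h.Uu_assoc, h.vV_assoc, h.Vv_assoc, h.Ux, h.Vy, h.Ux_assoc, h.Vy_assoc, hP.xx, hP.yy, hP.yx,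
      hP.xy, hP.ux h, hP.uy h, hP.xu h, hP.yu h, hP.uu h, hP.xU h, hP.yU h, hP.uU h, hP.Ux h,
      hP.Uy h, hP.Uu h, hP.UU h, hP.xV h, hP.yV h, hP.Vy h, hP.VV h]
    module

theorem moment_x (hP : IsSignedBracket P 1 x y) (h : IsLocPair x y u U v V) :
    P.br (v * U) x = momentRhs (v * U) x := by
  rw [P.deriv_left, hP.vx h, hP.Ux h, momentRhs]
  simp only [mul_add, add_mul, mul_sub, sub_mul, smul_add, smul_sub, smul_neg, neg_mul, mul_neg,
    zero_add, smul_mul_assoc, mul_smul_comm, Algebra.TensorProduct.tmul_mul_tmul, mul_one,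
    one_mul, mul_assoc, TensorProduct.add_tmul, TensorProduct.tmul_add, TensorProduct.sub_tmul,
    TensorProduct.tmul_sub, TensorProduct.neg_tmul, TensorProduct.tmul_neg, h.xy, h.yx, h.ux,
    h.vy, h.xy_assoc, h.yx_assoc, h.ux_assoc, h.vy_assoc, h.uU, h.Uu, h.vV, h.Vv, h.uU_assoc,
    h.Uu_assoc, h.vV_assoc, h.Vv_assoc, h.Ux, h.Vy, h.Ux_assoc, h.Vy_assoc]
  module

theorem moment_y (hP : IsSignedBracket P 1 x y) (h : IsLocPair x y u U v V) :
    P.br (v * U) y = momentRhs (v * U) y := by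
  rw [P.deriv_left, hP.vy h, hP.Uy h, momentRhs]
  simp only [mul_add, add_mul, mul_sub, sub_mul, smul_add, smul_sub, smul_neg, neg_mul, mul_neg,
    zero_add, smul_mul_assoc, mul_smul_comm, Algebra.TensorProduct.tmul_mul_tmul, mul_one,
    one_mul, mul_assoc, TensorProduct.add_tmul, TensorProduct.tmul_add, TensorProduct.sub_tmul,
    TensorProduct.tmul_sub, TensorProduct.neg_tmul, TensorProduct.tmul_neg, h.xy, h.yx, h.ux,
    h.vy, h.xy_assoc, h.yx_assoc, h.ux_assoc, h.vy_assoc, h.uU, h.Uu, h.vV, h.Vv, h.uU_assoc,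
    h.Uu_assoc, h.vV_assoc, h.Vv_assoc, h.Ux, h.Vy, h.Ux_assoc, h.Vy_assoc]
  module

/-- The triple bracket is quadratic in the bracket, and the factor `1/4` is the square of the `1/2`
in the bracket. Only `ε = 1` is computed; the other sign is obtained by transport. -/
theorem triple_xxx (hP : IsSignedBracket P 1 x y) :
    P.triple x x x = (4 : k)⁻¹ • dist3 x x x := by
  simp only [DoubleBracket.triple, DoubleBracket.nested, dist3, hP.xx, hP.yy, hP.yx, hP.xy, map_add,
    map_sub, map_neg, map_smul, LinearMap.rTensor_tmul, P.deriv_right, P.br_one, mul_add, add_mul,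
    mul_sub, sub_mul, smul_add, smul_sub, smul_neg, neg_mul, mul_neg, smul_mul_assoc, mul_smul_comm,
    Algebra.TensorProduct.tmul_mul_tmul, mul_one, one_mul, mul_assoc, TensorProduct.add_tmul,
    TensorProduct.tmul_add, TensorProduct.sub_tmul, TensorProduct.tmul_sub, TensorProduct.neg_tmul,
    TensorProduct.tmul_neg, TensorProduct.zero_tmul, ← TensorProduct.smul_tmul',
    TensorProduct.tmul_smul, cyc_tmul, map_zero]
  module

theorem triple_yxx (hP : IsSignedBracket P 1 x y) :
    P.triple y x x = (4 : k)⁻¹ • dist3 y x x := by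
  simp only [DoubleBracket.triple, DoubleBracket.nested, dist3, hP.xx, hP.yy, hP.yx, hP.xy, map_add,
    map_sub, map_neg, map_smul, LinearMap.rTensor_tmul, P.deriv_right, P.br_one, mul_add, add_mul,
    mul_sub, sub_mul, smul_add, smul_sub, smul_neg, neg_mul, mul_neg, smul_mul_assoc, mul_smul_comm,
    Algebra.TensorProduct.tmul_mul_tmul, mul_one, one_mul, mul_assoc, TensorProduct.add_tmul,
    TensorProduct.tmul_add, TensorProduct.sub_tmul, TensorProduct.tmul_sub, TensorProduct.neg_tmul,
    TensorProduct.tmul_neg, TensorProduct.zero_tmul, ← TensorProduct.smul_tmul',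
    TensorProduct.tmul_smul, cyc_tmul, map_zero]
  module

theorem triple_yyx (hP : IsSignedBracket P 1 x y) :
    P.triple y y x = (4 : k)⁻¹ • dist3 y y x := by
  simp only [DoubleBracket.triple, DoubleBracket.nested, dist3, hP.xx, hP.yy, hP.yx, hP.xy, map_add,
    map_sub, map_neg, map_smul, LinearMap.rTensor_tmul, P.deriv_right, P.br_one, mul_add, add_mul,
    mul_sub, sub_mul, smul_add, smul_sub, smul_neg, neg_mul, mul_neg, smul_mul_assoc, mul_smul_comm,
    Algebra.TensorProduct.tmul_mul_tmul, mul_one, one_mul, mul_assoc, TensorProduct.add_tmul,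
    TensorProduct.tmul_add, TensorProduct.sub_tmul, TensorProduct.tmul_sub, TensorProduct.neg_tmul,
    TensorProduct.tmul_neg, TensorProduct.zero_tmul, ← TensorProduct.smul_tmul',
    TensorProduct.tmul_smul, cyc_tmul, map_zero]
  module

theorem triple_yyy (hP : IsSignedBracket P 1 x y) :
    P.triple y y y = (4 : k)⁻¹ • dist3 y y y := by
  simp only [DoubleBracket.triple, DoubleBracket.nested, dist3, hP.xx, hP.yy, hP.yx, hP.xy, map_add,
    map_sub, map_neg, map_smul, LinearMap.rTensor_tmul, P.deriv_right, P.br_one, mul_add, add_mul,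
    mul_sub, sub_mul, smul_add, smul_sub, smul_neg, neg_mul, mul_neg, smul_mul_assoc, mul_smul_comm,
    Algebra.TensorProduct.tmul_mul_tmul, mul_one, one_mul, mul_assoc, TensorProduct.add_tmul,
    TensorProduct.tmul_add, TensorProduct.sub_tmul, TensorProduct.tmul_sub, TensorProduct.neg_tmul,
    TensorProduct.tmul_neg, TensorProduct.zero_tmul, ← TensorProduct.smul_tmul',
    TensorProduct.tmul_smul, cyc_tmul, map_zero]
  module

theorem smul {ε : k} (hP : IsSignedBracket P ε x y) (β : kˣ) :
    IsSignedBracket P ε ((β : k)⁻¹ • x) ((β : k) • y) := by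
  have hβ : (β : k) ≠ 0 := β.ne_zero
  constructor
  · simp only [map_smul, LinearMap.smul_apply, hP.xx, smul_mul_assoc, mul_smul_comm,
      TensorProduct.tmul_smul, ← TensorProduct.smul_tmul']
    module
  · simp only [map_smul, LinearMap.smul_apply, hP.yy, smul_mul_assoc, mul_smul_comm,
      TensorProduct.tmul_smul, ← TensorProduct.smul_tmul']
    module
  · simp only [map_smul, LinearMap.smul_apply, hP.yx, smul_mul_assoc, mul_smul_comm,
      TensorProduct.tmul_smul, ← TensorProduct.smul_tmul', smul_smul, mul_inv_cancel₀ hβ,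
      inv_mul_cancel₀ hβ, one_smul]

end IsSignedBracket

/-! ### Images of signed brackets -/

section Functoriality

variable {P : DoubleBracket k A} {x y : A}

theorem IsSignedBracket.map {B : Type*} [Ring B] [Algebra k B] {Q : DoubleBracket k B} {ε : k}
    (hP : IsSignedBracket P ε x y) (f : A →ₐ[k] B) (hf : ∀ a b, Q.br (f a) (f b) =
      TensorProduct.map f.toLinearMap f.toLinearMap (P.br a b)) :
    IsSignedBracket Q ε (f x) (f y) := by
  constructor
  · rw [hf, hP.xx]; simp
  · rw [hf, hP.yy]; simp
  · rw [hf, hP.yx]; simp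

theorem IsSignedBracket.br_map {P : DoubleBracket k (F2S k)} {Q : DoubleBracket k A} {ε : k}
    {f : F2S k →ₐ[k] A}
    (hP : IsSignedBracket P ε (F2S.x k) (F2S.y k))
    (hQ : IsSignedBracket Q ε (f (F2S.x k)) (f (F2S.y k))) (a b : F2S k) :
    Q.br (f a) (f b) = TensorProduct.map f.toLinearMap f.toLinearMap (P.br a b) := by
  refine br_map_of_generators P Q f ?_ ?_ ?_ a b
  · rw [hQ.xx, hP.xx]; simp
  · rw [hQ.yy, hP.yy]; simp
  · rw [hQ.yx, hP.yx]; simp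

end Functoriality

end Pairs

end QuasiHam

end

/-! ### The automorphisms of `F` and the two quasi-Hamiltonian structures. -/

noncomputable section

namespace QuasiHam

/-! ### Transformations of localising pairs -/

section PairTransformations

variable {k A : Type*} [Field k] [Ring A] [Algebra k A] {x y u U v V : A}

namespace IsLocPair

/-- The product `(x * u) * (U * y)` is still `x * y`, while in the other order `1 + U * y * x * u`
is the conjugate `U * v * u`. -/
theorem mul_right (h : IsLocPair x y u U v V) :
    IsLocPair (x * u) (U * y) u U (U * v * u) (U * V * u) := by
  constructor <;> simp only [mul_assoc, h.uU_assoc, h.vV_assoc, h.Vv_assoc, h.uU, h.Uu, h.xy]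
  · abel
  · rw [h.v_eq, add_mul, mul_add, one_mul, h.Uu, mul_assoc]

theorem mul_right_inv (h : IsLocPair x y u U v V) :
    IsLocPair (x * U) (u * y) u U (u * v * U) (u * V * U) := by
  constructor <;> simp only [mul_assoc, h.Uu_assoc, h.vV_assoc, h.Vv_assoc, h.uU, h.Uu, h.xy]
  · abel
  · rw [h.v_eq, add_mul, mul_add, one_mul, h.uU, mul_assoc]

theorem mul_left (h : IsLocPair x y u U v V) : IsLocPair (u * x) (y * U) u U v V := by
  constructor <;> simp only [mul_assoc, h.Uu_assoc, h.xy_assoc, h.uU, h.Uu, h.vV, h.Vv, h.yx,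
    mul_sub, mul_one]
  · abel
  · abel

theorem mul_left_inv (h : IsLocPair x y u U v V) : IsLocPair (U * x) (y * u) u U v V := by
  constructor <;> simp only [mul_assoc, h.uU_assoc, h.xy_assoc, h.uU, h.Uu, h.vV, h.Vv, h.yx,
    mul_sub, h.Uu_assoc]
  · abel
  · abel

/-- Since `y * x = v - 1`, the new first unit is `1 - V * (v - 1) = V`; likewise the second is `U`.
-/
theorem swap (h : IsLocPair x y u U v V) : IsLocPair (-(V * y)) x V v U u where
  u_eq := by rw [neg_mul, mul_assoc, h.yx, mul_sub, h.Vv]; noncomm_ring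
  v_eq := by rw [mul_neg, h.Vy, h.xy_assoc, h.uU]; noncomm_ring
  uU := h.Vv
  Uu := h.vV
  vV := h.Uu
  Vv := h.uU

theorem swap_inv (h : IsLocPair x y u U v V) : IsLocPair y (-(U * x)) V v U u where
  u_eq := by rw [mul_neg, h.Ux, h.yx_assoc, h.vV]; noncomm_ring
  v_eq := by rw [neg_mul, mul_assoc, h.xy, mul_sub, h.Uu]; noncomm_ring
  uU := h.Vv
  Uu := h.vV
  vV := h.Uu
  Vv := h.uU

theorem smul (h : IsLocPair x y u U v V) (β : kˣ) :
    IsLocPair ((β : k)⁻¹ • x) ((β : k) • y) u U v V := by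
  constructor <;> simp [h.uU, h.Uu, h.vV, h.Vv, smul_smul, h.xy, h.yx]

end IsLocPair

end PairTransformations

/-! ### Automorphisms and structures on the localised free algebra -/

section Automorphisms

variable {k : Type*} [Field k]

local notation "X" => F2S.x k
local notation "Y" => F2S.y k
local notation "Uᵤ" => ((F2S.u k : (F2S k)ˣ) : F2S k)
local notation "Uᵢ" => (((F2S.u k)⁻¹ : (F2S k)ˣ) : F2S k)
local notation "Vᵤ" => ((F2S.v k : (F2S k)ˣ) : F2S k)
local notation "Vᵢ" => (((F2S.v k)⁻¹ : (F2S k)ˣ) : F2S k)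

variable (k) in
theorem F2S.isLocPair : IsLocPair X Y Uᵤ Uᵢ Vᵤ Vᵢ where
  u_eq := F2S.u_val k
  v_eq := F2S.v_val k
  uU := Units.mul_inv _
  Uu := Units.inv_mul _
  vV := Units.mul_inv _
  Vv := Units.inv_mul _

theorem IsLocPair.exists_algHom {C : Type*} [Ring C] [Algebra k C] {a b p p' q q' : C}
    (h : IsLocPair a b p p' q q') : ∃ f : F2S k →ₐ[k] C, f X = a ∧ f Y = b ∧
      f Uᵤ = p ∧ f Uᵢ = p' ∧ f Vᵤ = q ∧ f Vᵢ = q' := by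
  obtain ⟨f, hx, hy⟩ := F2S.exists_algHom (k := k) a b
    (h.u_eq ▸ isUnit_iff_exists.mpr ⟨p', h.uU, h.Uu⟩)
    (h.v_eq ▸ isUnit_iff_exists.mpr ⟨q', h.vV, h.Vv⟩)
  have hf := (F2S.isLocPair k).map f
  have hu : f Uᵤ = p := by rw [hf.u_eq, h.u_eq, hx, hy]
  have hv : f Vᵤ = q := by rw [hf.v_eq, h.v_eq, hx, hy]
  rw [hx, hy, hu, hv] at hf
  exact ⟨f, hx, hy, hu, (hf.inv_unique h).1, hv, (hf.inv_unique h).2⟩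

variable (k)

theorem exists_mulRight : ∃ ψ : F2S k ≃ₐ[k] F2S k, ψ X = X * Uᵤ ∧ ψ Y = Uᵢ * Y ∧
    ψ Uᵤ = Uᵤ ∧ ψ Uᵢ = Uᵢ ∧ ψ Vᵤ = Uᵢ * Vᵤ * Uᵤ := by
  have h := F2S.isLocPair k
  obtain ⟨f, fx, fy, fu, fU, fv, -⟩ := h.mul_right.exists_algHom (k := k)
  obtain ⟨g, gx, gy, gu, gU, -, -⟩ := h.mul_right_inv.exists_algHom (k := k)
  refine ⟨AlgEquiv.ofAlgHom f g (F2S.algHom_ext ?_ ?_) (F2S.algHom_ext ?_ ?_), fx, fy, fu, fU, fv⟩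
  · simp [gx, fx, fU, mul_assoc]
  · simp [gy, fy, fu]
  · simp [gx, fx, gu, mul_assoc]
  · simp [gy, fy, gU]

/-- Auxiliary automorphism. It fixes `u` and `v`, hence both moment maps, whereas the map of
`exists_mulRight` conjugates `v`. -/
theorem exists_mulLeft : ∃ θ : F2S k ≃ₐ[k] F2S k, θ X = Uᵤ * X ∧ θ Y = Y * Uᵢ ∧
    θ Uᵤ = Uᵤ ∧ θ Uᵢ = Uᵢ ∧ θ Vᵤ = Vᵤ := by
  have h := F2S.isLocPair k
  obtain ⟨f, fx, fy, fu, fU, fv, -⟩ := h.mul_left.exists_algHom (k := k)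
  obtain ⟨g, gx, gy, gu, gU, -, -⟩ := h.mul_left_inv.exists_algHom (k := k)
  refine ⟨AlgEquiv.ofAlgHom f g (F2S.algHom_ext ?_ ?_) (F2S.algHom_ext ?_ ?_), fx, fy, fu, fU, fv⟩
  · simp [gx, fx, fU]
  · simp [gy, fy, fu, mul_assoc]
  · simp [gx, fx, gu]
  · simp [gy, fy, gU, mul_assoc]

theorem exists_swap : ∃ ξ : F2S k ≃ₐ[k] F2S k, ξ X = -(Vᵢ * Y) ∧ ξ Y = X ∧
    ξ Uᵤ = Vᵢ ∧ ξ Uᵢ = Vᵤ ∧ ξ Vᵤ = Uᵢ := by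
  have h := F2S.isLocPair k
  obtain ⟨f, fx, fy, fu, fU, fv, -⟩ := h.swap.exists_algHom (k := k)
  obtain ⟨g, gx, gy, -, -, -, gV⟩ := h.swap_inv.exists_algHom (k := k)
  refine ⟨AlgEquiv.ofAlgHom f g (F2S.algHom_ext ?_ ?_) (F2S.algHom_ext ?_ ?_), fx, fy, fu, fU, fv⟩
  · simp [gx, fy]
  · simp [gy, fx, fU]
  · simp [gy, fx, gV]
  · simp [gx, fy]

theorem exists_scale (β : kˣ) : ∃ φ : F2S k ≃ₐ[k] F2S k, φ X = (β : k)⁻¹ • X ∧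
    φ Y = (β : k) • Y ∧ φ Uᵤ = Uᵤ ∧ φ Uᵢ = Uᵢ ∧ φ Vᵤ = Vᵤ := by
  have h := F2S.isLocPair k
  obtain ⟨f, fx, fy, fu, fU, fv, -⟩ := (h.smul β).exists_algHom (k := k)
  obtain ⟨g, gx, gy, -⟩ := (h.smul β⁻¹).exists_algHom (k := k)
  refine ⟨AlgEquiv.ofAlgHom f g (F2S.algHom_ext ?_ ?_) (F2S.algHom_ext ?_ ?_), fx, fy, fu, fU, fv⟩
  · simp [gx, fx, smul_smul]
  · simp [gy, fy, smul_smul]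
  · simp [gx, fx, smul_smul]
  · simp [gy, fy, smul_smul]

variable {k}

theorem IsSignedBracket.isIso {H H' : QuasiHamiltonian k (F2S k)} {ε : k} {f : F2S k ≃ₐ[k] F2S k}
    (h : IsSignedBracket H.toDoubleBracket ε X Y)
    (h' : IsSignedBracket H'.toDoubleBracket ε (f X) (f Y)) (hm : f H.moment = H'.moment) :
    IsQuasiHamiltonianIso H H' f :=
  ⟨fun a b => h.br_map (f := (f : F2S k →ₐ[k] F2S k)) h' a b, hm⟩

variable [CharZero k]

theorem IsSignedBracket.isFirstStructure {H : QuasiHamiltonian k (F2S k)}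
    (h : IsSignedBracket H.toDoubleBracket 1 X Y) (hm : H.moment = Vᵤ * Uᵢ) :
    F2S.IsFirstStructure H := by
  refine ⟨?_, ?_, ?_, hm⟩
  · rw [h.xx, one_mul, pow_two]
  · rw [h.yy, one_mul, pow_two]
  · rw [h.yx]; module

theorem IsSignedBracket.isSecondStructure {H : QuasiHamiltonian k (F2S k)}
    (h : IsSignedBracket H.toDoubleBracket (-1) X Y) (hm : H.moment = Uᵢ * Vᵤ) :
    F2S.IsSecondStructure H := by
  refine ⟨?_, ?_, ?_, hm⟩
  · rw [h.xx, pow_two]; module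
  · rw [h.yy, pow_two]; module
  · rw [h.yx]; module

variable (k) in
theorem exists_firstStructure : ∃ H : QuasiHamiltonian k (F2S k),
    IsSignedBracket H.toDoubleBracket 1 X Y ∧ H.moment = Vᵤ * Uᵢ := by
  obtain ⟨P, hxx, hyy, hyx⟩ := exists_doubleBracket (k := k)
    (p := -((1 * 2⁻¹ : k) • ((X * X) ⊗ₜ[k] (1 : F2S k) - (1 : F2S k) ⊗ₜ[k] (X * X))))
    (q := (1 * 2⁻¹ : k) • ((Y * Y) ⊗ₜ[k] (1 : F2S k) - (1 : F2S k) ⊗ₜ[k] (Y * Y)))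
    ((1 : F2S k) ⊗ₜ[k] (1 : F2S k) + (2 : k)⁻¹ •
      ((X * Y) ⊗ₜ[k] (1 : F2S k) + (1 : F2S k) ⊗ₜ[k] (Y * X)) +
      (1 * 2⁻¹ : k) • (X ⊗ₜ[k] Y - Y ⊗ₜ[k] X))
    (by simp only [map_neg, map_smul, map_sub, TensorProduct.comm_tmul]; module)
    (by simp only [map_smul, map_sub, TensorProduct.comm_tmul]; module)
  have hP : IsSignedBracket P 1 X Y := ⟨hxx, hyy, hyx⟩
  have h := F2S.isLocPair k
  exact ⟨⟨P, isQuasiPoisson_of_generators P hP.triple_xxx hP.triple_yxx hP.triple_yyx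
    hP.triple_yyy, Vᵤ * Uᵢ, isMomentMap_of_generators P
      ((F2S.v k).isUnit.mul (F2S.u k)⁻¹.isUnit) (hP.moment_x h) (hP.moment_y h)⟩, hP, rfl⟩

variable (k) in
theorem exists_secondStructure : ∃ H : QuasiHamiltonian k (F2S k),
    IsSignedBracket H.toDoubleBracket (-1) X Y ∧ H.moment = Uᵢ * Vᵤ := by
  obtain ⟨H, hP, hm⟩ := exists_firstStructure k
  obtain ⟨ξ, hx, hy, -, hU, hv⟩ := exists_swap k
  -- By `IsSignedBracket.swap` the pair `(ξ X, ξ Y)` has sign `-1` for `H`, so transport along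
  -- `ξ.symm` gives sign `-1` on `(X, Y)` and spares a second verification of the axioms.
  refine ⟨H.transport ξ.symm, ?_, ?_⟩
  · have h1 := (hP.swap (F2S.isLocPair k)).map (ξ.symm : F2S k →ₐ[k] F2S k)
      (H.isIso_transport ξ.symm).1
    have h2 : (ξ.symm : F2S k →ₐ[k] F2S k) (-(Vᵢ * Y)) = X := by
      rw [← hx]; exact ξ.symm_apply_apply _
    have h3 : (ξ.symm : F2S k →ₐ[k] F2S k) X = Y := by
      nth_rewrite 1 [← hy]; exact ξ.symm_apply_apply _
    rwa [h2, h3] at h1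
  · change ξ.symm H.moment = _
    rw [hm, AlgEquiv.symm_apply_eq, map_mul, hU, hv]

variable {H₁ H₂ : QuasiHamiltonian k (F2S k)} {f : F2S k ≃ₐ[k] F2S k}

theorem isIso_mulLeft (h₁ : IsSignedBracket H₁.toDoubleBracket 1 X Y)
    (m₁ : H₁.moment = Vᵤ * Uᵢ) (hx : f X = Uᵤ * X) (hy : f Y = Y * Uᵢ) (hU : f Uᵢ = Uᵢ)
    (hv : f Vᵤ = Vᵤ) : IsQuasiHamiltonianIso H₁ H₁ f := by
  refine h₁.isIso ?_ (by rw [m₁, map_mul, hU, hv])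
  rw [hx, hy]
  exact h₁.mul_left (F2S.isLocPair k)

theorem isIso_mulRight (h₁ : IsSignedBracket H₁.toDoubleBracket 1 X Y)
    (m₁ : H₁.moment = Vᵤ * Uᵢ) (h₂ : IsSignedBracket H₂.toDoubleBracket (-1) X Y)
    (m₂ : H₂.moment = Uᵢ * Vᵤ) (hx : f X = X * Uᵤ) (hy : f Y = Uᵢ * Y) (hU : f Uᵢ = Uᵢ)
    (hv : f Vᵤ = Uᵢ * Vᵤ * Uᵤ) : IsQuasiHamiltonianIso H₁ H₂ f := by
  refine h₁.isIso ?_ (by rw [m₁, m₂, map_mul, hU, hv, Units.mul_inv_cancel_right])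
  rw [hx, hy]
  exact h₂.mul_right (F2S.isLocPair k)

theorem isIso_swap (h₁ : IsSignedBracket H₁.toDoubleBracket 1 X Y)
    (m₁ : H₁.moment = Vᵤ * Uᵢ) (h₂ : IsSignedBracket H₂.toDoubleBracket (-1) X Y)
    (m₂ : H₂.moment = Uᵢ * Vᵤ) (hx : f X = -(Vᵢ * Y)) (hy : f Y = X) (hU : f Uᵢ = Vᵤ)
    (hv : f Vᵤ = Uᵢ) : IsQuasiHamiltonianIso H₁ H₂ f := by
  refine h₁.isIso ?_ (by rw [m₁, m₂, map_mul, hU, hv])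
  rw [hx, hy]
  simpa using h₂.swap (F2S.isLocPair k)

theorem isIso_scale {H : QuasiHamiltonian k (F2S k)} {ε : k}
    (h : IsSignedBracket H.toDoubleBracket ε X Y) (hm : f H.moment = H.moment) {β : kˣ}
    (hx : f X = (β : k)⁻¹ • X) (hy : f Y = (β : k) • Y) : IsQuasiHamiltonianIso H H f := by
  refine h.isIso ?_ hm
  rw [hx, hy]
  exact h.smul β

end Automorphisms

end QuasiHam

end

/-! ### The algebra `B₁ᶜ` as a quotient of `F`, and descent of automorphisms. -/

noncomputable section

namespace QuasiHam

/-! ### The quotient map to the localised quantised Weyl algebra -/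

section Quotient

variable {k : Type*} [Field k] {c : k}

local notation "Uᵤ" => ((F2S.u k : (F2S k)ˣ) : F2S k)
local notation "Uᵢ" => (((F2S.u k)⁻¹ : (F2S k)ˣ) : F2S k)
local notation "Vᵤ" => ((F2S.v k : (F2S k)ˣ) : F2S k)
local notation "Vᵢ" => (((F2S.v k)⁻¹ : (F2S k)ˣ) : F2S k)

namespace B1

variable (c)

/-- The generator `x` of `B₁ᶜ`. -/
def x : B1 c := UnivLoc.of (weylSet c) (QWeyl.mk c (fx k))

/-- The generator `y` of `B₁ᶜ`. -/
def y : B1 c := UnivLoc.of (weylSet c) (QWeyl.mk c (fy k))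

/-- The unit `z = 1 + xy` of `B₁ᶜ`. -/
def z : (B1 c)ˣ := UnivLoc.unit (weylSet c) ⟨QWeyl.mk c (1 + fx k * fy k), rfl⟩

theorem z_val : (z c : B1 c) = 1 + x c * y c := by
  change UnivLoc.of (weylSet c) (QWeyl.mk c (1 + fx k * fy k)) = _
  simp [x, y]

theorem z_val' : (z c : B1 c) = c • (1 + y c * x c) := by
  change UnivLoc.of (weylSet c) (QWeyl.mk c (1 + fx k * fy k)) = _
  rw [QWeyl.mk_rel]
  simp [x, y]

theorem xy : x c * y c = z c - 1 := by rw [z_val]; abel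

theorem yx (hc : c ≠ 0) : y c * x c = c⁻¹ • (z c : B1 c) - 1 := by
  rw [z_val', smul_smul, inv_mul_cancel₀ hc, one_smul]; abel

theorem zy : (z c : B1 c) * y c = c • (y c * z c) := by
  nth_rewrite 1 [z_val']
  rw [z_val, smul_mul_assoc, add_mul, mul_add, one_mul, mul_one, mul_assoc]

theorem xz : x c * z c = c • (z c * x c : B1 c) := by
  nth_rewrite 1 [z_val']
  rw [z_val, mul_smul_comm, add_mul, mul_add, one_mul, mul_one, mul_assoc]

variable {c}

theorem algHom_ext {C : Type*} [Ring C] [Algebra k C] {f g : B1 c →ₐ[k] C}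
    (hx : f (x c) = g (x c)) (hy : f (y c) = g (y c)) : f = g := by
  refine UnivLoc.algHom_ext fun a => ?_
  have : (f.comp (UnivLoc.of (weylSet c))).comp (QWeyl.mk c) =
      (g.comp (UnivLoc.of (weylSet c))).comp (QWeyl.mk c) := by
    refine FreeAlgebra.hom_ext (funext fun i => ?_)
    fin_cases i
    · exact hx
    · exact hy
  obtain ⟨a, rfl⟩ := RingQuot.mkAlgHom_surjective k (QWeylRel c) a
  exact DFunLike.congr_fun this a

theorem exists_algHom {C : Type*} [Ring C] [Algebra k C] {a b : C} (hu : IsUnit (1 + a * b))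
    (hab : 1 + a * b = c • (1 + b * a)) : ∃ f : B1 c →ₐ[k] C, f (x c) = a ∧ f (y c) = b := by
  let g : FreeAlgebra k (Fin 2) →ₐ[k] C := FreeAlgebra.lift k ![a, b]
  have ga : g (fx k) = a := by simp [g, fx]
  have gb : g (fy k) = b := by simp [g, fy]
  let g' : QWeyl c →ₐ[k] C := RingQuot.liftAlgHom k (s := QWeylRel c) ⟨g, by
    rintro _ _ ⟨⟩
    simpa [ga, gb] using hab⟩
  have hg' : ∀ p, g' (QWeyl.mk c p) = g p := fun p =>
    RingQuot.liftAlgHom_mkAlgHom_apply k g _ p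
  refine ⟨UnivLoc.lift g' ?_, ?_, ?_⟩
  · rintro ⟨_, rfl⟩
    simpa [hg', ga, gb] using hu
  · rw [x, UnivLoc.lift_of, hg', ga]
  · rw [y, UnivLoc.lift_of, hg', gb]

/-- The universal property gives a map `B1 c → S`; followed by the inclusion it fixes `x` and `y`,
so it is the identity. -/
theorem eq_top_of_mem (S : Subalgebra k (B1 c)) (hx : x c ∈ S) (hy : y c ∈ S)
    (hz : (((z c)⁻¹ : (B1 c)ˣ) : B1 c) ∈ S) : S = ⊤ := by
  have hu : (1 + (⟨x c, hx⟩ : S) * ⟨y c, hy⟩ : S).1 = z c := (z_val c).symm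
  obtain ⟨f, fx, fy⟩ := exists_algHom (c := c) (C := S) (a := ⟨x c, hx⟩) (b := ⟨y c, hy⟩)
    (isUnit_iff_exists.mpr ⟨⟨_, hz⟩, Subtype.ext (by simp only [MulMemClass.coe_mul, hu]; simp),
      Subtype.ext (by simp only [MulMemClass.coe_mul, hu]; simp)⟩)
    (Subtype.ext ((z_val c).symm.trans (z_val' c)))
  have h : S.val.comp f = AlgHom.id k (B1 c) := algHom_ext (by simp [fx]) (by simp [fy])
  refine eq_top_iff.mpr fun b _ => ?_
  have hb : (f b).1 = b := DFunLike.congr_fun h b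
  exact hb ▸ (f b).2

end B1

variable (hc : c ≠ 0)

theorem toB1_x : toB1 hc (F2S.x k) = B1.x c := UnivLoc.lift_of _ _ _

theorem toB1_y : toB1 hc (F2S.y k) = B1.y c := UnivLoc.lift_of _ _ _

theorem toB1_u : toB1 hc Uᵤ = B1.z c := by
  rw [F2S.u_val, B1.z_val, map_add, map_mul, toB1_x, toB1_y, map_one]

theorem toB1_v : toB1 hc Vᵤ = c⁻¹ • (B1.z c : B1 c) := by
  rw [F2S.v_val, map_add, map_mul, toB1_x, toB1_y, map_one, B1.yx c hc]; abel

theorem toB1_u_inv : toB1 hc Uᵢ = ((B1.z c)⁻¹ : (B1 c)ˣ) := by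
  have h : Units.map (toB1 hc : F2S k →* B1 c) (F2S.u k) = B1.z c := Units.ext (toB1_u hc)
  exact congrArg (fun w : (B1 c)ˣ => ((w⁻¹ : (B1 c)ˣ) : B1 c)) h

theorem toB1_surjective : Function.Surjective (toB1 hc) := by
  rw [← AlgHom.range_eq_top]
  exact B1.eq_top_of_mem _ ⟨_, toB1_x hc⟩ ⟨_, toB1_y hc⟩ ⟨_, toB1_u_inv hc⟩

theorem exists_factor {C : Type*} [Ring C] [Algebra k C] (g : F2S k →ₐ[k] C)
    (h : g Uᵤ = c • g Vᵤ) : ∃ f : B1 c →ₐ[k] C, ∀ p, f (toB1 hc p) = g p := by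
  have hu := (F2S.u k).isUnit.map g
  rw [F2S.u_val, F2S.v_val] at h
  rw [F2S.u_val] at hu
  simp only [map_add, map_mul, map_one] at h hu
  obtain ⟨f, fx, fy⟩ := B1.exists_algHom hu h
  refine ⟨f, DFunLike.congr_fun (f := f.comp (toB1 hc)) (F2S.algHom_ext ?_ ?_)⟩
  · rw [AlgHom.comp_apply, toB1_x, fx]
  · rw [AlgHom.comp_apply, toB1_y, fy]

/-- Either of the two moment maps. -/
def IsMoment (Φ : F2S k) : Prop := Φ = Vᵤ * Uᵢ ∨ Φ = Uᵢ * Vᵤ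

variable {hc} {Φ : F2S k}

theorem IsMoment.toB1_eq (h : IsMoment Φ) : toB1 hc Φ = algebraMap k (B1 c) c⁻¹ := by
  rcases h with rfl | rfl <;>
  simp [toB1_v, toB1_u_inv, Algebra.algebraMap_eq_smul_one]

/-- The value is a central scalar, so the order of the two factors of `Φ` is irrelevant. -/
theorem IsMoment.eq_smul (h : IsMoment Φ) (hc : c ≠ 0) {C : Type*} [Ring C] [Algebra k C]
    {g : F2S k →ₐ[k] C} (hg : g Φ = algebraMap k C c⁻¹) : g Uᵤ = c • g Vᵤ := by
  rw [Algebra.algebraMap_eq_smul_one] at hg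
  have h1 : g Vᵤ = c⁻¹ • g Uᵤ := by
    rcases h with rfl | rfl
    · calc g Vᵤ = g (Vᵤ * Uᵢ) * g Uᵤ := by rw [← map_mul, Units.inv_mul_cancel_right]
        _ = c⁻¹ • g Uᵤ := by rw [hg, smul_mul_assoc, one_mul]
    · calc g Vᵤ = g Uᵤ * g (Uᵢ * Vᵤ) := by rw [← map_mul, Units.mul_inv_cancel_left]
        _ = c⁻¹ • g Uᵤ := by rw [hg, mul_smul_comm, mul_one]
  rw [h1, smul_smul, mul_inv_cancel₀ hc, one_smul]

theorem ker_toB1 (h : IsMoment Φ) : TwoSidedIdeal.ker (toB1 hc) =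
    TwoSidedIdeal.span {Φ - algebraMap k (F2S k) c⁻¹} := by
  apply le_antisymm
  · intro p hp
    rw [TwoSidedIdeal.mem_ker] at hp
    set I := TwoSidedIdeal.span {Φ - algebraMap k (F2S k) c⁻¹}
    have hq : ∀ a b : F2S k, I.ringCon.mkₐ (α := k) a = I.ringCon.mkₐ (α := k) b ↔ a - b ∈ I :=
      fun a b => (RingCon.eq _).trans (I.rel_iff a b)
    -- In the quotient by `I` the relation of `B₁ᶜ` holds, so the quotient map factors through `toB1
    -- hc` and kills its kernel.
    obtain ⟨f, hf⟩ := exists_factor hc (I.ringCon.mkₐ (α := k)) (h.eq_smul hc (by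
      rw [← AlgHom.commutes (I.ringCon.mkₐ (α := k)), hq]
      exact TwoSidedIdeal.subset_span rfl))
    have h0 := hf p
    rw [hp, map_zero, ← map_zero (I.ringCon.mkₐ (α := k)), eq_comm, hq, sub_zero] at h0
    exact h0
  · rw [TwoSidedIdeal.span_le, Set.singleton_subset_iff, SetLike.mem_coe, TwoSidedIdeal.mem_ker,
      map_sub, h.toB1_eq, AlgHom.commutes, sub_self]

theorem exists_induces {f : F2S k ≃ₐ[k] F2S k} (hc : c ≠ 0) (h : IsMoment Φ)
    (h' : IsMoment (f Φ)) : ∃ σ : B1 c ≃ₐ[k] B1 c, Induces hc f σ := by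
  obtain ⟨s, hs⟩ := exists_factor hc ((toB1 hc).comp (f : F2S k →ₐ[k] F2S k))
    (h.eq_smul hc h'.toB1_eq)
  obtain ⟨t, ht⟩ := exists_factor hc ((toB1 hc).comp (f.symm : F2S k →ₐ[k] F2S k))
    (h'.eq_smul hc (by simpa using h.toB1_eq))
  have hst : ∀ b, s (t b) = b := fun b => by
    obtain ⟨p, rfl⟩ := toB1_surjective hc b
    rw [ht]
    exact (hs _).trans (by simp)
  have hts : ∀ b, t (s b) = b := fun b => by
    obtain ⟨p, rfl⟩ := toB1_surjective hc b
    rw [hs]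
    exact (ht _).trans (by simp)
  exact ⟨AlgEquiv.ofAlgHom s t (AlgHom.ext hst) (AlgHom.ext hts), hs⟩

variable (hc) in
/-- The group of pairs consisting of an automorphism of `k⟨x, y⟩_S` and an automorphism of `B₁ᶜ`
induced by it. -/
def inducesSubgroup : Subgroup ((F2S k ≃ₐ[k] F2S k) × (B1 c ≃ₐ[k] B1 c)) where
  carrier := {p | Induces hc p.1 p.2}
  one_mem' := fun p => rfl
  mul_mem' {a b} ha hb p := by
    change a.2 (b.2 _) = toB1 hc (a.1 (b.1 p))
    rw [← ha, ← hb]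
  inv_mem' {a} ha p := by
    change a.2.symm _ = toB1 hc (a.1.symm p)
    rw [AlgEquiv.symm_apply_eq, ha, AlgEquiv.apply_symm_apply]

end Quotient

/-! ### Automorphism groups -/

section AutomorphismGroup

variable {k A : Type*} [Field k] [Ring A] [Algebra k A]

/-- The group of automorphisms of a quasi-Hamiltonian algebra. -/
def QuasiHamiltonian.autSubgroup (H : QuasiHamiltonian k A) : Subgroup (A ≃ₐ[k] A) where
  carrier := {f | IsQuasiHamiltonianIso H H f}
  one_mem' := isQuasiHamiltonianIso_refl H
  mul_mem' {_ _} ha hb := hb.trans ha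
  inv_mem' {_} ha := ha.symm

end AutomorphismGroup

end QuasiHam

end

/-! ### Laurent polynomials, their evaluations and twists. -/

noncomputable section

namespace QuasiHam

/-! ### Laurent polynomials -/

section Laurent

open LaurentPolynomial

variable {k : Type*} [Field k]

/-- The highest terms multiply to a nonzero term and so do the lowest. Both products sit in degree
`n`, so each factor has equal highest and lowest degree. Nonvanishing is assumed only for the
coefficients that occur, because `R` will be an endomorphism ring with zero divisors. -/
theorem single_of_mul_eq_single {R : Type*} [Ring R] {p q : R[T;T⁻¹]} {n : ℤ} {r : R}
    (hpq : ∀ i j, p.coeff i ≠ 0 → q.coeff j ≠ 0 → p.coeff i * q.coeff j ≠ 0)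
    (h : p * q = .single n r) (hr : r ≠ 0) :
    ∃ i j, i + j = n ∧ p = .single i (p.coeff i) ∧ q = .single j (q.coeff j) := by
  have hne : p * q ≠ 0 := by rw [h]; exact AddMonoidAlgebra.single_ne_zero.mpr hr
  have hp : p.coeff.support.Nonempty := by
    rw [Finsupp.support_nonempty_iff]
    intro h0
    exact hne (by rw [AddMonoidAlgebra.coeff_eq_zero.mp h0, zero_mul])
  have hq : q.coeff.support.Nonempty := by
    rw [Finsupp.support_nonempty_iff]
    intro h0
    exact hne (by rw [AddMonoidAlgebra.coeff_eq_zero.mp h0, mul_zero])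
  have key : ∀ a ∈ p.coeff.support, ∀ b ∈ q.coeff.support,
      UniqueAdd p.coeff.support q.coeff.support a b → a + b = n := by
    intro a ha b hb hab
    have h1 := AddMonoidAlgebra.coeff_mul_add_of_uniqueAdd hab
    by_contra hn
    rw [h, AddMonoidAlgebra.coeff_single, Finsupp.single_apply, if_neg (Ne.symm hn)] at h1
    exact hpq a b (Finsupp.mem_support_iff.mp ha) (Finsupp.mem_support_iff.mp hb) h1.symm
  have hmax := key _ (Finset.max'_mem _ hp) _ (Finset.max'_mem _ hq) fun a b ha hb hab => by
    have := Finset.le_max' _ a ha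
    have := Finset.le_max' _ b hb
    omega
  have hmin := key _ (Finset.min'_mem _ hp) _ (Finset.min'_mem _ hq) fun a b ha hb hab => by
    have := Finset.min'_le _ a ha
    have := Finset.min'_le _ b hb
    omega
  have hp' := Finset.min'_le _ _ (Finset.max'_mem _ hp)
  have hq' := Finset.min'_le _ _ (Finset.max'_mem _ hq)
  refine ⟨_, _, hmax, ?_, ?_⟩
  · ext i
    rw [AddMonoidAlgebra.coeff_single, Finsupp.single_apply]
    split_ifs with hi
    · rw [hi]
    · by_contra hi'
      have hm := Finsupp.mem_support_iff.mpr hi'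
      have := Finset.le_max' _ i hm
      have := Finset.min'_le _ i hm
      omega
  · ext i
    rw [AddMonoidAlgebra.coeff_single, Finsupp.single_apply]
    split_ifs with hi
    · rw [hi]
    · by_contra hi'
      have hm := Finsupp.mem_support_iff.mpr hi'
      have := Finset.le_max' _ i hm
      have := Finset.min'_le _ i hm
      omega

theorem eq_single_of_mul_eq_one {f g : k[T;T⁻¹]} (h : f * g = 1) :
    ∃ (n : ℤ) (r : kˣ), f = .single n (r : k) := by
  obtain ⟨i, j, hij, hf, -⟩ := single_of_mul_eq_single (n := 0) (r := (1 : k))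
    (fun i j => mul_ne_zero) h one_ne_zero
  refine ⟨i, Units.mk0 (f.coeff i) fun h0 => ?_, hf⟩
  rw [hf, h0] at h
  simp at h

variable {A B : Type*} [Ring A] [Algebra k A] [Ring B] [Algebra k B]

/-- Evaluation of Laurent polynomials at a unit. -/
def laurentEval (w : Aˣ) : k[T;T⁻¹] →ₐ[k] A :=
  AddMonoidAlgebra.lift k A ℤ ((Units.coeHom A).comp (zpowersHom Aˣ w))

theorem laurentEval_single (w : Aˣ) (n : ℤ) (r : k) :
    laurentEval w (.single n r) = r • ((w ^ n : Aˣ) : A) := by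
  rw [laurentEval, AddMonoidAlgebra.lift_single]
  simp

theorem map_laurentEval (g : A →ₐ[k] B) (w : Aˣ) (f : k[T;T⁻¹]) :
    g (laurentEval w f) = laurentEval (Units.map (g : A →* B) w) f := by
  induction f using AddMonoidAlgebra.induction_linear with
  | zero => simp
  | add f f' hf hf' => simp only [map_add, hf, hf']
  | single n r =>
    rw [laurentEval_single, laurentEval_single, map_smul, ← map_zpow]
    rfl

/-- A scalar as a unit of an algebra. -/
def scalarUnit (A : Type*) [Ring A] [Algebra k A] (d : kˣ) : Aˣ :=
  Units.map (algebraMap k A : k →* A) d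

theorem commute_scalarUnit (d : kˣ) (w : Aˣ) : Commute (scalarUnit A d) w :=
  Units.ext (Algebra.commutes _ _)

theorem scalarUnit_mul (d e : kˣ) : scalarUnit A (d * e) = scalarUnit A d * scalarUnit A e :=
  map_mul _ _ _

theorem scalarUnit_zpow (d : kˣ) (n : ℤ) : scalarUnit A (d ^ n) = scalarUnit A d ^ n :=
  map_zpow (Units.map (algebraMap k A : k →* A)) d n

/-- The variable as a unit. -/
def unitT : k[T;T⁻¹]ˣ where
  val := .single 1 1
  inv := .single (-1) 1
  val_inv := by rw [AddMonoidAlgebra.single_mul_single, one_mul]; rfl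
  inv_val := by rw [AddMonoidAlgebra.single_mul_single, one_mul]; rfl

theorem laurentEval_unitT (w : Aˣ) : laurentEval (k := k) w (unitT : k[T;T⁻¹]ˣ) = w := by
  rw [unitT, laurentEval_single, one_smul, zpow_one]

theorem laurentEval_unitT_id (f : k[T;T⁻¹]) : laurentEval unitT f = f := by
  have hT : ∀ n : ℤ, ((unitT ^ n : k[T;T⁻¹]ˣ) : k[T;T⁻¹]) = .single n 1 := by
    intro n
    let F : Multiplicative ℤ →* k[T;T⁻¹]ˣ :=
      (AddMonoidAlgebra.of k ℤ).toHomUnits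
    have h := DFunLike.congr_fun (f := zpowersHom _ unitT) (g := F)
      (MonoidHom.ext_mint (Units.ext (by simp [F, unitT]))) (Multiplicative.ofAdd n)
    have h' := congrArg Units.val h
    simpa [F] using h'
  induction f using AddMonoidAlgebra.induction_linear with
  | zero => simp
  | add f g hf hg => rw [map_add, hf, hg]
  | single n r => rw [laurentEval_single, hT, AddMonoidAlgebra.smul_single', mul_one]

/-- The automorphism `T ↦ d T` of Laurent polynomials. -/
def twist (d : kˣ) : k[T;T⁻¹] →ₐ[k] k[T;T⁻¹] := laurentEval (scalarUnit _ d * unitT)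

theorem laurentEval_twist (w : Aˣ) (d : kˣ) (f : k[T;T⁻¹]) :
    laurentEval w (twist d f) = laurentEval (scalarUnit A d * w) f := by
  rw [twist, map_laurentEval, map_mul]
  congr 2
  congr 1
  · exact Units.ext (AlgHom.commutes (laurentEval w) (d : k))
  · exact Units.ext (laurentEval_unitT w)

theorem twist_twist (d e : kˣ) (f : k[T;T⁻¹]) : twist d (twist e f) = twist (d * e) f := by
  rw [twist, laurentEval_twist, twist, ← mul_assoc, ← scalarUnit_mul, mul_comm e d]

theorem twist_one (f : k[T;T⁻¹]) : twist 1 f = f := by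
  rw [twist, scalarUnit, map_one, one_mul, laurentEval_unitT_id]

theorem twist_injective (d : kˣ) : Function.Injective (twist d) :=
  Function.LeftInverse.injective (g := twist d⁻¹) fun f => by
    rw [twist_twist, inv_mul_cancel, twist_one]

/-- Moving `a` past `w` rescales `w` by `d`, hence moving it past `f(w)` gives `f(d w)`. -/
theorem mul_laurentEval {w : Aˣ} {a : A} {d : kˣ} (h : a * w = (d : k) • (w * a))
    (f : k[T;T⁻¹]) : a * laurentEval w f = laurentEval w (twist d f) * a := by
  have h1 : SemiconjBy a (w : A) ((scalarUnit A d * w : Aˣ) : A) := by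
    rw [SemiconjBy, h, Units.val_mul, mul_assoc, Algebra.smul_def]
    rfl
  rw [laurentEval_twist]
  induction f using AddMonoidAlgebra.induction_linear with
  | zero => simp
  | add f g hf hg => rw [map_add, map_add, mul_add, add_mul, hf, hg]
  | single n r =>
    rw [laurentEval_single, laurentEval_single, mul_smul_comm, smul_mul_assoc,
      (h1.units_zpow_right n).eq]

end Laurent

end QuasiHam

end

/-! ### A skew Laurent representation of `B₁ᶜ` and its normal forms. -/

noncomputable section

namespace QuasiHam

/-! ### A skew Laurent polynomial model and normal forms -/

section Model

open LaurentPolynomial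

variable {k : Type*} [Field k]

/-- The variable of the Laurent polynomials over `k`. -/
abbrev varT (k : Type*) [Field k] : k[T;T⁻¹] := (unitT : k[T;T⁻¹]ˣ)

theorem twist_unitT (d : kˣ) : twist d (varT k) = (d : k) • varT k := by
  rw [twist, laurentEval_unitT, Units.val_mul, Algebra.smul_def]
  rfl

variable (k) in
/-- The twists as units of the algebra of operators on Laurent polynomials. -/
def twistUnit : kˣ →* (Module.End k k[T;T⁻¹])ˣ where
  toFun d :=
    { val := (twist d).toLinearMap
      inv := (twist d⁻¹).toLinearMap
      val_inv := LinearMap.ext fun f => by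
        change twist d (twist d⁻¹ f) = f
        rw [twist_twist, mul_inv_cancel, twist_one]
      inv_val := LinearMap.ext fun f => by
        change twist d⁻¹ (twist d f) = f
        rw [twist_twist, inv_mul_cancel, twist_one] }
  map_one' := Units.ext (LinearMap.ext fun f => twist_one f)
  map_mul' d e := Units.ext (LinearMap.ext fun f => (twist_twist d e f).symm)

/-- The operator `f · twist d`. -/
def twistOp (f : k[T;T⁻¹]) (d : kˣ) : Module.End k k[T;T⁻¹] :=
  Algebra.lmul k _ f * twistUnit k d

theorem twistOp_apply (f g : k[T;T⁻¹]) (d : kˣ) : twistOp f d g = f * twist d g := rfl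

theorem twistOp_mul (f g : k[T;T⁻¹]) (d e : kˣ) :
    twistOp f d * twistOp g e = twistOp (f * twist d g) (d * e) := by
  refine LinearMap.ext fun h => ?_
  change f * twist d (g * twist e h) = f * twist d g * twist (d * e) h
  rw [map_mul, twist_twist, mul_assoc]

theorem twistOp_add (f g : k[T;T⁻¹]) (d : kˣ) :
    twistOp (f + g) d = twistOp f d + twistOp g d := by
  rw [twistOp, map_add, add_mul]; rfl

theorem twistOp_eq_zero {f : k[T;T⁻¹]} {d : kˣ} (h : twistOp f d = 0) : f = 0 := by
  have h1 := twistOp_apply f 1 d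
  rw [h, map_one (twist d), mul_one] at h1
  exact h1.symm

theorem twistOp_zero (d : kˣ) : twistOp (0 : k[T;T⁻¹]) d = 0 := by
  rw [twistOp, map_zero, zero_mul]

variable (k) in
/-- A ring which contains the skew Laurent ring over `k[T;T⁻¹]`. -/
def SkewRing : Type _ := (Module.End k k[T;T⁻¹])[T;T⁻¹]

instance : Ring (SkewRing k) := inferInstanceAs (Ring (Module.End k k[T;T⁻¹])[T;T⁻¹])

instance : Algebra k (SkewRing k) := inferInstanceAs (Algebra k (Module.End k k[T;T⁻¹])[T;T⁻¹])

variable (q : kˣ)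

/-- The element `f tⁱ` of the skew Laurent ring. -/
def skewMono (f : k[T;T⁻¹]) (i : ℤ) : SkewRing k :=
  (AddMonoidAlgebra.single i (twistOp f (q ^ i)) : (Module.End k k[T;T⁻¹])[T;T⁻¹])

/-- The twisting is done by the operator coefficients; the outer variable commutes with them and
only records the degree. It keeps different powers of `t` independent even if `q` is a root of
unity. -/
theorem skewMono_mul (f g : k[T;T⁻¹]) (i j : ℤ) :
    skewMono q f i * skewMono q g j = skewMono q (f * twist (q ^ i) g) (i + j) := by
  refine (AddMonoidAlgebra.single_mul_single _ _ _ _).trans ?_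
  rw [twistOp_mul, ← zpow_add]
  rfl

theorem skewMono_add (f g : k[T;T⁻¹]) (i : ℤ) :
    skewMono q (f + g) i = skewMono q f i + skewMono q g i := by
  rw [skewMono, twistOp_add, AddMonoidAlgebra.single_add]; rfl

/-- The inclusion of the Laurent polynomials into the skew Laurent ring. -/
def skewC : k[T;T⁻¹] →ₐ[k] SkewRing k :=
  (AddMonoidAlgebra.singleZeroAlgHom (R := k) (A := Module.End k k[T;T⁻¹]) (M := ℤ)).comp
    (Algebra.lmul k _)

theorem skewC_apply (f : k[T;T⁻¹]) : skewC f = skewMono q f 0 := by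
  rw [skewMono, zpow_zero, twistOp, map_one, Units.val_one, mul_one]
  rfl

end Model

namespace B1

open LaurentPolynomial

variable {k : Type*} [Field k] (q : kˣ)

/-- The inclusion of the Laurent polynomials in `z`. -/
def incl : k[T;T⁻¹] →ₐ[k] B1 (q : k) := laurentEval (z (q : k))

/-- `xⁱ` for `i ≥ 0` and `y⁻ⁱ` for `i ≤ 0`. -/
def mono (i : ℤ) : B1 (q : k) := x (q : k) ^ i.toNat * y (q : k) ^ (-i).toNat

theorem mono_natCast (n : ℕ) : mono q n = x (q : k) ^ n := by
  simp [mono]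

theorem mono_neg_natCast (n : ℕ) : mono q (-n) = y (q : k) ^ n := by
  simp [mono]

theorem incl_unitT : incl q (varT k) = z (q : k) := laurentEval_unitT _

theorem x_mul_incl (f : k[T;T⁻¹]) : x (q : k) * incl q f = incl q (twist q f) * x (q : k) :=
  mul_laurentEval (xz _) f

theorem y_mul_incl (f : k[T;T⁻¹]) : y (q : k) * incl q f = incl q (twist q⁻¹ f) * y (q : k) :=
  mul_laurentEval (by rw [zy, smul_smul, Units.inv_mul, one_smul]) f

theorem x_mul_y : x (q : k) * y (q : k) = incl q (varT k - 1) := by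
  rw [xy, map_sub, incl_unitT, map_one]

theorem y_mul_x : y (q : k) * x (q : k) = incl q (twist q⁻¹ (varT k - 1)) := by
  rw [yx _ q.ne_zero, map_sub, twist_unitT, map_sub, map_smul, incl_unitT, map_one, map_one,
    Units.val_inv_eq_inv_val]

theorem pow_mul_incl {a : B1 (q : k)} {d : kˣ}
    (h : ∀ f, a * incl q f = incl q (twist d f) * a) (n : ℕ) (f : k[T;T⁻¹]) :
    a ^ n * incl q f = incl q (twist (d ^ n) f) * a ^ n := by
  induction n with
  | zero => simp [twist_one]
  | succ n ih =>
    rw [pow_succ', mul_assoc, ih, ← mul_assoc, h, twist_twist, mul_assoc, ← pow_succ' d]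

theorem mono_mul_incl (i : ℤ) (f : k[T;T⁻¹]) :
    mono q i * incl q f = incl q (twist (q ^ i) f) * mono q i := by
  obtain ⟨n, rfl | rfl⟩ := i.eq_nat_or_neg
  · rw [mono_natCast, pow_mul_incl q (x_mul_incl q), zpow_natCast]
  · rw [mono_neg_natCast, pow_mul_incl q (y_mul_incl q), zpow_neg, zpow_natCast, inv_pow]

theorem exists_x_mul_mono (i : ℤ) : ∃ a, x (q : k) * mono q i = incl q a * mono q (i + 1) := by
  obtain ⟨n, rfl | rfl⟩ := i.eq_nat_or_neg
  · refine ⟨1, ?_⟩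
    rw [← Nat.cast_succ, mono_natCast, mono_natCast, map_one, one_mul, pow_succ']
  · rcases n with _ | n
    · refine ⟨1, ?_⟩
      have h1 : (-((0 : ℕ) : ℤ) + 1) = ((1 : ℕ) : ℤ) := by simp
      rw [h1, mono_natCast, mono_neg_natCast, map_one, one_mul, pow_zero, mul_one, pow_one]
    · refine ⟨varT k - 1, ?_⟩
      have h1 : (-((n + 1 : ℕ) : ℤ) + 1) = -(n : ℤ) := by push_cast; ring
      rw [h1, mono_neg_natCast, mono_neg_natCast, pow_succ', ← mul_assoc, x_mul_y]

theorem exists_y_mul_mono (i : ℤ) : ∃ a, y (q : k) * mono q i = incl q a * mono q (i - 1) := by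
  obtain ⟨n, rfl | rfl⟩ := i.eq_nat_or_neg
  · rcases n with _ | n
    · refine ⟨1, ?_⟩
      have h1 : (((0 : ℕ) : ℤ) - 1) = -((1 : ℕ) : ℤ) := by simp
      rw [h1, mono_natCast, mono_neg_natCast, map_one, one_mul, pow_zero, mul_one, pow_one]
    · refine ⟨twist q⁻¹ (varT k - 1), ?_⟩
      have h1 : (((n + 1 : ℕ) : ℤ) - 1) = (n : ℤ) := by push_cast; ring
      rw [h1, mono_natCast, mono_natCast, pow_succ', ← mul_assoc, y_mul_x]
  · refine ⟨1, ?_⟩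
    have h1 : (-(n : ℤ) - 1) = -((n + 1 : ℕ) : ℤ) := by push_cast; ring
    rw [h1, mono_neg_natCast, mono_neg_natCast, map_one, one_mul, pow_succ']

/-- The map `∑ fᵢ ↦ ∑ fᵢ(z) mono i`. -/
def normalForm : (ℤ →₀ k[T;T⁻¹]) →ₗ[k] B1 (q : k) :=
  Finsupp.lsum k fun i => LinearMap.mulRight k (mono q i) ∘ₗ (incl q).toLinearMap

theorem normalForm_single (i : ℤ) (f : k[T;T⁻¹]) :
    normalForm q (Finsupp.single i f) = incl q f * mono q i := by
  simp [normalForm]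

/-- The elements whose left multiplication preserves the range form a subalgebra. It contains `x`,
`y` and `z⁻¹`, so it is everything, and it is applied to `1`. -/
theorem normalForm_surjective : Function.Surjective (normalForm q) := by
  let S : Subalgebra k (B1 (q : k)) :=
    { carrier := {b | ∀ m ∈ LinearMap.range (normalForm q), b * m ∈ LinearMap.range (normalForm q)}
      mul_mem' := fun {a b} ha hb m hm => by rw [mul_assoc]; exact ha _ (hb _ hm)
      add_mem' := fun {a b} ha hb m hm => by rw [add_mul]; exact add_mem (ha _ hm) (hb _ hm)
      algebraMap_mem' := fun r m hm => by
        rw [← Algebra.smul_def]; exact Submodule.smul_mem _ r hm }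
  have hS : ∀ b, (∀ f i, ∃ g j, b * (incl q f * mono q i) = incl q g * mono q j) → b ∈ S := by
    rintro b hb _ ⟨F, rfl⟩
    induction F using Finsupp.induction_linear with
    | zero => rw [map_zero, mul_zero]; exact zero_mem _
    | add F G hF hG => rw [map_add, mul_add]; exact add_mem hF hG
    | single i f =>
      obtain ⟨g, j, h⟩ := hb f i
      exact ⟨Finsupp.single j g, by rw [normalForm_single, normalForm_single, h]⟩
  have htop : S = ⊤ := by
    refine eq_top_of_mem S (hS _ fun f i => ?_) (hS _ fun f i => ?_) (hS _ fun f i => ?_)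
    · obtain ⟨a, ha⟩ := exists_x_mul_mono q i
      exact ⟨twist q f * a, i + 1, by
        rw [← mul_assoc, x_mul_incl, mul_assoc, ha, map_mul, mul_assoc]⟩
    · obtain ⟨a, ha⟩ := exists_y_mul_mono q i
      exact ⟨twist q⁻¹ f * a, i - 1, by
        rw [← mul_assoc, y_mul_incl, mul_assoc, ha, map_mul, mul_assoc]⟩
    · refine ⟨(unitT⁻¹ : k[T;T⁻¹]ˣ) * f, i, ?_⟩
      have h : incl q ((unitT⁻¹ : k[T;T⁻¹]ˣ) : k[T;T⁻¹]) = ((z (q : k))⁻¹ : (B1 (q : k))ˣ) := by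
        have h1 : Units.map (incl q : k[T;T⁻¹] →* B1 (q : k)) unitT = z (q : k) :=
          Units.ext (incl_unitT q)
        exact congrArg (fun w : (B1 (q : k))ˣ => ((w⁻¹ : (B1 (q : k))ˣ) : B1 (q : k))) h1
      rw [map_mul, h, mul_assoc]
  intro b
  have h1 : (1 : B1 (q : k)) ∈ LinearMap.range (normalForm q) :=
    ⟨Finsupp.single 0 1, by rw [normalForm_single, mono]; simp⟩
  have hb : b ∈ S := htop ▸ Algebra.mem_top
  simpa using hb 1 h1

/-- The image of `y` is `t⁻¹ (T - 1)` with the coefficient moved to the left, chosen so that `x y`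
goes to `T - 1`, that is, `z` to `T`. -/
theorem exists_skewHom : ∃ ρ : B1 (q : k) →ₐ[k] SkewRing k,
    ρ (x (q : k)) = skewMono q 1 1 ∧ ρ (y (q : k)) = skewMono q (twist q⁻¹ (varT k - 1)) (-1) := by
  have hxy : skewMono q 1 1 * skewMono q (twist q⁻¹ (varT k - 1)) (-1) =
      skewC (varT k) - 1 := by
    rw [skewMono_mul, zpow_one, twist_twist, mul_inv_cancel, twist_one, one_mul,
      ← map_one (skewC (k := k)), ← map_sub, skewC_apply q]
    rfl
  have hyx : skewMono q (twist q⁻¹ (varT k - 1)) (-1) * skewMono q 1 1 =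
      (q : k)⁻¹ • skewC (varT k) - 1 := by
    rw [skewMono_mul, map_one, mul_one, map_sub, map_one, twist_unitT,
      ← map_one (skewC (k := k)), ← map_smul, ← map_sub, skewC_apply q, Units.val_inv_eq_inv_val]
    rfl
  refine exists_algHom (c := (q : k)) (C := SkewRing k) ?_ ?_
  · rw [hxy, add_sub_cancel]
    exact (Units.isUnit _).map _
  · rw [hxy, hyx, add_sub_cancel, add_sub_cancel, smul_smul, mul_inv_cancel₀ q.ne_zero, one_smul]

theorem map_incl {ρ : B1 (q : k) →ₐ[k] SkewRing k}
    (hx : ρ (x (q : k)) = skewMono q 1 1)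
    (hy : ρ (y (q : k)) = skewMono q (twist q⁻¹ (varT k - 1)) (-1)) (f : k[T;T⁻¹]) :
    ρ (incl q f) = skewMono q f 0 := by
  have h : Units.map (ρ : B1 (q : k) →* _) (z (q : k)) =
      Units.map ((skewC : k[T;T⁻¹] →ₐ[k] _) : k[T;T⁻¹] →* SkewRing k) unitT := Units.ext ?_
  · rw [incl, map_laurentEval ρ, h, ← skewC_apply, ← map_laurentEval skewC, laurentEval_unitT_id]
  change ρ (z (q : k)) = skewC (varT k)
  rw [z_val, map_add, map_mul, hx, hy, skewMono_mul, zpow_one, twist_twist, mul_inv_cancel,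
    twist_one, one_mul, map_one, ← map_one (skewC (k := k)), skewC_apply q, skewC_apply q,
    add_neg_cancel, ← skewMono_add, add_sub_cancel]

theorem unitT_sub_one_ne_zero : varT k - 1 ≠ 0 := by
  intro h
  have h1 : (AddMonoidAlgebra.single 1 1 : k[T;T⁻¹]).coeff 1 =
      (AddMonoidAlgebra.single 0 1 : k[T;T⁻¹]).coeff 1 := by
    rw [← AddMonoidAlgebra.one_def, ← sub_eq_zero.mp h]
    rfl
  rw [AddMonoidAlgebra.coeff_single, AddMonoidAlgebra.coeff_single, Finsupp.single_eq_same,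
    Finsupp.single_apply, if_neg zero_ne_one] at h1
  exact one_ne_zero h1

/-- The coefficient stays nonzero because Laurent polynomials over `k` form a domain and twists are
injective; this is what makes the representation faithful. -/
theorem exists_map_mono {ρ : B1 (q : k) →ₐ[k] SkewRing k}
    (hx : ρ (x (q : k)) = skewMono q 1 1)
    (hy : ρ (y (q : k)) = skewMono q (twist q⁻¹ (varT k - 1)) (-1)) (i : ℤ) :
    ∃ h : k[T;T⁻¹], h ≠ 0 ∧ ρ (mono q i) = skewMono q h i := by
  have hpow : ∀ (a : B1 (q : k)) (h : k[T;T⁻¹]) (j : ℤ), h ≠ 0 → ρ a = skewMono q h j →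
      ∀ n : ℕ, ∃ h' : k[T;T⁻¹], h' ≠ 0 ∧ ρ (a ^ n) = skewMono q h' (n * j) := by
    intro a h j h0 ha n
    induction n with
    | zero =>
      refine ⟨1, one_ne_zero, ?_⟩
      rw [pow_zero, map_one, Nat.cast_zero, zero_mul, ← skewC_apply, map_one]
    | succ n ih =>
      obtain ⟨h', h'0, e⟩ := ih
      refine ⟨h * twist (q ^ j) h', mul_ne_zero h0 fun h1 => h'0 ?_, ?_⟩
      · exact twist_injective _ (h1.trans (map_zero _).symm)
      · rw [pow_succ', map_mul, ha, e, skewMono_mul]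
        congr 1
        push_cast; ring
  obtain ⟨n, rfl | rfl⟩ := i.eq_nat_or_neg
  · rw [mono_natCast]
    simpa using hpow _ 1 1 one_ne_zero hx n
  · rw [mono_neg_natCast]
    have h0 : twist q⁻¹ (varT k - 1) ≠ 0 := fun h1 =>
      unitT_sub_one_ne_zero (twist_injective _ (h1.trans (map_zero _).symm))
    simpa using hpow _ _ (-1) h0 hy n

end B1

end QuasiHam

end

/-! ### Faithfulness, units of `B₁ᶜ`, and the shape of its automorphisms. -/

noncomputable section

namespace QuasiHam

namespace B1

open LaurentPolynomial

variable {k : Type*} [Field k] (q : kˣ)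

/-- The coefficient of `tⁱ`. -/
def skewCoeff (i : ℤ) : SkewRing k →+ Module.End k k[T;T⁻¹] where
  toFun p := AddMonoidAlgebra.coeff (R := Module.End k k[T;T⁻¹]) p i
  map_zero' := rfl
  map_add' _ _ := rfl

theorem skewCoeff_skewMono (i j : ℤ) (f : k[T;T⁻¹]) :
    skewCoeff i (skewMono q f j) = if j = i then twistOp f (q ^ j) else 0 := by
  change (AddMonoidAlgebra.single j (twistOp f (q ^ j))).coeff i = _
  rw [AddMonoidAlgebra.coeff_single, Finsupp.single_apply]

/-- A faithful representation of `B₁ᶜ`, in terms of normal forms. -/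
theorem exists_skewHom_normalForm : ∃ (ρ : B1 (q : k) →ₐ[k] SkewRing k) (h : ℤ → k[T;T⁻¹]),
    ρ (x (q : k)) = skewMono q 1 1 ∧ (∀ i, h i ≠ 0) ∧
    ∀ F i, skewCoeff i (ρ (normalForm q F)) = twistOp (F i * h i) (q ^ i) := by
  obtain ⟨ρ, hx, hy⟩ := exists_skewHom q
  choose h h0 hh using exists_map_mono q hx hy
  refine ⟨ρ, h, hx, h0, fun F i => ?_⟩
  induction F using Finsupp.induction_linear with
  | zero => rw [map_zero, map_zero, map_zero, Finsupp.zero_apply, zero_mul, twistOp_zero]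
  | add F G hF hG => rw [map_add, map_add, map_add, hF, hG, Finsupp.add_apply, add_mul, twistOp_add]
  | single j f =>
    rw [normalForm_single, map_mul, map_incl q hx hy, hh, skewMono_mul, zpow_zero, twist_one,
      zero_add, skewCoeff_skewMono, Finsupp.single_apply]
    split_ifs with hij
    · rw [hij]
    · rw [zero_mul, twistOp_zero]

theorem normalForm_eq_zero {ρ : B1 (q : k) →ₐ[k] SkewRing k} {h : ℤ → k[T;T⁻¹]}
    (h0 : ∀ i, h i ≠ 0)
    (hρ : ∀ F i, skewCoeff i (ρ (normalForm q F)) = twistOp (F i * h i) (q ^ i))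
    {F : ℤ →₀ k[T;T⁻¹]} {i : ℤ} (hF : skewCoeff i (ρ (normalForm q F)) = 0) : F i = 0 := by
  rw [hρ] at hF
  exact (mul_eq_zero.mp (twistOp_eq_zero hF)).resolve_right (h0 i)

theorem normalForm_injective : Function.Injective (normalForm q) := by
  obtain ⟨ρ, h, -, h0, hρ⟩ := exists_skewHom_normalForm q
  refine (injective_iff_map_eq_zero _).mpr fun F hF => Finsupp.ext fun i => ?_
  exact normalForm_eq_zero q h0 hρ (by rw [hF, map_zero, map_zero])

theorem incl_mul_mono_inj {f g : k[T;T⁻¹]} {i : ℤ}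
    (h : incl q f * mono q i = incl q g * mono q i) : f = g := by
  rw [← normalForm_single, ← normalForm_single] at h
  exact Finsupp.single_injective i (normalForm_injective q h)

theorem mono_zero : mono q 0 = 1 := by simp [mono]

theorem incl_injective : Function.Injective (incl q) := fun f g h =>
  incl_mul_mono_inj q (i := 0) (by rw [h])

/-- The image `t` of `x` is invertible in the skew Laurent ring, and the representation is faithful.
-/
theorem x_mul_cancel {a b : B1 (q : k)} (hab : x (q : k) * a = x (q : k) * b) : a = b := by
  obtain ⟨ρ, h, hx, h0, hρ⟩ := exists_skewHom_normalForm q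
  have h1 : ρ (a - b) = 0 := by
    calc ρ (a - b) = skewMono q 1 (-1) * ρ (x (q : k) * (a - b)) := by
          rw [map_mul, hx, ← mul_assoc, skewMono_mul, map_one, mul_one, neg_add_cancel,
            ← skewC_apply, map_one, one_mul]
      _ = 0 := by rw [mul_sub, hab, sub_self, map_zero, mul_zero]
  obtain ⟨F, hF⟩ := normalForm_surjective q (a - b)
  have hF0 : F = 0 := Finsupp.ext fun i =>
    normalForm_eq_zero q h0 hρ (by rw [hF, h1, map_zero])
  rw [hF0, map_zero] at hF
  exact sub_eq_zero.mp hF.symm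

/-- Factors of nonzero elements of degree zero are homogeneous. -/
theorem homogeneous_of_mul_eq {a b : B1 (q : k)} {e : k[T;T⁻¹]} (hab : a * b = incl q e)
    (he : e ≠ 0) : ∃ (i : ℤ) (f g : k[T;T⁻¹]),
      a = incl q f * mono q i ∧ b = incl q g * mono q (-i) := by
  obtain ⟨ρ, h, hx, h0, hρ⟩ := exists_skewHom_normalForm q
  obtain ⟨F, rfl⟩ := normalForm_surjective q a
  obtain ⟨G, rfl⟩ := normalForm_surjective q b
  have hone : ∀ E : ℤ →₀ k[T;T⁻¹], ∀ i : ℤ,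
      (ρ (normalForm q E) : (Module.End k k[T;T⁻¹])[T;T⁻¹]) =
        .single i (skewCoeff i (ρ (normalForm q E))) →
          normalForm q E = incl q (E i) * mono q i := by
    intro E i hE
    have : E = Finsupp.single i (E i) := by
      refine Finsupp.ext fun j => ?_
      rw [Finsupp.single_apply]
      split_ifs with hij
      · rw [hij]
      · refine normalForm_eq_zero q h0 hρ ?_
        have h2 := congrArg (fun p : (Module.End k k[T;T⁻¹])[T;T⁻¹] => p.coeff j) hE
        simp only [AddMonoidAlgebra.coeff_single] at h2
        rw [Finsupp.single_apply, if_neg hij] at h2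
        exact h2
    nth_rewrite 1 [this]
    rw [normalForm_single]
  have hprod : ρ (normalForm q F) * ρ (normalForm q G) = skewMono q (e * h 0) 0 := by
    have h3 := hρ (Finsupp.single 0 e)
    have hz : ρ (incl q e) = ρ (normalForm q (Finsupp.single 0 e)) := by
      rw [normalForm_single, mono_zero, mul_one]
    rw [← map_mul, hab, hz]
    refine AddMonoidAlgebra.ext (R := Module.End k k[T;T⁻¹]) ?_
    refine Finsupp.ext fun i => ?_
    refine (h3 i).trans (Eq.trans ?_ (skewCoeff_skewMono q i 0 (e * h 0)).symm)
    rw [Finsupp.single_apply]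
    split_ifs with hi
    · rw [← hi]
    · rw [zero_mul, twistOp_zero]
  -- All coefficients of the images have the form `twistOp f (q ^ i)`, and products of nonzero
  -- operators of this form are nonzero.
  obtain ⟨i, j, hij, hF, hG⟩ := single_of_mul_eq_single (R := Module.End k k[T;T⁻¹])
    (p := ρ (normalForm q F)) (q := ρ (normalForm q G)) (fun i j hi hj => by
      change skewCoeff i (ρ (normalForm q F)) ≠ 0 at hi
      change skewCoeff j (ρ (normalForm q G)) ≠ 0 at hj
      change skewCoeff i (ρ (normalForm q F)) * skewCoeff j (ρ (normalForm q G)) ≠ 0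
      rw [hρ] at hi hj ⊢
      rw [hρ, twistOp_mul]
      intro hm
      rcases mul_eq_zero.mp (twistOp_eq_zero hm) with h4 | h4
      · exact hi (by rw [h4, twistOp_zero])
      · rw [← map_zero (twist (q ^ i))] at h4
        exact hj (by rw [twist_injective _ h4, twistOp_zero])) hprod
    (fun h5 => (mul_ne_zero he (h0 0)) (twistOp_eq_zero h5))
  obtain rfl : j = -i := by omega
  exact ⟨i, F i, G (-i), hone F i hF, hone G (-i) hG⟩

theorem eval_twist (r d : kˣ) (f : k[T;T⁻¹]) :
    laurentEval (A := k) r (twist d f) = laurentEval (d * r) f := by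
  rw [laurentEval_twist]; rfl

theorem eval_varT_sub_one (r : kˣ) : laurentEval (A := k) r (varT k - 1) = r - 1 := by
  rw [map_sub, laurentEval_unitT, map_one]

/-- Peeling off the innermost `a * b` shows that `p` is the product of the factors `dᵐ e T - 1` for
`m < n`. The roots recorded are those for `m = 0` and `m = 1`. -/
theorem pow_mul_pow {a b : B1 (q : k)} {d e : kˣ}
    (h : ∀ f, a * incl q f = incl q (twist d f) * a) (hab : a * b = incl q (twist e (varT k - 1)))
    (n : ℕ) : ∃ p, a ^ n * b ^ n = incl q p ∧ (1 ≤ n → laurentEval (A := k) e⁻¹ p = 0) ∧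
      (2 ≤ n → laurentEval (A := k) (d * e)⁻¹ p = 0) := by
  induction n with
  | zero => exact ⟨1, by rw [pow_zero, pow_zero, one_mul, map_one], by omega, by omega⟩
  | succ n ih =>
    obtain ⟨p, hp, h1, h2⟩ := ih
    refine ⟨twist (d ^ n * e) (varT k - 1) * p, ?_, fun _ => ?_, fun hn => ?_⟩
    · rw [pow_succ, pow_succ', mul_assoc, ← mul_assoc a b, hab, ← mul_assoc, pow_mul_incl q h,
        twist_twist, mul_assoc, hp, map_mul]
    · rw [map_mul]
      rcases n with _ | n
      · rw [eval_twist, eval_varT_sub_one]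
        simp
      · rw [h1 (by omega), mul_zero]
    · rw [map_mul]
      obtain rfl | hn' : n = 1 ∨ 2 ≤ n := by omega
      · rw [eval_twist, eval_varT_sub_one]
        simp
      · rw [h2 hn', mul_zero]

theorem exists_mono_mul_mono_neg (hq : q ≠ 1) (i : ℤ) : ∃ p, mono q i * mono q (-i) = incl q p ∧
    (i ≠ 0 → ∃ r : kˣ, laurentEval (A := k) r p = 0) ∧
    (i ≠ 0 → i ≠ 1 → i ≠ -1 → ∃ r r' : kˣ, r ≠ r' ∧ laurentEval (A := k) r p = 0 ∧
      laurentEval (A := k) r' p = 0) := by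
  have hde : ∀ d e : kˣ, d ≠ 1 → e⁻¹ ≠ (d * e)⁻¹ := by
    intro d e hd h
    rw [inv_inj, eq_comm, mul_eq_right] at h
    exact hd h
  obtain ⟨n, rfl | rfl⟩ := i.eq_nat_or_neg
  · obtain ⟨p, hp, h1, h2⟩ := pow_mul_pow q (x_mul_incl q) (e := 1)
      (by rw [twist_one, x_mul_y]) n
    refine ⟨p, by rw [mono_natCast, mono_neg_natCast, hp], fun h => ⟨_, h1 (by omega)⟩,
      fun h h' h'' => ⟨_, _, hde q 1 hq, h1 (by omega), h2 (by omega)⟩⟩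
  · obtain ⟨p, hp, h1, h2⟩ := pow_mul_pow q (y_mul_incl q) (y_mul_x q) n
    refine ⟨p, by rw [neg_neg, mono_natCast, mono_neg_natCast, hp], fun h => ⟨_, h1 (by omega)⟩,
      fun h h' h'' => ⟨_, _, hde q⁻¹ q⁻¹ (by simpa using hq), h1 (by omega), h2 (by omega)⟩⟩

theorem incl_mono_mul (f g : k[T;T⁻¹]) (i : ℤ) {p : k[T;T⁻¹]}
    (hp : mono q i * mono q (-i) = incl q p) : incl q f * mono q i * (incl q g * mono q (-i)) =
      incl q (f * twist (q ^ i) g * p) := by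
  rw [mul_assoc, ← mul_assoc (mono q i), mono_mul_incl, mul_assoc (incl q _), hp, ← mul_assoc,
    map_mul, map_mul]

theorem incl_single (n : ℤ) (r : k) :
    incl q (.single n r) = r • ((z (q : k) ^ n : (B1 (q : k))ˣ) : B1 (q : k)) :=
  laurentEval_single _ _ _

theorem eq_smul_zpow_of_mul_eq_one (hq : q ≠ 1) {a b : B1 (q : k)} (hab : a * b = 1) :
    ∃ (n : ℤ) (r : kˣ), a = (r : k) • ((z (q : k) ^ n : (B1 (q : k))ˣ) : B1 (q : k)) := by
  rw [← map_one (incl q)] at hab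
  obtain ⟨i, f, g, rfl, rfl⟩ := homogeneous_of_mul_eq q hab one_ne_zero
  obtain ⟨p, hp, h1, -⟩ := exists_mono_mul_mono_neg q hq i
  rw [incl_mono_mul q f g i hp] at hab
  have h2 := incl_injective q hab
  -- Otherwise `p` has a root in `kˣ`, and evaluating there gives `0 = 1`.
  have hi : i = 0 := by
    by_contra hi
    obtain ⟨r, hr⟩ := h1 hi
    have h3 := congrArg (laurentEval (A := k) r) h2
    rw [map_mul, hr, mul_zero, map_one] at h3
    exact zero_ne_one h3
  rw [mul_assoc] at h2
  obtain ⟨n, r, rfl⟩ := eq_single_of_mul_eq_one h2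
  exact ⟨n, r, by rw [hi, mono_zero, mul_one, incl_single]⟩

/-- The images of `x` and `y` multiply to `l z - 1`, so `s x` is homogeneous of some degree `i`. The
single root of `l T - 1` forces `|i| ≤ 1`, and the relation `x z = q z x` forces `q ^ i = q`,
leaving `i = 1`. Then `l T - 1` is divisible by `T - 1`, so `l = 1` and the remaining factor is a
unit. Powers of `q` beyond the second are never assumed nontrivial. -/
theorem algEquiv_apply_x (hq : q ≠ 1) (hq' : q ^ 2 ≠ 1) (s : B1 (q : k) ≃ₐ[k] B1 (q : k)) {l : kˣ}
    (hs : s (z (q : k)) = (l : k) • (z (q : k) : B1 (q : k))) : s (z (q : k)) = z (q : k) ∧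
      ∃ (n : ℤ) (r : kˣ), s (x (q : k)) =
        (r : k) • (((z (q : k) ^ n : (B1 (q : k))ˣ) : B1 (q : k)) * x (q : k)) := by
  have hz : incl q (varT k) = z (q : k) := incl_unitT q
  have hl : (l : k) ≠ 0 := l.ne_zero
  have hprod : s (x (q : k)) * s (y (q : k)) = incl q ((l : k) • varT k - 1) := by
    rw [← map_mul, xy, map_sub, hs, map_one, map_sub, map_smul, hz, map_one]
  have hne : (l : k) • varT k - 1 ≠ 0 := by
    intro h0
    rw [h0, map_zero, ← map_mul, x_mul_y] at hprod
    have h1 := (map_eq_zero_iff s s.injective).mp hprod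
    exact unitT_sub_one_ne_zero (incl_injective q (h1.trans (map_zero _).symm))
  obtain ⟨i, f, g, hf, hg⟩ := homogeneous_of_mul_eq q hprod hne
  obtain ⟨p, hp, -, h2⟩ := exists_mono_mul_mono_neg q hq i
  rw [hf, hg, incl_mono_mul q f g i hp] at hprod
  have hpoly := incl_injective q hprod
  have heval : ∀ r : kˣ, laurentEval (A := k) r p = 0 → (l : k) * r = 1 := by
    intro r hr
    have h3 := congrArg (laurentEval (A := k) r) hpoly
    rw [map_mul, hr, mul_zero, map_sub, map_smul, laurentEval_unitT, map_one] at h3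
    exact (sub_eq_zero.mp h3.symm)
  have hqi : q ^ i = q := by
    have h3 := congrArg s (xz (q : k))
    rw [map_mul, map_smul, map_mul, hs, mul_smul_comm, smul_mul_assoc, smul_comm, hf, ← hz,
      mul_assoc, mono_mul_incl, ← mul_assoc, ← mul_assoc, ← map_mul, ← map_mul, twist_unitT,
      ← smul_mul_assoc, ← smul_mul_assoc, ← smul_mul_assoc, ← map_smul, ← map_smul,
      ← map_smul] at h3
    -- Comparison of normal forms of `s x * s z` and `q • (s z * s x)`, both in degree `i`.
    have h4 := incl_mul_mono_inj q h3
    have h5 : (((q ^ i : kˣ) : k) - q) • (f * varT k) = 0 := by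
      have h6 : (l : k) • ((((q ^ i : kˣ) : k) - q) • (f * varT k)) = 0 := by
        rw [sub_smul, smul_sub, ← mul_smul_comm, h4, mul_comm (varT k), smul_comm, sub_self]
      exact (smul_eq_zero.mp h6).resolve_left hl
    rcases smul_eq_zero.mp h5 with h6 | h6
    · exact Units.ext (sub_eq_zero.mp h6)
    · rcases mul_eq_zero.mp h6 with h7 | h7
      · rw [h7, zero_mul, zero_mul] at hpoly
        exact absurd hpoly.symm hne
      · exact absurd h7 (Units.ne_zero _)
  have hi : i = 1 := by
    by_contra h1
    have h0 : i ≠ 0 := by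
      rintro rfl
      exact hq (by rw [← hqi, zpow_zero])
    have hm : i ≠ -1 := by
      rintro rfl
      apply hq'
      rw [pow_two]
      nth_rewrite 1 [← hqi]
      rw [zpow_neg_one, inv_mul_cancel]
    obtain ⟨r, r', hrr, hr, hr'⟩ := h2 h0 h1 hm
    apply hrr
    have h3 := (heval r hr).trans (heval r' hr').symm
    exact Units.ext (mul_left_cancel₀ hl h3)
  subst hi
  have hm1 : mono q 1 = x (q : k) := by simpa using mono_natCast q 1
  have hm2 : mono q (-1) = y (q : k) := by simpa using mono_neg_natCast q 1
  have hp1 : p = varT k - 1 := incl_injective q (by rw [← hp, hm1, hm2, x_mul_y])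
  have hl1 : (l : k) = 1 := by
    have h3 := heval 1 (by rw [hp1, eval_varT_sub_one]; simp)
    simpa using h3
  refine ⟨by rw [hs, hl1, one_smul], ?_⟩
  rw [hp1, hl1, one_smul] at hpoly
  have h3 := mul_right_cancel₀ unitT_sub_one_ne_zero (hpoly.trans (one_mul _).symm)
  obtain ⟨n, r, rfl⟩ := eq_single_of_mul_eq_one h3
  exact ⟨n, r, by rw [hf, hm1, incl_single, smul_mul_assoc]⟩

/-- The image of `y` is determined by `x y = z - 1`, since `x` can be cancelled on the left. -/
theorem algEquiv_ext {s t : B1 (q : k) ≃ₐ[k] B1 (q : k)} (hx : s (x (q : k)) = t (x (q : k)))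
    (hz : s (z (q : k)) = t (z (q : k))) : s = t := by
  have hy : y (q : k) = s.symm (t (y (q : k))) := by
    apply x_mul_cancel q
    apply s.injective
    rw [map_mul s _ (s.symm _), s.apply_symm_apply, hx, ← map_mul t, xy, map_sub, map_sub, hz,
      map_one, map_one]
  have hy' : s (y (q : k)) = t (y (q : k)) := by
    nth_rewrite 1 [hy]; rw [s.apply_symm_apply]
  have h : (s : B1 (q : k) →ₐ[k] B1 (q : k)) = t := algHom_ext hx hy'
  exact AlgEquiv.ext fun a => DFunLike.congr_fun h a

/-- An automorphism sends the unit `z` to a unit `r zⁿ`, and its inverse sends `z` to some `r' zᵐ`.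
Composing gives `n m = 1`. -/
theorem algEquiv_apply_z (hq : q ≠ 1) (s : B1 (q : k) ≃ₐ[k] B1 (q : k)) : ∃ r : kˣ,
    s (z (q : k)) = (r : k) • (z (q : k) : B1 (q : k)) ∨
    s (z (q : k)) = (r : k) • (((z (q : k))⁻¹ : (B1 (q : k))ˣ) : B1 (q : k)) := by
  have key : ∀ t : B1 (q : k) ≃ₐ[k] B1 (q : k), ∃ (n : ℤ) (r : kˣ),
      Units.map (t : B1 (q : k) →* B1 (q : k)) (z (q : k)) = scalarUnit _ r * z (q : k) ^ n := by
    intro t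
    obtain ⟨n, r, h⟩ := eq_smul_zpow_of_mul_eq_one q hq (a := t (z (q : k)))
      (b := t ((z (q : k))⁻¹ : (B1 (q : k))ˣ)) (by rw [← map_mul, Units.mul_inv, map_one])
    exact ⟨n, r, Units.ext (h.trans (Algebra.smul_def _ _))⟩
  obtain ⟨n, r, hn⟩ := key s
  obtain ⟨m, r', hm⟩ := key s.symm
  have hnm : n * m = 1 := by
    have h1 : z (q : k) = scalarUnit _ (r' * r ^ m) * z (q : k) ^ (n * m) := by
      have h2 := congrArg (Units.map (s : B1 (q : k) →* B1 (q : k))) hm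
      rw [map_mul, map_zpow, hn, (commute_scalarUnit r _).mul_zpow, ← zpow_mul, ← mul_assoc] at h2
      have h3 : Units.map (s : B1 (q : k) →* B1 (q : k))
          (Units.map (s.symm : B1 (q : k) →* B1 (q : k)) (z (q : k))) = z (q : k) :=
        Units.ext (s.apply_symm_apply _)
      have h4 : Units.map (s : B1 (q : k) →* B1 (q : k)) (scalarUnit _ r') = scalarUnit _ r' :=
        Units.ext (s.commutes _)
      rw [h3, h4] at h2
      rw [scalarUnit_mul, scalarUnit_zpow]
      exact h2
    have h2 : incl q (.single 1 1) = incl q (.single (n * m) ((r' * r ^ m : kˣ) : k)) := by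
      rw [incl_single, incl_single, one_smul, zpow_one, Algebra.smul_def]
      exact congrArg Units.val h1
    have h3 := congrArg (fun f : k[T;T⁻¹] => f.coeff 1) (incl_injective q h2)
    simp only [AddMonoidAlgebra.coeff_single] at h3
    by_contra hne
    rw [Finsupp.single_eq_same, Finsupp.single_apply, if_neg hne] at h3
    exact one_ne_zero h3
  have hval := congrArg Units.val hn
  refine ⟨r, ?_⟩
  rcases Int.eq_one_or_neg_one_of_mul_eq_one hnm with rfl | rfl
  · left
    rw [zpow_one] at hval
    exact hval.trans (Algebra.smul_def _ _).symm
  · right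
    rw [zpow_neg_one] at hval
    exact hval.trans (Algebra.smul_def _ _).symm

end B1

end QuasiHam

end

/-! ### Generation of the automorphism group of `B₁ᶜ`. -/

noncomputable section

namespace QuasiHam

/-! ### Generators of the automorphism group -/

section Generation

variable {k : Type*} [Field k] {q : kˣ}

theorem toB1_v_inv {c : k} (hc : c ≠ 0) :
    toB1 hc ((F2S.v k)⁻¹ : (F2S k)ˣ) = c • (((B1.z c)⁻¹ : (B1 c)ˣ) : B1 c) := by
  have h : toB1 hc ((F2S.v k)⁻¹ : (F2S k)ˣ) * toB1 hc (F2S.v k) = 1 := by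
    rw [← map_mul, Units.inv_mul, map_one]
  rw [toB1_v, mul_smul_comm, inv_smul_eq_iff₀ hc] at h
  rw [← Units.mul_inv_cancel_right (toB1 hc ((F2S.v k)⁻¹ : (F2S k)ˣ)) (B1.z c), h,
    smul_mul_assoc, one_mul]

namespace B1

theorem map_z_zpow {θ : B1 (q : k) ≃ₐ[k] B1 (q : k)} (hz : θ (z (q : k)) = z (q : k)) (n : ℤ) :
    θ ((z (q : k) ^ n : (B1 (q : k))ˣ) : B1 (q : k)) = (z (q : k) ^ n : (B1 (q : k))ˣ) := by
  have h : Units.map (θ : B1 (q : k) →* B1 (q : k)) (z (q : k)) = z (q : k) := Units.ext hz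
  have h2 := map_zpow (Units.map (θ : B1 (q : k) →* B1 (q : k))) (z (q : k)) n
  rw [h] at h2
  exact congrArg Units.val h2

theorem zpow_apply {θ : B1 (q : k) ≃ₐ[k] B1 (q : k)} (hz : θ (z (q : k)) = z (q : k))
    (hx : θ (x (q : k)) = z (q : k) * x (q : k)) (n : ℤ) :
    (θ ^ n) (z (q : k)) = z (q : k) ∧
      (θ ^ n) (x (q : k)) = ((z (q : k) ^ n : (B1 (q : k))ˣ) : B1 (q : k)) * x (q : k) := by
  have hz' : θ⁻¹ (z (q : k)) = z (q : k) := θ.symm_apply_eq.mpr hz.symm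
  have hx' : θ⁻¹ (x (q : k)) = ((z (q : k) ^ (-1 : ℤ) : (B1 (q : k))ˣ) : B1 (q : k)) *
      x (q : k) := by
    refine θ.symm_apply_eq.mpr ?_
    rw [map_mul, map_z_zpow hz, hx, zpow_neg_one, Units.inv_mul_cancel_left]
  induction n with
  | zero => simp
  | succ n ih =>
    rw [zpow_add_one, AlgEquiv.mul_apply, AlgEquiv.mul_apply, hz, hx, map_mul, ih.1, ih.2,
      ← mul_assoc, ← Units.val_mul, ← zpow_one_add, add_comm]
    exact ⟨rfl, rfl⟩
  | pred n ih =>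
    rw [sub_eq_add_neg, zpow_add θ, zpow_neg_one, AlgEquiv.mul_apply, AlgEquiv.mul_apply, hz', hx',
      map_mul, map_z_zpow ih.1, ih.1, ih.2, ← mul_assoc, ← Units.val_mul, ← zpow_add, add_comm]
    exact ⟨rfl, rfl⟩

variable {θ ξ : B1 (q : k) ≃ₐ[k] B1 (q : k)} {φ : kˣ → (B1 (q : k) ≃ₐ[k] B1 (q : k))}

theorem exists_eq_mul (hq : q ≠ 1) (hq' : q ^ 2 ≠ 1) (hθz : θ (z (q : k)) = z (q : k))
    (hθx : θ (x (q : k)) = z (q : k) * x (q : k))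
    (hξ : ξ (z (q : k)) = (q : k) • (((z (q : k))⁻¹ : (B1 (q : k))ˣ) : B1 (q : k)))
    (hφz : ∀ β, φ β (z (q : k)) = z (q : k))
    (hφx : ∀ β : kˣ, φ β (x (q : k)) = (β : k)⁻¹ • x (q : k)) (σ : B1 (q : k) ≃ₐ[k] B1 (q : k)) :
    ∃ (β : kˣ) (n : ℤ), σ = φ β * θ ^ n ∨ σ = φ β * θ ^ n * ξ⁻¹ := by
  have key : ∀ (τ : B1 (q : k) ≃ₐ[k] B1 (q : k)) (l : kˣ),
      τ (z (q : k)) = (l : k) • (z (q : k) : B1 (q : k)) → ∃ (β : kˣ) (n : ℤ), τ = φ β * θ ^ n := by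
    intro τ l h
    obtain ⟨hz, n, r, hx⟩ := algEquiv_apply_x q hq hq' τ h
    refine ⟨r⁻¹, n, algEquiv_ext q ?_ ?_⟩
    · rw [hx, AlgEquiv.mul_apply, (zpow_apply hθz hθx n).2, map_mul, map_z_zpow (hφz _), hφx,
        Units.val_inv_eq_inv_val, inv_inv, mul_smul_comm]
    · rw [hz, AlgEquiv.mul_apply, (zpow_apply hθz hθx n).1, hφz]
  obtain ⟨r, h | h⟩ := algEquiv_apply_z q hq σ
  · obtain ⟨β, n, h⟩ := key σ r h
    exact ⟨β, n, .inl h⟩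
  -- As `ξ z = q z⁻¹` and `σ z = r z⁻¹`, the composite sends `z` to `q r⁻¹ z`, which is the first
  -- case.
  · obtain ⟨β, n, h⟩ := key (σ * ξ) (q * r⁻¹) (by
      have h1 : Units.map (σ : B1 (q : k) →* B1 (q : k)) (z (q : k)) =
          scalarUnit _ r * (z (q : k))⁻¹ := Units.ext (h.trans (Algebra.smul_def _ _))
      have h2 := congrArg (fun w : (B1 (q : k))ˣ => ((w⁻¹ : (B1 (q : k))ˣ) : B1 (q : k))) h1
      simp only [mul_inv_rev, inv_inv, Units.val_mul] at h2
      have h3 : σ (((z (q : k))⁻¹ : (B1 (q : k))ˣ) : B1 (q : k)) =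
          z (q : k) * algebraMap k _ ((r⁻¹ : kˣ) : k) := h2
      rw [AlgEquiv.mul_apply, hξ, map_smul, h3, ← Algebra.commutes, ← Algebra.smul_def, smul_smul,
        Units.val_mul])
    exact ⟨β, n, .inr (by rw [← h, mul_inv_cancel_right])⟩

theorem closure_eq_top {ψ : B1 (q : k) ≃ₐ[k] B1 (q : k)} (hq : q ≠ 1) (hq' : q ^ 2 ≠ 1)
    (hψz : ψ (z (q : k)) = z (q : k)) (hψx : ψ (x (q : k)) = x (q : k) * z (q : k))
    (hξ : ξ (z (q : k)) = (q : k) • (((z (q : k))⁻¹ : (B1 (q : k))ˣ) : B1 (q : k)))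
    (hφz : ∀ β, φ β (z (q : k)) = z (q : k))
    (hφx : ∀ β : kˣ, φ β (x (q : k)) = (β : k)⁻¹ • x (q : k)) :
    Subgroup.closure ({ψ, ξ} ∪ Set.range φ) = ⊤ := by
  refine eq_top_iff.mpr fun σ _ => ?_
  have hψ : ψ ∈ Subgroup.closure ({ψ, ξ} ∪ Set.range φ) :=
    Subgroup.subset_closure (.inl (.inl rfl))
  have hξm : ξ ∈ Subgroup.closure ({ψ, ξ} ∪ Set.range φ) :=
    Subgroup.subset_closure (.inl (.inr rfl))
  have hφ : ∀ β, φ β ∈ Subgroup.closure ({ψ, ξ} ∪ Set.range φ) := fun β =>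
    Subgroup.subset_closure (.inr ⟨β, rfl⟩)
  -- On `B₁ᶜ` the map `x ↦ z x` needs no new generator: `φ q * ψ` sends `x` to `q⁻¹ x z = z x`.
  obtain ⟨β, n, rfl | rfl⟩ := exists_eq_mul (θ := φ q * ψ) hq hq'
    (by rw [AlgEquiv.mul_apply, hψz, hφz])
    (by rw [AlgEquiv.mul_apply, hψx, map_mul, hφx, hφz, smul_mul_assoc, xz, smul_smul,
      inv_mul_cancel₀ q.ne_zero, one_smul]) hξ hφz hφx σ
  · exact mul_mem (hφ β) (zpow_mem (mul_mem (hφ q) hψ) n)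
  · exact mul_mem (mul_mem (hφ β) (zpow_mem (mul_mem (hφ q) hψ) n)) (inv_mem hξm)

end B1

end Generation

end QuasiHam

end

/-! ### Assembly of the theorem. -/

theorem mainTheorem10 {k : Type*} [Field k] [CharZero k] (c : k)
    (hc0 : c ≠ 0) (hc1 : c ≠ 1) (hcm1 : c ≠ -1) :
    -- the two quasi-Hamiltonian structures exist on `k⟨x, y⟩_S`
    ∃ H₁ H₂ : QuasiHam.QuasiHamiltonian k (QuasiHam.F2S k),
      QuasiHam.F2S.IsFirstStructure H₁ ∧ QuasiHam.F2S.IsSecondStructure H₂ ∧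
      -- `B₁ᶜ` is the quotient of `k⟨x, y⟩_S` obtained by setting either moment map to `c⁻¹`
      Function.Surjective (QuasiHam.toB1 hc0) ∧
      (∀ H ∈ ({H₁, H₂} : Set (QuasiHam.QuasiHamiltonian k (QuasiHam.F2S k))),
        TwoSidedIdeal.ker (QuasiHam.toB1 hc0) =
          TwoSidedIdeal.span {H.moment - algebraMap k (QuasiHam.F2S k) c⁻¹}) ∧
      -- explicit isomorphisms, inducing generators of the automorphism group of `B₁ᶜ`
      (∃ (ψ ξ : QuasiHam.F2S k ≃ₐ[k] QuasiHam.F2S k)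
          (φ : kˣ → (QuasiHam.F2S k ≃ₐ[k] QuasiHam.F2S k))
          (ψ' ξ' : QuasiHam.B1 c ≃ₐ[k] QuasiHam.B1 c)
          (φ' : kˣ → (QuasiHam.B1 c ≃ₐ[k] QuasiHam.B1 c)),
        ψ (QuasiHam.F2S.x k) = QuasiHam.F2S.x k * (QuasiHam.F2S.u k : QuasiHam.F2S k) ∧
        ψ (QuasiHam.F2S.y k) =
          ((QuasiHam.F2S.u k)⁻¹ : (QuasiHam.F2S k)ˣ) * QuasiHam.F2S.y k ∧
        QuasiHam.IsQuasiHamiltonianIso H₁ H₂ ψ ∧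
        QuasiHam.Induces hc0 ψ ψ' ∧
        ξ (QuasiHam.F2S.x k) =
          -(((QuasiHam.F2S.v k)⁻¹ : (QuasiHam.F2S k)ˣ) * QuasiHam.F2S.y k) ∧
        ξ (QuasiHam.F2S.y k) = QuasiHam.F2S.x k ∧
        QuasiHam.IsQuasiHamiltonianIso H₁ H₂ ξ ∧
        QuasiHam.Induces hc0 ξ ξ' ∧
        (∀ β : kˣ,
          φ β (QuasiHam.F2S.x k) = (β : k)⁻¹ • QuasiHam.F2S.x k ∧
          φ β (QuasiHam.F2S.y k) = (β : k) • QuasiHam.F2S.y k ∧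
          QuasiHam.IsQuasiHamiltonianIso H₁ H₁ (φ β) ∧
          QuasiHam.IsQuasiHamiltonianIso H₂ H₂ (φ β) ∧
          QuasiHam.Induces hc0 (φ β) (φ' β)) ∧
        Subgroup.closure ({ψ', ξ'} ∪ Set.range φ') = ⊤) ∧
      -- every automorphism of `B₁ᶜ` is induced by an isomorphism of quasi-Hamiltonian algebras
      (∀ σ : QuasiHam.B1 c ≃ₐ[k] QuasiHam.B1 c,
        ∃ H ∈ ({H₁, H₂} : Set (QuasiHam.QuasiHamiltonian k (QuasiHam.F2S k))),
        ∃ H' ∈ ({H₁, H₂} : Set (QuasiHam.QuasiHamiltonian k (QuasiHam.F2S k))),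
        ∃ f : QuasiHam.F2S k ≃ₐ[k] QuasiHam.F2S k,
          QuasiHam.IsQuasiHamiltonianIso H H' f ∧ QuasiHam.Induces hc0 f σ) := by
  obtain ⟨H₁, h₁, m₁⟩ := QuasiHam.exists_firstStructure k
  obtain ⟨H₂, h₂, m₂⟩ := QuasiHam.exists_secondStructure k
  obtain ⟨ψ, ψx, ψy, ψu, ψU, ψv⟩ := QuasiHam.exists_mulRight k
  obtain ⟨θ, θx, θy, θu, θU, θv⟩ := QuasiHam.exists_mulLeft k
  obtain ⟨ξ, ξx, ξy, ξu, ξU, ξv⟩ := QuasiHam.exists_swap k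
  choose φ φx φy φu φU φv using QuasiHam.exists_scale k
  have M₁ : QuasiHam.IsMoment H₁.moment := .inl m₁
  have M₂ : QuasiHam.IsMoment H₂.moment := .inr m₂
  have iψ := QuasiHam.isIso_mulRight h₁ m₁ h₂ m₂ ψx ψy ψU ψv
  have iθ := QuasiHam.isIso_mulLeft h₁ m₁ θx θy θU θv
  have iξ := QuasiHam.isIso_swap h₁ m₁ h₂ m₂ ξx ξy ξU ξv
  have iφ₁ : ∀ β, QuasiHam.IsQuasiHamiltonianIso H₁ H₁ (φ β) := fun β =>
    QuasiHam.isIso_scale h₁ (by rw [m₁, map_mul, φU, φv]) (φx β) (φy β)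
  have iφ₂ : ∀ β, QuasiHam.IsQuasiHamiltonianIso H₂ H₂ (φ β) := fun β =>
    QuasiHam.isIso_scale h₂ (by rw [m₂, map_mul, φU, φv]) (φx β) (φy β)
  obtain ⟨ψ', eψ⟩ := QuasiHam.exists_induces (f := ψ) hc0 M₁ (by rw [iψ.2]; exact M₂)
  obtain ⟨θ', eθ⟩ := QuasiHam.exists_induces (f := θ) hc0 M₁ (by rw [iθ.2]; exact M₁)
  obtain ⟨ξ', eξ⟩ := QuasiHam.exists_induces (f := ξ) hc0 M₁ (by rw [iξ.2]; exact M₂)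
  choose φ' eφ using fun β => QuasiHam.exists_induces (f := φ β) hc0 M₁
    (by rw [(iφ₁ β).2]; exact M₁)
  have zψ : ψ' (QuasiHam.B1.z c) = QuasiHam.B1.z c := by
    rw [← QuasiHam.toB1_u hc0, eψ, ψu]
  have xψ : ψ' (QuasiHam.B1.x c) = QuasiHam.B1.x c * QuasiHam.B1.z c := by
    rw [← QuasiHam.toB1_u hc0, ← QuasiHam.toB1_x hc0, eψ, ψx, map_mul]
  have zθ : θ' (QuasiHam.B1.z c) = QuasiHam.B1.z c := by
    rw [← QuasiHam.toB1_u hc0, eθ, θu]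
  have xθ : θ' (QuasiHam.B1.x c) = QuasiHam.B1.z c * QuasiHam.B1.x c := by
    rw [← QuasiHam.toB1_u hc0, ← QuasiHam.toB1_x hc0, eθ, θx, map_mul]
  have zξ : ξ' (QuasiHam.B1.z c) =
      c • (((QuasiHam.B1.z c)⁻¹ : (QuasiHam.B1 c)ˣ) : QuasiHam.B1 c) := by
    rw [← QuasiHam.toB1_u hc0, eξ, ξu, QuasiHam.toB1_v_inv]
  have zφ : ∀ β, φ' β (QuasiHam.B1.z c) = QuasiHam.B1.z c := fun β => by
    rw [← QuasiHam.toB1_u hc0, eφ, φu]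
  have xφ : ∀ β : kˣ, φ' β (QuasiHam.B1.x c) = (β : k)⁻¹ • QuasiHam.B1.x c := fun β => by
    rw [← QuasiHam.toB1_x hc0, eφ, φx, map_smul]
  obtain ⟨q, rfl⟩ : ∃ q : kˣ, (q : k) = c := ⟨Units.mk0 c hc0, rfl⟩
  have hq : q ≠ 1 := fun h => hc1 (by rw [h, Units.val_one])
  have hq' : q ^ 2 ≠ 1 := fun h => by
    have h' : (q : k) ^ 2 = 1 := by rw [← Units.val_pow_eq_pow_val, h, Units.val_one]
    exact (sq_eq_one_iff.mp h').elim hc1 hcm1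
  refine ⟨H₁, H₂, h₁.isFirstStructure m₁, h₂.isSecondStructure m₂, QuasiHam.toB1_surjective hc0, ?_,
    ⟨ψ, ξ, φ, ψ', ξ', φ', ψx, ψy, iψ, eψ, ξx, ξy, iξ, eξ,
      fun β => ⟨φx β, φy β, iφ₁ β, iφ₂ β, eφ β⟩,
      QuasiHam.B1.closure_eq_top hq hq' zψ xψ zξ zφ xφ⟩, fun σ => ?_⟩
  · rintro H (rfl | rfl)
    · exact QuasiHam.ker_toB1 M₁
    · exact QuasiHam.ker_toB1 M₂
  -- Here `θ` is indispensable: unlike `ψ` it is an automorphism of `(F, H₁)`, so all its integer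
  -- powers are.
  have hf : ∀ (β : kˣ) (n : ℤ), QuasiHam.IsQuasiHamiltonianIso H₁ H₁ (φ β * θ ^ n) := fun β n =>
    H₁.autSubgroup.mul_mem (iφ₁ β) (H₁.autSubgroup.zpow_mem iθ n)
  have hI : ∀ (β : kˣ) (n : ℤ), (φ β * θ ^ n, φ' β * θ' ^ n) ∈ QuasiHam.inducesSubgroup hc0 :=
    fun β n => (QuasiHam.inducesSubgroup hc0).mul_mem (x := (φ β, φ' β)) (eφ β)
      ((QuasiHam.inducesSubgroup hc0).zpow_mem (x := (θ, θ')) eθ n)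
  obtain ⟨β, n, rfl | rfl⟩ := QuasiHam.B1.exists_eq_mul hq hq' zθ xθ zξ zφ xφ σ
  · exact ⟨H₁, .inl rfl, H₁, .inl rfl, _, hf β n, hI β n⟩
  -- The factor `ξ⁻¹` acts first and goes from `H₂` to `H₁`; the rest stays within `H₁`.
  · exact ⟨H₂, .inr rfl, H₁, .inl rfl, φ β * θ ^ n * ξ⁻¹, iξ.symm.trans (hf β n),
      (QuasiHam.inducesSubgroup hc0).mul_mem (hI β n)
        ((QuasiHam.inducesSubgroup hc0).inv_mem (x := (ξ, ξ')) eξ)⟩
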